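/- All graphs are finite, simple and undirected. For a graph $G=(V,E)$ with $n$ vertices and $V'\subseteq V$, let $E(V')$ be the set of edges with both endpoints in $V'$, and let $E(V',V\setminus V')$ be the set of edges with exactly one endpoint in $V'$. Consider the following two decision problems, whose input is a graph $G$ with vertex set $\{0,\dots,n-1\}$ (given by its adjacency matrix), an integer $k\ge 0$ and an integer $p$. - $k$-densest subgraph: is there a set $V'\subseteq V$ with $|V'|=k$ and $|E(V')|\ge p$? - min $(k,n-k)$-cut: is there a set $V'\subseteq V$ with $|V'|=k$ and $|E(V',V\setminus V')|\le p$? Let $\Delta$ be the maximum degree of $G$ and put $\bar\Delta=\max(\Delta,1)$. Each of the two problems can be solved in time $O^*((\bar\Delta k)^{2k})$, where $0^0=1$. That is, for each of the two problems there are one deterministic algorithm (a program of a random access machine with logarithmic cost) and constants $C,c\in\mathbb N$ such that on every input $(G,k,p)$ the algorithm halts with the correct answer after at most $$C\cdot(\bar\Delta k)^{2k}\cdot N^{c}$$ steps, where $N$ is $n$ plus the bit lengths of $k$ and $p$ (each bit length counted with one additional sign bit). In particular, for graphs with at least one edge the running time is $O^*((\Delta k)^{2k})$. -/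

import Mathlib

/-! ### A random access machine with logarithmic cost

Programs are structured (`while`) programs over integer registers and named, unbounded integer
arrays with indirect addressing. Every operation is charged one step plus the bit lengths of all
the integers it handles, including the addresses used in array accesses. -/

namespace RAM

/-- The bit length of an integer (with one extra bit for the sign, so that it is positive). -/
def bitLen (z : ℤ) : ℕ := z.natAbs.size + 1

/-- The binary operations of the machine. -/
inductive BinOp : Type
  | add | sub | mul | div | le | eq

/-- The result of an operation; comparisons return `1` for true and `0` for false. -/
def BinOp.apply : BinOp → ℤ → ℤ → ℤ
  | .add, a, b => a + b
  | .sub, a, b => a - b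
  | .mul, a, b => a * b
  | .div, a, b => a / b
  | .le, a, b => if a ≤ b then 1 else 0
  | .eq, a, b => if a = b then 1 else 0

/-- Expressions: constants, registers, array cells `A[e]`, and operations. -/
inductive Expr : Type
  | const (c : ℤ)
  | reg (r : ℕ)
  | get (A : ℕ) (e : Expr)
  | op (o : BinOp) (e₁ e₂ : Expr)

/-- Programs. A test succeeds when the expression is nonzero; `loop e P` is the while loop with
test `e` and body `P`. -/
inductive Prog : Type
  | skip
  | assign (r : ℕ) (e : Expr)
  | store (A : ℕ) (i e : Expr)
  | seq (P Q : Prog)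
  | ite (e : Expr) (P Q : Prog)
  | loop (e : Expr) (P : Prog)

/-- A memory configuration: the contents of the registers and of the arrays. -/
structure State : Type where
  reg : ℕ → ℤ
  arr : ℕ → ℤ → ℤ

/-- Write the value `v` into register `r`. -/
def State.setReg (s : State) (r : ℕ) (v : ℤ) : State :=
  { s with reg := Function.update s.reg r v }

/-- Write the value `v` into cell `i` of array `A`. -/
def State.setArr (s : State) (A : ℕ) (i v : ℤ) : State :=
  { s with arr := Function.update s.arr A (Function.update (s.arr A) i v) }

/-- The value of an expression. -/
def Expr.val (s : State) : Expr → ℤ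
  | .const c => c
  | .reg r => s.reg r
  | .get A e => s.arr A (e.val s)
  | .op o e₁ e₂ => o.apply (e₁.val s) (e₂.val s)

/-- The logarithmic cost of evaluating an expression. -/
def Expr.cost (s : State) : Expr → ℕ
  | .const c => 1 + bitLen c
  | .reg r => 1 + bitLen (s.reg r)
  | .get A e => 1 + e.cost s + bitLen (e.val s) + bitLen (s.arr A (e.val s))
  | .op _ e₁ e₂ => 1 + e₁.cost s + e₂.cost s + bitLen (e₁.val s) + bitLen (e₂.val s)

/-- `Exec P s s' t`: started in `s`, the program `P` halts in `s'` after time exactly `t`. -/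
inductive Exec : Prog → State → State → ℕ → Prop
  | skip (s : State) : Exec .skip s s 1
  | assign (s : State) (r : ℕ) (e : Expr) :
      Exec (.assign r e) s (s.setReg r (e.val s)) (1 + e.cost s + bitLen (e.val s))
  | store (s : State) (A : ℕ) (i e : Expr) :
      Exec (.store A i e) s (s.setArr A (i.val s) (e.val s))
        (1 + i.cost s + e.cost s + bitLen (i.val s) + bitLen (e.val s))
  | seq {P Q : Prog} {s s' s'' : State} {t t' : ℕ} :
      Exec P s s' t → Exec Q s' s'' t' → Exec (.seq P Q) s s'' (t + t')
  | ite_true {e : Expr} {P Q : Prog} {s s' : State} {t : ℕ} :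
      e.val s ≠ 0 → Exec P s s' t → Exec (.ite e P Q) s s' (1 + e.cost s + t)
  | ite_false {e : Expr} {P Q : Prog} {s s' : State} {t : ℕ} :
      e.val s = 0 → Exec Q s s' t → Exec (.ite e P Q) s s' (1 + e.cost s + t)
  | loop_true {e : Expr} {P : Prog} {s s' s'' : State} {t t' : ℕ} :
      e.val s ≠ 0 → Exec P s s' t → Exec (.loop e P) s' s'' t' →
      Exec (.loop e P) s s'' (1 + e.cost s + t + t')
  | loop_false {e : Expr} {P : Prog} {s : State} :
      e.val s = 0 → Exec (.loop e P) s s (1 + e.cost s)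

end RAM

/-! ### Local graph partitioning problems -/

namespace LocalPartition

/-- `m₁ = |E(S)|`: the number of edges with both endpoints in `S`. -/
noncomputable def innerEdges {V : Type*} (G : SimpleGraph V) (S : Finset V) : ℕ :=
  {e ∈ G.edgeSet | ∀ v ∈ e, v ∈ S}.ncard

/-- `m₂ = |E(S, V \ S)|`: the number of edges with exactly one endpoint in `S`. -/
noncomputable def cutEdges {V : Type*} (G : SimpleGraph V) (S : Finset V) : ℕ :=
  {e ∈ G.edgeSet | (∃ v ∈ e, v ∈ S) ∧ ∃ v ∈ e, v ∉ S}.ncard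

/-- The value `α₁ m₁ + α₂ m₂` of a vertex set. -/
noncomputable def value {V : Type*} (α₁ α₂ : ℝ) (G : SimpleGraph V) (S : Finset V) : ℝ :=
  α₁ * innerEdges G S + α₂ * cutEdges G S

/-- The two possible goals of an optimization problem. -/
inductive Goal : Type
  | min | max

/-- A value `x` meets the threshold `p`: at most `p` when minimizing, at least `p` when
maximizing. -/
def Goal.Meets : Goal → ℝ → ℝ → Prop
  | .min, x, p => x ≤ p
  | .max, x, p => p ≤ x

/-- A decision problem on a graph with vertex set `{0, …, n - 1}` and integers `k`, `p`: the
predicate that holds at the yes-instances. -/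
abbrev Problem : Type := (n : ℕ) → SimpleGraph (Fin n) → (k : ℕ) → (p : ℤ) → Prop

/-- The local graph partitioning problem with parameters `goal, α₁, α₂`: is there a vertex set of
size exactly `k` whose value is at most (at least) `p`? -/
def localProblem (goal : Goal) (α₁ α₂ : ℝ) : Problem := fun _ G k p =>
  ∃ S, S.card = k ∧ goal.Meets (value α₁ α₂ G S) p

/-- `k`-densest subgraph. -/
def kDensestSubgraph : Problem := localProblem .max 1 0

/-- Min `(k, n - k)`-cut. -/
def minCut : Problem := localProblem .min 0 1

open Classical in
/-- The machine's input: registers `0, 1, 2` hold `n, k, p`, array `0` holds the adjacency matrix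
of the graph, row by row, and everything else is zero. -/
noncomputable def input {n : ℕ} (G : SimpleGraph (Fin n)) (k : ℕ) (p : ℤ) : RAM.State where
  reg r := if r = 0 then (n : ℤ) else if r = 1 then (k : ℤ) else if r = 2 then p else 0
  arr A z :=
    if A = 0 ∧ ∃ i j : Fin n, G.Adj i j ∧ z = (i : ℤ) * (n : ℤ) + (j : ℤ) then 1 else 0

/-- The size of an instance. -/
def inputSize (n k : ℕ) (p : ℤ) : ℕ := n + RAM.bitLen k + RAM.bitLen p

/-- The maximum degree of a graph. -/
noncomputable def maxDeg {n : ℕ} (G : SimpleGraph (Fin n)) : ℕ := by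
  classical exact G.maxDegree

/-- `SolvableInOStar Pb f`: the problem `Pb` can be solved in time `O*(f(Δ, k))`. A single program
halts on every instance within time `f(Δ, k)` times a polynomial in the instance size and leaves
the answer (`1` for yes, `0` for no) in register `0`. -/
def SolvableInOStar (Pb : Problem) (f : ℕ → ℕ → ℕ) : Prop :=
  ∃ (P : RAM.Prog) (C c : ℕ), ∀ (n : ℕ) (G : SimpleGraph (Fin n)) (k : ℕ) (p : ℤ),
    ∃ (s : RAM.State) (t : ℕ), RAM.Exec P (input G k p) s t ∧
      (Pb n G k p → s.reg 0 = 1) ∧ (¬ Pb n G k p → s.reg 0 = 0) ∧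
      t ≤ C * f (maxDeg G) k * inputSize n k p ^ c

end LocalPartition

open Finset

/-! Both problems minimize one objective over vertex sets of size `k`: vertex weights minus twice
the number of inner edges. Zero weights give densest subgraph, with threshold `-2 * p`; degrees as
weights give the cut. This objective is additive over connected components and subadditive over
disjoint sets, because edges between two sets only lower the cost of their union.

For each size `s ≤ k`, pick greedily up to `k` disjoint sets of size `s`, each at most as expensive
as every connected set of size `s` on the vertices not used so far. Let `W s` be the union of the
picked sets; it has at most `k * s` vertices. Split an optimal solution into connected pieces. If a
piece `C` of size `s` avoids `W s`, then `k` sets were picked, all at most as expensive as `C`. The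
other pieces have fewer than `k` vertices, so one picked set is disjoint from all of them and can
replace `C`. Repeating this (`Family.exists_hit`) yields an optimal solution in which every piece
meets the hitting set of its size.

Such a solution has a short code. Put `Y = k * D` with `D = max Δ 1`. A piece of size `s` is
described by its size, by the index below `k * s` of a vertex in `W s`, and then, vertex by vertex,
by the position of an earlier neighbour and an index in that vertex's neighbour list, which is one
digit below `Y`. This takes at most `2 * s` digits in base `Y` (`exists_code_block`), hence `2 * k`
in all (`exists_codes_le`), and trying all `Y ^ (2 * k)` codes solves the problem. Filling the table
of hitting sets is cheaper: a connected set of size `s` with a given first vertex needs only `s - 1`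
digits, so `Y ^ k` codes per first vertex suffice (`exists_codes_grown`).

The rest verifies a concrete program. `Runs` is a total-correctness judgement in which time is
measured in units proportional to the length of a bound `H` on all stored numbers. Here `H` is about
`Y ^ (2 * k)` plus terms from `n` and `p`, so a unit is polynomial in the input size. -/

namespace LocalPartition

/-! ### Costs, connected pieces and the exchange argument. -/

/-- The uniform objective: vertex weights minus twice the number of inner edges. -/
def cost (a : ℕ → ℕ → ℤ) (c : ℕ → ℤ) (S : Finset ℕ) : ℤ :=
  ∑ u ∈ S, c u - ∑ u ∈ S, ∑ v ∈ S, a u v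

theorem cost_union {a : ℕ → ℕ → ℤ} {c : ℕ → ℤ} {S T : Finset ℕ} (h : Disjoint S T) :
    cost a c (S ∪ T) = cost a c S + cost a c T
      - (∑ u ∈ S, ∑ v ∈ T, a u v) - ∑ u ∈ T, ∑ v ∈ S, a u v := by
  simp only [cost, sum_union h, sum_add_distrib]
  ring

/-- Edges between the two sets are subtracted only in the union. Hence a set inserted by an exchange
may be adjacent to the remaining pieces without harm. -/
theorem cost_union_le {a : ℕ → ℕ → ℤ} {c : ℕ → ℤ} (ha : ∀ u v, 0 ≤ a u v) {S T : Finset ℕ}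
    (h : Disjoint S T) : cost a c (S ∪ T) ≤ cost a c S + cost a c T := by
  rw [cost_union h]
  have h₁ : 0 ≤ ∑ u ∈ S, ∑ v ∈ T, a u v := sum_nonneg fun u _ => sum_nonneg fun v _ => ha u v
  have h₂ : 0 ≤ ∑ u ∈ T, ∑ v ∈ S, a u v := sum_nonneg fun u _ => sum_nonneg fun v _ => ha u v
  linarith

/-- Connectedness of a vertex set, by edge cuts. -/
def Conn (a : ℕ → ℕ → ℤ) (C : Finset ℕ) : Prop :=
  C.Nonempty ∧ ∀ D ⊆ C, D.Nonempty → D ≠ C → ∃ u ∈ D, ∃ v ∈ C \ D, a u v ≠ 0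

/-- A sequence of distinct vertices each of which, from the second on, has an earlier neighbour. -/
def Grown (a : ℕ → ℕ → ℤ) (f : ℕ → ℕ) (s : ℕ) : Prop :=
  (∀ i < s, ∀ j < s, f i = f j → i = j) ∧ ∀ i, 0 < i → i < s → ∃ j < i, a (f j) (f i) ≠ 0

/-- As long as the listed vertices form a proper subset of `C`, an edge leaves them inside `C` and
supplies the next vertex. The first vertex is arbitrary, so it can be chosen in a hitting set. -/
theorem Conn.exists_grown {a : ℕ → ℕ → ℤ} {C : Finset ℕ} (hC : Conn a C) {r : ℕ} (hr : r ∈ C) :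
    ∃ f : ℕ → ℕ, f 0 = r ∧ (range C.card).image f = C ∧ Grown a f C.card := by
  have key : ∀ m, m + 1 ≤ C.card → ∃ f : ℕ → ℕ, f 0 = r ∧ (range (m + 1)).image f ⊆ C ∧
      Grown a f (m + 1) := by
    intro m
    induction m with
    | zero =>
      intro _
      refine ⟨fun _ => r, rfl, ?_, ?_, ?_⟩
      · intro x hx
        simp at hx
        exact hx ▸ hr
      · intro i hi j hj _
        omega
      · intro i hi hi'
        omega
    | succ m ih =>
      intro hm
      obtain ⟨f, h0, hsub, hinj, hgr⟩ := ih (by omega)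
      have hcard : ((range (m + 1)).image f).card = m + 1 := by
        rw [card_image_of_injOn, card_range]
        intro i hi j hj hij
        exact hinj i (by simpa using hi) j (by simpa using hj) hij
      obtain ⟨u, hu, v, hv, huv⟩ := hC.2 _ hsub ⟨f 0, mem_image_of_mem f (by simp)⟩ (by
        intro h
        rw [h] at hcard
        omega)
      obtain ⟨j, hj, rfl⟩ := mem_image.1 hu
      rw [mem_sdiff] at hv
      have hj' : j < m + 1 := by simpa using hj
      have hne : ∀ i < m + 1, f i ≠ v := fun i hi h =>
        hv.2 (mem_image.2 ⟨i, by simpa using hi, h⟩)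
      refine ⟨Function.update f (m + 1) v, by simp [h0], ?_, ?_, ?_⟩
      · intro x hx
        obtain ⟨i, hi, rfl⟩ := mem_image.1 hx
        rcases eq_or_ne i (m + 1) with rfl | hne'
        · simpa using hv.1
        · rw [Function.update_of_ne hne']
          have : i < m + 1 := by have := mem_range.1 hi; omega
          exact hsub (mem_image_of_mem f (by simpa using this))
      · intro i hi i' hi' h
        simp only [Function.update_apply] at h
        split_ifs at h with h1 h2 h2
        · omega
        · exact absurd h.symm (hne i' (by omega))
        · exact absurd h (hne i (by omega))
        · exact hinj i (by omega) i' (by omega) h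
      · intro i hi hi'
        rcases eq_or_ne i (m + 1) with rfl | hne'
        · refine ⟨j, hj', ?_⟩
          rw [Function.update_of_ne (by omega), Function.update_self]
          exact huv
        · obtain ⟨j', hj', h⟩ := hgr i hi (by omega)
          refine ⟨j', hj', ?_⟩
          rw [Function.update_of_ne (by omega), Function.update_of_ne hne']
          exact h
  have hpos : 0 < C.card := card_pos.2 hC.1
  obtain ⟨f, h0, hsub, hg⟩ := key (C.card - 1) (by omega)
  rw [Nat.sub_add_cancel hpos] at hsub hg
  refine ⟨f, h0, eq_of_subset_of_card_le hsub ?_, hg⟩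
  rw [card_image_of_injOn, card_range]
  intro i hi j hj hij
  exact hg.1 i (by simpa using hi) j (by simpa using hj) hij

/-- A list of pairwise disjoint connected subsets of `S` with total size `k` and total cost at most
`z`. -/
structure Family (a : ℕ → ℕ → ℤ) (c : ℕ → ℤ) (S : Finset ℕ) (k : ℕ) (z : ℤ)
    (F : List (Finset ℕ)) : Prop where
  conn : ∀ C ∈ F, Conn a C
  sub : ∀ C ∈ F, C ⊆ S
  disj : F.Pairwise Disjoint
  card : (F.map Finset.card).sum = k
  cost_le : (F.map (cost a c)).sum ≤ z

theorem Family.length_le {a : ℕ → ℕ → ℤ} {c : ℕ → ℤ} {S : Finset ℕ} {k : ℕ} {z : ℤ}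
    {F : List (Finset ℕ)} (h : Family a c S k z F) : F.length ≤ k := by
  rw [← h.card]
  have := List.card_nsmul_le_sum (F.map Finset.card) 1 (by
    intro x hx
    obtain ⟨C, hC, rfl⟩ := List.mem_map.1 hx
    exact card_pos.2 (h.conn C hC).1)
  simpa using this

theorem Family.append {a : ℕ → ℕ → ℤ} {c : ℕ → ℤ} {S T U : Finset ℕ} {k l : ℕ} {y z : ℤ}
    {F E : List (Finset ℕ)} (hF : Family a c S k y F) (hE : Family a c T l z E)
    (hS : S ⊆ U) (hT : T ⊆ U) (h : ∀ C ∈ F, ∀ D ∈ E, Disjoint C D) :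
    Family a c U (k + l) (y + z) (F ++ E) where
  conn C hC := (List.mem_append.1 hC).elim (hF.conn C) (hE.conn C)
  sub C hC := (List.mem_append.1 hC).elim (fun h => (hF.sub C h).trans hS)
    (fun h => (hE.sub C h).trans hT)
  disj := List.pairwise_append.2 ⟨hF.disj, hE.disj, h⟩
  card := by rw [List.map_append, List.sum_append, hF.card, hE.card]
  cost_le := by
    rw [List.map_append, List.sum_append]
    exact add_le_add hF.cost_le hE.cost_le

/-- Splitting a vertex set into connected pieces. -/
theorem exists_family {a : ℕ → ℕ → ℤ} (hs : ∀ u v, a u v = a v u) (c : ℕ → ℤ) (S : Finset ℕ) :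
    ∃ F, Family a c S S.card (cost a c S) F ∧ (F = [S] ∨ S = ∅ ∨ 2 ≤ F.length) := by
  induction hm : S.card using Nat.strong_induction_on generalizing S with
  | _ m ih =>
  subst hm
  rcases S.eq_empty_or_nonempty with rfl | hne
  · exact ⟨[], ⟨by simp, by simp, by simp, by simp, by simp [cost]⟩, by simp⟩
  by_cases hc : Conn a S
  · exact ⟨[S], ⟨by simpa using hc, by simp, by simp, by simp, by simp⟩, by simp⟩
  simp only [Conn, hne, true_and] at hc
  push Not at hc
  obtain ⟨D, hD, hDn, hDS, h0⟩ := hc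
  have hlt : D.card < S.card := card_lt_card (hD.ssubset_of_ne hDS)
  have hsum : (S \ D).card + D.card = S.card := card_sdiff_add_card_eq_card hD
  have hpos : 0 < D.card := card_pos.2 hDn
  obtain ⟨F, hF, hF'⟩ := ih D.card hlt D rfl
  obtain ⟨E, hE, hE'⟩ := ih (S \ D).card (by omega) (S \ D) rfl
  have hcost : cost a c S = cost a c D + cost a c (S \ D) := by
    conv_lhs => rw [← union_sdiff_of_subset hD, cost_union disjoint_sdiff]
    have h1 : ∑ u ∈ D, ∑ v ∈ S \ D, a u v = 0 :=
      sum_eq_zero fun u hu => sum_eq_zero fun v hv => h0 u hu v hv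
    have h2 : ∑ u ∈ S \ D, ∑ v ∈ D, a u v = 0 :=
      sum_eq_zero fun u hu => sum_eq_zero fun v hv => by rw [hs]; exact h0 v hv u hu
    rw [h1, h2]
    ring
  refine ⟨F ++ E, ?_, Or.inr (Or.inr ?_)⟩
  · rw [hcost, ← hsum, add_comm (S \ D).card]
    refine hF.append hE hD sdiff_subset fun C hC B hB => ?_
    exact disjoint_of_subset_left (hF.sub C hC)
      (disjoint_of_subset_right (hE.sub B hB) disjoint_sdiff)
  · have h1 : 1 ≤ F.length := by
      rcases hF' with rfl | rfl | h
      · simp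
      · simp at hpos
      · omega
    have h2 : 1 ≤ E.length := by
      rcases hE' with h | h | h
      · simp [h]
      · rw [h] at hsum
        simp at hsum
        omega
      · omega
    rw [List.length_append]
    omega

/-- `W` contains `k` disjoint sets of size `s`, each at least as cheap as any given connected set
of size `s` that avoids `W`. -/
def Hitting (a : ℕ → ℕ → ℤ) (c : ℕ → ℤ) (V : Finset ℕ) (j s : ℕ) (W : Finset ℕ) : Prop :=
  ∀ C ⊆ V, Conn a C → C.card = s → Disjoint C W →
    ∃ B : ℕ → Finset ℕ, (∀ i < j, B i ⊆ W ∧ B i ⊆ V ∧ (B i).card = s ∧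
      cost a c (B i) ≤ cost a c C) ∧ ∀ i < j, ∀ i' < j, i ≠ i' → Disjoint (B i) (B i')

theorem Family.of_perm {a : ℕ → ℕ → ℤ} {c : ℕ → ℤ} {S : Finset ℕ} {k : ℕ} {z : ℤ}
    {F E : List (Finset ℕ)} (h : Family a c S k z F) (hp : F.Perm E) : Family a c S k z E where
  conn C hC := h.conn C (hp.mem_iff.2 hC)
  sub C hC := h.sub C (hp.mem_iff.2 hC)
  disj := hp.pairwise h.disj (fun h => h.symm)
  card := by rw [← (hp.map _).sum_eq, h.card]
  cost_le := by rw [← (hp.map _).sum_eq]; exact h.cost_le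

theorem card_foldr_union_le (F : List (Finset ℕ)) :
    (F.foldr (· ∪ ·) ∅).card ≤ (F.map Finset.card).sum := by
  induction F with
  | nil => simp
  | cons C F ih =>
    simp only [List.foldr_cons, List.map_cons, List.sum_cons]
    exact (card_union_le _ _).trans (by omega)

theorem subset_foldr_union {F : List (Finset ℕ)} {C : Finset ℕ} (h : C ∈ F) :
    C ⊆ F.foldr (· ∪ ·) ∅ := by
  induction F with
  | nil => simp at h
  | cons D F ih =>
    rcases List.mem_cons.1 h with rfl | h
    · exact subset_union_left
    · exact (ih h).trans subset_union_right

/-- The exchange argument: every family can be changed into one, of no larger cost, all of whose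
members meet the hitting set of their size. -/
theorem Family.exists_hit {a : ℕ → ℕ → ℤ} (hs : ∀ u v, a u v = a v u) {c : ℕ → ℤ} {V : Finset ℕ}
    {k : ℕ} {z : ℤ} {W : ℕ → Finset ℕ} (hW : ∀ s, 1 ≤ s → s ≤ k → Hitting a c V k s (W s))
    {F : List (Finset ℕ)} (hF : Family a c V k z F) :
    ∃ E, Family a c V k z E ∧ ∀ C ∈ E, ¬ Disjoint C (W C.card) := by
  classical
  -- The number of members plus the number of members that meet their hitting set is at most `2 *
  -- k`, and every exchange increases it.
  induction hm : 2 * k - (F.length + F.countP fun C => decide (¬ Disjoint C (W C.card)))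
    using Nat.strong_induction_on generalizing F with
  | _ m ih =>
  by_cases hall : ∀ C ∈ F, ¬ Disjoint C (W C.card)
  · exact ⟨F, hF, hall⟩
  push Not at hall
  obtain ⟨C, hCF, hCW⟩ := hall
  have hp := List.perm_cons_erase hCF
  set l := F.erase C with hl
  have hF' := hF.of_perm hp
  have hC : Conn a C := hF.conn C hCF
  have hcard := hF'.card
  have hcost := hF'.cost_le
  have hdisj := List.pairwise_cons.1 hF'.disj
  rw [List.map_cons, List.sum_cons] at hcard hcost
  have hpos : 0 < C.card := card_pos.2 hC.1
  obtain ⟨B, hB, hBd⟩ := hW C.card hpos (by omega) C (hF.sub C hCF) hC rfl hCW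
  set U := l.foldr (· ∪ ·) ∅ with hU
  have hUc : U.card < k := (card_foldr_union_le l).trans_lt (by omega)
  -- Pigeonhole: if all `k` disjoint sets met `U`, they would do so in distinct vertices, but `U`
  -- has fewer than `k`.
  obtain ⟨j, hj, hjU⟩ : ∃ j < k, Disjoint (B j) U := by
    by_contra! h
    have h' : ∀ j, ∃ u, j < k → u ∈ B j ∧ u ∈ U := by
      intro j
      by_cases hj : j < k
      · obtain ⟨u, hu⟩ := not_disjoint_iff.1 (h j hj)
        exact ⟨u, fun _ => hu⟩
      · exact ⟨0, fun h => absurd h hj⟩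
    choose u hu using h'
    have : (range k).card ≤ U.card := by
      refine card_le_card_of_injOn u (fun j hj => (hu j (by simpa using hj)).2) ?_
      intro i hi j hj hij
      by_contra hne
      have hi' : i < k := by simpa using hi
      have hj' : j < k := by simpa using hj
      exact disjoint_left.1 (hBd i hi' j hj' hne) (hu i hi').1 (hij ▸ (hu j hj').1)
    rw [card_range] at this
    omega
  obtain ⟨hBW, hBV, hBs, hBc⟩ := hB j hj
  -- The replacement need not be connected, so it is split again; splitting preserves the total
  -- cost.
  obtain ⟨E, hE, hE'⟩ := exists_family hs c (B j)
  have hlfam : Family a c V (k - C.card) (z - cost a c C) l :=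
    ⟨fun D hD => hF'.conn D (List.mem_cons_of_mem _ hD),
      fun D hD => hF'.sub D (List.mem_cons_of_mem _ hD), hdisj.2, by omega, by linarith⟩
  have hnew := hE.append hlfam hBV subset_rfl (fun D hD D' hD' =>
    disjoint_of_subset_left (hE.sub D hD) (disjoint_of_subset_right (subset_foldr_union hD') hjU))
  have hnew' : Family a c V k z (E ++ l) :=
    ⟨hnew.conn, hnew.sub, hnew.disj, by rw [hnew.card]; omega, hnew.cost_le.trans (by linarith)⟩
  have hlen := hnew'.length_le
  have hcnt : (E ++ l).countP (fun C => decide (¬ Disjoint C (W C.card))) ≤ (E ++ l).length :=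
    List.countP_le_length
  have hFlen : F.length = l.length + 1 := by rw [hp.length_eq, List.length_cons]
  have hFcnt : F.countP (fun C => decide (¬ Disjoint C (W C.card))) =
      l.countP (fun C => decide (¬ Disjoint C (W C.card))) := by
    rw [hp.countP_eq, List.countP_cons_of_neg (by simpa using hCW)]
  refine ih _ ?_ hnew' rfl
  subst hm
  rw [List.length_append, List.countP_append, hFlen, hFcnt]
  rw [List.length_append] at hlen hcnt
  rw [List.countP_append] at hcnt
  -- If `B j` stays in one piece, that piece lies in its hitting set and the count of hitting
  -- members grows; if it splits, the number of members grows. It cannot be empty, since it has the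
  -- size of `C`.
  rcases hE' with rfl | h | h
  · have h1 : List.countP (fun C => decide (¬ Disjoint C (W C.card))) [B j] = 1 := by
      have : ¬ Disjoint (B j) (W (B j).card) := by
        rw [hBs]
        intro h
        have hne : (B j).Nonempty := card_pos.1 (by omega)
        obtain ⟨u, hu⟩ := hne
        exact disjoint_left.1 h hu (hBW hu)
      simp [this]
    rw [h1, List.length_singleton] at hcnt ⊢
    rw [List.length_singleton] at hlen
    omega
  · rw [h] at hBs
    simp at hBs
    omega
  · omega

end LocalPartition

namespace RAM

/-! ### Bit lengths and the logarithmic cost of expressions. -/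

theorem bitLen_mono {x y : ℤ} (h : x.natAbs ≤ y.natAbs) : bitLen x ≤ bitLen y :=
  Nat.succ_le_succ (Nat.size_le_size h)

theorem bitLen_le_of_abs_le {x : ℤ} {H : ℕ} (h : |x| ≤ H) : bitLen x ≤ bitLen H :=
  bitLen_mono (by rw [Int.natAbs_natCast]; have := abs_le.1 h; omega)

theorem one_le_bitLen (x : ℤ) : 1 ≤ bitLen x := Nat.le_add_left _ _

theorem natAbs_lt_two_pow_bitLen (x : ℤ) : 2 * x.natAbs < 2 ^ bitLen x := by
  have := Nat.lt_size_self x.natAbs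
  rw [bitLen, pow_succ]
  omega

theorem bitLen_le {x : ℤ} {m : ℕ} (h : x.natAbs < 2 ^ m) : bitLen x ≤ m + 1 :=
  Nat.succ_le_succ (Nat.size_le.2 h)

/-- The possible carry bit is paid for by the second of the two sign bits on the right. -/
theorem bitLen_add_natAbs_le {x y z : ℤ} (h : z.natAbs ≤ x.natAbs + y.natAbs) :
    bitLen z ≤ bitLen x + bitLen y := by
  have hx := Nat.lt_size_self x.natAbs
  have hy := Nat.lt_size_self y.natAbs
  have h1 : 2 ^ x.natAbs.size ≤ 2 ^ (x.natAbs.size + y.natAbs.size) :=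
    Nat.pow_le_pow_right (by omega) (by omega)
  have h2 : 2 ^ y.natAbs.size ≤ 2 ^ (x.natAbs.size + y.natAbs.size) :=
    Nat.pow_le_pow_right (by omega) (by omega)
  have h3 : bitLen z ≤ (x.natAbs.size + y.natAbs.size + 1) + 1 := bitLen_le (by
    rw [pow_succ]
    omega)
  simp only [bitLen] at *
  omega

theorem bitLen_apply_le (o : BinOp) (x y : ℤ) : bitLen (o.apply x y) ≤ bitLen x + bitLen y := by
  have hx := one_le_bitLen x
  have hy := one_le_bitLen y
  have h0 : bitLen 0 = 1 := rfl
  have h1 : bitLen 1 = 2 := rfl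
  cases o <;> simp only [BinOp.apply]
  · exact bitLen_add_natAbs_le (Int.natAbs_add_le x y)
  · exact bitLen_add_natAbs_le (Int.natAbs_sub_le x y)
  · have : (x * y).natAbs < 2 ^ (x.natAbs.size + y.natAbs.size) := by
      rw [Int.natAbs_mul, pow_add]
      exact Nat.mul_lt_mul'' (Nat.lt_size_self _) (Nat.lt_size_self _)
    have := bitLen_le this
    simp only [bitLen] at *
    omega
  · exact (bitLen_mono (Int.natAbs_ediv_le_natAbs x y)).trans (by omega)
  · split_ifs <;> omega
  · split_ifs <;> omega

/-- The number of leaves of an expression. -/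
def Expr.size : Expr → ℕ
  | .const _ => 1
  | .reg _ => 1
  | .get _ _ => 1
  | .op _ e₁ e₂ => e₁.size + e₂.size

/-- The cost of an expression, in units of the length of the largest number in memory. -/
def Expr.weight : Expr → ℕ
  | .const _ => 2
  | .reg _ => 2
  | .get _ e => e.weight + e.size + 2
  | .op _ e₁ e₂ => e₁.weight + e₂.weight + e₁.size + e₂.size + 1

/-- All constants of the expression are at most `2` in absolute value. -/
def Expr.consts : Expr → Bool
  | .const c => decide (c.natAbs ≤ 2)
  | .reg _ => true
  | .get _ e => e.consts
  | .op _ e₁ e₂ => e₁.consts && e₂.consts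

/-- Expressions of bounded complexity. -/
def Expr.Light (e : Expr) : Prop := e.consts = true ∧ e.weight + e.size + 1 ≤ 100

instance (e : Expr) : Decidable e.Light := inferInstanceAs (Decidable (_ ∧ _))

/-- All numbers in memory are at most `H` in absolute value. -/
def Small (H : ℕ) (s : State) : Prop := (∀ r, |s.reg r| ≤ H) ∧ ∀ A z, |s.arr A z| ≤ H

/-- Only stored numbers are bounded by `H`; intermediate values may exceed it. But no operation, not
even a product, does more than add the lengths of its arguments, so the length is linear in the
number of leaves. -/
theorem Expr.bitLen_val_le {H : ℕ} (hH : 2 ≤ H) {s : State} (hs : Small H s) (e : Expr)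
    (he : e.consts = true) : bitLen (e.val s) ≤ e.size * bitLen H := by
  induction e with
  | const c =>
    simp only [Expr.consts, decide_eq_true_eq] at he
    simpa [Expr.size, Expr.val] using bitLen_mono (y := H) (by simpa using he.trans hH)
  | reg r => simpa [Expr.size, Expr.val] using bitLen_le_of_abs_le (hs.1 r)
  | get A e ih => simpa [Expr.size, Expr.val] using bitLen_le_of_abs_le (hs.2 A _)
  | op o e₁ e₂ ih₁ ih₂ =>
    simp only [Expr.consts, Bool.and_eq_true] at he
    simp only [Expr.size, Expr.val, add_mul]
    exact (bitLen_apply_le _ _ _).trans (add_le_add (ih₁ he.1) (ih₂ he.2))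

theorem Expr.cost_le {H : ℕ} (hH : 2 ≤ H) {s : State} (hs : Small H s) (e : Expr)
    (he : e.consts = true) : e.cost s ≤ e.weight * bitLen H := by
  have h1 := one_le_bitLen H
  induction e with
  | const c =>
    have := Expr.bitLen_val_le hH hs _ he
    simp only [Expr.size, Expr.val, Expr.cost, Expr.weight] at *
    omega
  | reg r =>
    have := Expr.bitLen_val_le hH hs _ he
    simp only [Expr.size, Expr.val, Expr.cost, Expr.weight] at *
    omega
  | get A e ih =>
    have h2 := Expr.bitLen_val_le hH hs _ he
    have h3 := Expr.bitLen_val_le hH hs e he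
    have h4 := ih he
    simp only [Expr.size, Expr.val, Expr.cost, Expr.weight, add_mul] at *
    omega
  | op o e₁ e₂ ih₁ ih₂ =>
    simp only [Expr.consts, Bool.and_eq_true] at he
    have h2 := Expr.bitLen_val_le hH hs _ he.1
    have h3 := Expr.bitLen_val_le hH hs _ he.2
    have h4 := ih₁ he.1
    have h5 := ih₂ he.2
    simp only [Expr.cost, Expr.weight, add_mul] at *
    omega

theorem Expr.Light.total_le {e : Expr} (h : e.Light) {H : ℕ} (hH : 2 ≤ H) {s : State}
    (hs : Small H s) : 1 + e.cost s + bitLen (e.val s) ≤ 100 * bitLen H := by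
  have h1 := e.cost_le hH hs h.1
  have h2 := e.bitLen_val_le hH hs h.1
  have h3 := one_le_bitLen H
  have h4 := Nat.mul_le_mul_right (bitLen H) h.2
  simp only [add_mul] at h4
  omega

@[simp] theorem State.reg_setReg (s : State) (r : ℕ) (v : ℤ) (r' : ℕ) :
    (s.setReg r v).reg r' = if r' = r then v else s.reg r' := by
  simp [State.setReg, Function.update_apply]

@[simp] theorem State.arr_setReg (s : State) (r : ℕ) (v : ℤ) : (s.setReg r v).arr = s.arr := rfl

@[simp] theorem State.reg_setArr (s : State) (A : ℕ) (i v : ℤ) : (s.setArr A i v).reg = s.reg :=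
  rfl

@[simp] theorem State.arr_setArr (s : State) (A : ℕ) (i v : ℤ) (A' : ℕ) (z : ℤ) :
    (s.setArr A i v).arr A' z = if A' = A then (if z = i then v else s.arr A z) else s.arr A' z := by
  by_cases h : A' = A
  · subst h
    simp [State.setArr, Function.update_apply]
  · simp [State.setArr, h]

theorem Small.setReg {H : ℕ} {s : State} (hs : Small H s) (r : ℕ) {v : ℤ} (hv : |v| ≤ H) :
    Small H (s.setReg r v) := by
  refine ⟨fun r' => ?_, hs.2⟩
  rw [State.reg_setReg]
  split_ifs
  exacts [hv, hs.1 _]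

theorem Small.setArr {H : ℕ} {s : State} (hs : Small H s) (A : ℕ) (i : ℤ) {v : ℤ}
    (hv : |v| ≤ H) : Small H (s.setArr A i v) := by
  refine ⟨hs.1, fun A' z => ?_⟩
  rw [State.arr_setArr]
  split_ifs
  exacts [hv, hs.2 _ _, hs.2 _ _]

/-! ### Frame conditions and a Hoare logic with time bounds. -/

/-- Whether the program can write to the register. -/
def Prog.writesReg : Prog → ℕ → Bool
  | .skip, _ => false
  | .assign r _, r' => r == r'
  | .store _ _ _, _ => false
  | .seq P Q, r' => P.writesReg r' || Q.writesReg r'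
  | .ite _ P Q, r' => P.writesReg r' || Q.writesReg r'
  | .loop _ P, r' => P.writesReg r'

/-- Whether the program can write to the array. -/
def Prog.writesArr : Prog → ℕ → Bool
  | .skip, _ => false
  | .assign _ _, _ => false
  | .store A _ _, A' => A == A'
  | .seq P Q, A' => P.writesArr A' || Q.writesArr A'
  | .ite _ P Q, A' => P.writesArr A' || Q.writesArr A'
  | .loop _ P, A' => P.writesArr A'

/-- The registers and arrays that the program does not write to are unchanged. -/
structure Frame (P : Prog) (s s' : State) : Prop where
  reg : ∀ r, P.writesReg r = false → s'.reg r = s.reg r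
  arr : ∀ A, P.writesArr A = false → s'.arr A = s.arr A

theorem Exec.frame {P : Prog} {s s' : State} {t : ℕ} (h : Exec P s s' t) : Frame P s s' := by
  induction h with
  | skip s => exact ⟨fun _ _ => rfl, fun _ _ => rfl⟩
  | assign s r e =>
    refine ⟨fun r' h => ?_, fun _ _ => rfl⟩
    simp only [Prog.writesReg, beq_eq_false_iff_ne] at h
    simp [h.symm]
  | store s A i e =>
    refine ⟨fun _ _ => rfl, fun A' h => ?_⟩
    simp only [Prog.writesArr, beq_eq_false_iff_ne] at h
    ext z
    simp [h.symm]
  | seq _ _ ih₁ ih₂ =>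
    refine ⟨fun r h => ?_, fun A h => ?_⟩
    · simp only [Prog.writesReg, Bool.or_eq_false_iff] at h
      rw [ih₂.reg r h.2, ih₁.reg r h.1]
    · simp only [Prog.writesArr, Bool.or_eq_false_iff] at h
      rw [ih₂.arr A h.2, ih₁.arr A h.1]
  | ite_true _ _ ih =>
    refine ⟨fun r h => ?_, fun A h => ?_⟩
    · simp only [Prog.writesReg, Bool.or_eq_false_iff] at h
      exact ih.reg r h.1
    · simp only [Prog.writesArr, Bool.or_eq_false_iff] at h
      exact ih.arr A h.1
  | ite_false _ _ ih =>
    refine ⟨fun r h => ?_, fun A h => ?_⟩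
    · simp only [Prog.writesReg, Bool.or_eq_false_iff] at h
      exact ih.reg r h.2
    · simp only [Prog.writesArr, Bool.or_eq_false_iff] at h
      exact ih.arr A h.2
  | loop_true _ _ _ ih₁ ih₂ =>
    exact ⟨fun r h => (ih₂.reg r h).trans (ih₁.reg r h),
      fun A h => (ih₂.arr A h).trans (ih₁.arr A h)⟩
  | loop_false _ => exact ⟨fun _ _ => rfl, fun _ _ => rfl⟩

/-- Started in `s` with memory bounded by `H`, the program halts in a state satisfying `Q` after at
most `T` units of time, where a unit is `200` times the length of `H`. -/
def Runs (H : ℕ) (P : Prog) (s : State) (T : ℕ) (Q : State → Prop) : Prop :=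
  Small H s → ∃ s' t, Exec P s s' t ∧ t ≤ T * (200 * bitLen H) ∧ Small H s' ∧ Q s'

section rules
variable {H : ℕ} {P P' : Prog} {s : State} {T T' : ℕ} {Q R : State → Prop}

theorem Runs.mono (h : Runs H P s T Q) (hT : T ≤ T') (hQ : ∀ s', Q s' → R s') :
    Runs H P s T' R := fun hs =>
  let ⟨s', t, h₁, h₂, h₃, h₄⟩ := h hs
  ⟨s', t, h₁, h₂.trans (Nat.mul_le_mul_right _ hT), h₃, hQ _ h₄⟩

theorem Runs.time_le (h : Runs H P s T Q) (hT : T ≤ T') : Runs H P s T' Q :=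
  h.mono hT fun _ => id

theorem Runs.of_small (h : Small H s → Runs H P s T Q) : Runs H P s T Q := fun hs => h hs hs

theorem Runs.frame (h : Runs H P s T Q) : Runs H P s T fun s' => Q s' ∧ Frame P s s' := fun hs =>
  let ⟨s', t, h₁, h₂, h₃, h₄⟩ := h hs
  ⟨s', t, h₁, h₂, h₃, h₄, h₁.frame⟩

theorem Runs.seq (h : Runs H P s T fun s' => Runs H P' s' T' Q) :
    Runs H (.seq P P') s (T + T') Q := fun hs => by
  obtain ⟨s', t, h₁, h₂, h₃, h₄⟩ := h hs
  obtain ⟨s'', t', h₁', h₂', h₃', h₄'⟩ := h₄ h₃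
  exact ⟨s'', _, .seq h₁ h₁', by rw [add_mul]; omega, h₃', h₄'⟩

theorem Runs.skip (h : Q s) : Runs H .skip s 1 Q := fun hs =>
  ⟨s, 1, .skip s, by have := one_le_bitLen H; omega, hs, h⟩

theorem Runs.assign {r : ℕ} {e : Expr} (hH : 2 ≤ H) (he : e.Light)
    (hv : Small H s → |e.val s| ≤ H) (h : Q (s.setReg r (e.val s))) :
    Runs H (.assign r e) s 1 Q := fun hs =>
  ⟨_, _, .assign s r e, (he.total_le hH hs).trans (by omega), hs.setReg r (hv hs), h⟩

/-- Two light expressions are evaluated, each within `100 * bitLen H`; this is why the unit of time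
has the factor `200`. -/
theorem Runs.store {A : ℕ} {i e : Expr} (hH : 2 ≤ H) (hi : i.Light) (he : e.Light)
    (hv : Small H s → |e.val s| ≤ H) (h : Q (s.setArr A (i.val s) (e.val s))) :
    Runs H (.store A i e) s 1 Q := fun hs =>
  ⟨_, _, .store s A i e, by
    have := hi.total_le hH hs
    have := he.total_le hH hs
    omega, hs.setArr A _ (hv hs), h⟩

theorem Runs.ite {e : Expr} (hH : 2 ≤ H) (he : e.Light) (h : e.val s ≠ 0 → Runs H P s T Q)
    (h' : e.val s = 0 → Runs H P' s T' Q) : Runs H (.ite e P P') s (1 + T + T') Q := fun hs => by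
  have h0 := he.total_le hH hs
  have h1 := Nat.zero_le (T * (200 * bitLen H))
  have h2 := Nat.zero_le (T' * (200 * bitLen H))
  by_cases hc : e.val s = 0
  · obtain ⟨s', t, h₁, h₂, h₃, h₄⟩ := h' hc hs
    exact ⟨s', _, .ite_false hc h₁, by simp only [add_mul]; omega, h₃, h₄⟩
  · obtain ⟨s', t, h₁, h₂, h₃, h₄⟩ := h hc hs
    exact ⟨s', _, .ite_true hc h₁, by simp only [add_mul]; omega, h₃, h₄⟩

end rules

/-- The loop `for r < m do P`, where `r` has been initialized. -/
def forLoop (r m : ℕ) (P : Prog) : Prog :=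
  .loop (.op .le (.op .add (.reg r) (.const 1)) (.reg m))
    (.seq P (.assign r (.op .add (.reg r) (.const 1))))

/-- Each pass costs the body plus one unit for the test and one for the increment; the final `+ 1`
is the failing test. The step also receives the frame relative to the initial state `s`, so
invariants need not mention memory that the loop leaves alone. -/
theorem Runs.forLoop {H r m : ℕ} {P : Prog} {s : State} {T a b : ℕ} (hH : 2 ≤ H)
    (inv : ℕ → State → Prop) (hr : P.writesReg r = false) (hm : P.writesReg m = false)
    (hrm : r ≠ m) (ha : s.reg r = a) (hb : s.reg m = b) (hab : a ≤ b) (h0 : inv a s)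
    (step : ∀ i, a ≤ i → i < b → ∀ s' : State, s'.reg r = i → Frame (forLoop r m P) s s' → inv i s' →
      Runs H P s' T fun s'' => inv (i + 1) (s''.setReg r ((i + 1 : ℕ) : ℤ))) :
    Runs H (forLoop r m P) s (b * (T + 2) + 1)
      fun s' : State => inv b s' ∧ s'.reg r = b ∧ Frame (forLoop r m P) s s' := by
  have main : ∀ d i : ℕ, i + d = b → a ≤ i → ∀ s' : State, s'.reg r = i → Frame (RAM.forLoop r m P) s s' →
      inv i s' → Runs H (RAM.forLoop r m P) s' (d * (T + 2) + 1)
        fun s' : State => inv b s' ∧ s'.reg r = b ∧ Frame (RAM.forLoop r m P) s s' := by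
    have hwm : (RAM.forLoop r m P).writesReg m = false := by
      simp [RAM.forLoop, Prog.writesReg, hm, hrm]
    have hl : (Expr.op .le (.op .add (.reg r) (.const 1)) (.reg m)).Light := by
      simp [Expr.Light, Expr.consts, Expr.weight, Expr.size]
    have hl' : (Expr.op .add (.reg r) (.const 1)).Light := by
      simp [Expr.Light, Expr.consts, Expr.weight, Expr.size]
    intro d
    induction d with
    | zero =>
      intro i hi hai s' hs' hF hinv hsm
      have hmv : s'.reg m = b := (hF.reg m hwm).trans hb
      refine ⟨s', _, .loop_false ?_, ?_, hsm, ?_, ?_, hF⟩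
      · simp only [Expr.val, BinOp.apply, hs', hmv]
        rw [if_neg (by omega)]
      · have := hl.total_le hH hsm
        omega
      · have : i = b := by omega
        exact this ▸ hinv
      · have : i = b := by omega
        exact this ▸ hs'
    | succ d ih =>
      intro i hi hai s' hs' hF hinv hsm
      have hmv : s'.reg m = b := (hF.reg m hwm).trans hb
      have hib : i < b := by omega
      have hstep : Runs H (.seq P (.assign r (.op .add (.reg r) (.const 1)))) s' (T + 1)
          fun s'' => inv (i + 1) s'' ∧ s''.reg r = ((i + 1 : ℕ) : ℤ) := by
        refine Runs.seq ((step i hai hib s' hs' hF hinv).frame.mono le_rfl ?_)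
        rintro s₁ ⟨h₁, hF₁⟩
        have hr₁ : s₁.reg r = i := (hF₁.reg r hr).trans hs'
        have hval : (Expr.op .add (.reg r) (.const 1)).val s₁ = ((i + 1 : ℕ) : ℤ) := by
          simp [Expr.val, BinOp.apply, hr₁]
        refine Runs.assign hH hl' (fun hs₁ => ?_) ?_
        · have h2 := hsm.1 m
          rw [hmv] at h2
          rw [hval, abs_of_nonneg (by positivity)]
          rw [abs_of_nonneg (by positivity)] at h2
          omega
        · rw [hval]
          exact ⟨h₁, by simp⟩
      obtain ⟨s₁, t₁, e₁, ht₁, hsm₁, hinv₁, hr₁⟩ := hstep hsm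
      have hF₁ : Frame (RAM.forLoop r m P) s s₁ :=
        ⟨fun r' h => (e₁.frame.reg r' h).trans (hF.reg r' h),
          fun A h => (e₁.frame.arr A h).trans (hF.arr A h)⟩
      obtain ⟨s₂, t₂, e₂, ht₂, hsm₂, hQ⟩ := ih (i + 1) (by omega) (by omega) s₁ hr₁ hF₁ hinv₁ hsm₁
      refine ⟨s₂, _, .loop_true ?_ e₁ e₂, ?_, hsm₂, hQ⟩
      · simp only [Expr.val, BinOp.apply, hs', hmv]
        rw [if_pos (by omega)]
        norm_num
      · have := hl.total_le hH hsm
        have hsplit : ((d + 1) * (T + 2) + 1) * (200 * bitLen H) =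
            (d * (T + 2) + 1) * (200 * bitLen H) + (T + 1) * (200 * bitLen H)
              + 200 * bitLen H := by ring
        omega
  have hF0 : Frame (RAM.forLoop r m P) s s := ⟨fun _ _ => rfl, fun _ _ => rfl⟩
  refine (main (b - a) a (by omega) le_rfl s ha hF0 h0).time_le ?_
  have := Nat.mul_le_mul_right (T + 2) (Nat.sub_le b a)
  omega

end RAM

namespace RAM

theorem Runs.assign_eq {H : ℕ} {s : State} {Q : State → Prop} {r : ℕ} {e : Expr} (v : ℤ)
    (hH : 2 ≤ H) (he : e.Light) (hv : e.val s = v) (hb : Small H s → |v| ≤ H)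
    (h : Q (s.setReg r v)) : Runs H (.assign r e) s 1 Q := by
  subst hv
  exact Runs.assign hH he hb h

theorem Runs.store_eq {H : ℕ} {s : State} {Q : State → Prop} {A : ℕ} {i e : Expr} (z v : ℤ)
    (hH : 2 ≤ H) (hi : i.Light) (he : e.Light) (hz : i.val s = z) (hv : e.val s = v)
    (hb : Small H s → |v| ≤ H) (h : Q (s.setArr A z v)) : Runs H (.store A i e) s 1 Q := by
  subst hv hz
  exact Runs.store hH hi he hb h

theorem abs_natCast_le {m H : ℕ} (h : m ≤ H) : |(m : ℤ)| ≤ H := by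
  rw [abs_of_nonneg (by positivity)]
  exact_mod_cast h

theorem Small.le_of_reg {H : ℕ} {s : State} (hs : Small H s) {r m : ℕ} (h : s.reg r = m) :
    m ≤ H := by
  have := hs.1 r
  rw [h, abs_of_nonneg (by positivity)] at this
  exact_mod_cast this

/-- The remainder as an expression. -/
def Expr.mod (e₁ e₂ : Expr) : Expr := .op .sub e₁ (.op .mul (.op .div e₁ e₂) e₂)

theorem Expr.val_mod {s : State} {e₁ e₂ : Expr} {x y : ℕ} (h₁ : e₁.val s = x) (h₂ : e₂.val s = y) :
    (e₁.mod e₂).val s = ((x % y : ℕ) : ℤ) := by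
  simp only [Expr.mod, Expr.val, BinOp.apply, h₁, h₂]
  push_cast
  rw [Int.emod_def]
  ring

end RAM

namespace LocalPartition
open RAM

/-! ### Decoding a number into a list of vertices. -/

/-- The fixed data of a run: parameters, adjacency matrix, vertex weights, neighbour lists. -/
structure Inst where
  (n k D Y : ℕ)
  a : ℕ → ℕ → ℤ
  c : ℕ → ℤ
  NB : ℕ → ℕ

/-- The memory holds the data. -/
structure Ctx (I : Inst) (s : State) : Prop where
  n : s.reg 0 = I.n
  k : s.reg 1 = I.k
  D : s.reg 3 = I.D
  Y : s.reg 4 = I.Y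
  a : ∀ u < I.n, ∀ v < I.n, s.arr 0 ((u : ℤ) * I.n + v) = I.a u v
  c : ∀ u < I.n, s.arr 1 u = I.c u
  nb : ∀ z : ℕ, s.arr 2 z = I.NB z

theorem Ctx.congr {I : Inst} {s s' : State} (h : Ctx I s)
    (hr : ∀ r ∈ [0, 1, 3, 4], s'.reg r = s.reg r) (ha : ∀ A ∈ [0, 1, 2], s'.arr A = s.arr A) :
    Ctx I s' where
  n := (hr 0 (by simp)).trans h.n
  k := (hr 1 (by simp)).trans h.k
  D := (hr 3 (by simp)).trans h.D
  Y := (hr 4 (by simp)).trans h.Y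
  a u hu v hv := by rw [ha 0 (by simp)]; exact h.a u hu v hv
  c u hu := by rw [ha 1 (by simp)]; exact h.c u hu
  nb z := by rw [ha 2 (by simp)]; exact h.nb z

theorem Ctx.frame {I : Inst} {s s' : State} {P : Prog} (h : Ctx I s) (hF : Frame P s s')
    (hr : ∀ r ∈ [0, 1, 3, 4], P.writesReg r = false := by decide)
    (ha : ∀ A ∈ [0, 1, 2], P.writesArr A = false := by decide) : Ctx I s' :=
  h.congr (fun r h => hF.reg r (hr r h)) (fun A h => hF.arr A (ha A h))

/-- The state of the decoder: the rest of the code, the number of vertices missing from the current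
block, and the list of vertices. -/
structure Dec where
  (x rem : ℕ)
  L : ℕ → ℕ

/-- One step of the decoder: the `i`-th vertex is a neighbour of a listed vertex, or starts a new
block. -/
def Dec.step (I : Inst) (R : ℕ → ℕ) (i : ℕ) (d : Dec) : Dec :=
  if d.rem ≠ 0 then
    ⟨d.x / I.Y, d.rem - 1,
      Function.update d.L i (I.NB (d.L (d.x % I.Y / I.D) * I.n + d.x % I.Y % I.D))⟩
  -- The header digit is the block size minus one: this is the number of vertices still missing
  -- after the root, and its successor is the row of the table. The root index takes two digits,
  -- except for blocks of size one, where one digit suffices.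
  else if d.x % I.Y ≠ 0 then
    ⟨d.x / I.Y / (I.Y * I.Y), d.x % I.Y,
      Function.update d.L i (R ((d.x % I.Y + 1) * (I.k * I.k) + d.x / I.Y % (I.Y * I.Y)))⟩
  else
    ⟨d.x / I.Y / I.Y, d.x % I.Y,
      Function.update d.L i (R ((d.x % I.Y + 1) * (I.k * I.k) + d.x / I.Y % I.Y))⟩

/-- The memory holds the state of the decoder. -/
structure Dec.Rep (d : Dec) (s : State) : Prop where
  x : s.reg 15 = d.x
  rem : s.reg 16 = d.rem
  L : ∀ z : ℕ, s.arr 5 z = d.L z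

/-- The program for one step of the decoder. -/
def decodeStep : Prog :=
  .seq (.assign 28 (.mod (.reg 15) (.reg 4)))
  (.seq (.assign 15 (.op .div (.reg 15) (.reg 4)))
  (.ite (.reg 16)
    (.seq (.store 5 (.reg 17) (.get 2 (.op .add
        (.op .mul (.get 5 (.op .div (.reg 28) (.reg 3))) (.reg 0)) (.mod (.reg 28) (.reg 3)))))
      (.assign 16 (.op .sub (.reg 16) (.const 1))))
    (.seq (.assign 16 (.reg 28))
    (.seq (.ite (.reg 16)
        (.seq (.assign 29 (.mod (.reg 15) (.op .mul (.reg 4) (.reg 4))))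
          (.assign 15 (.op .div (.reg 15) (.op .mul (.reg 4) (.reg 4)))))
        (.seq (.assign 29 (.mod (.reg 15) (.reg 4)))
          (.assign 15 (.op .div (.reg 15) (.reg 4)))))
      (.store 5 (.reg 17) (.get 3 (.op .add
        (.op .mul (.op .add (.reg 16) (.const 1)) (.op .mul (.reg 1) (.reg 1))) (.reg 29))))))))

theorem Dec.Rep.runs_step {H : ℕ} (hH : 2 ≤ H) {I : Inst} {R : ℕ → ℕ} {d : Dec} {s : State}
    {i : ℕ} (hc : Ctx I s) (hR : ∀ z : ℕ, s.arr 3 z = R z) (hd : d.Rep s) (hi : s.reg 17 = i)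
    (hNH : ∀ z, I.NB z ≤ H) (hRH : ∀ z, R z ≤ H) :
    Runs H decodeStep s 14 (d.step I R i).Rep := by
  refine Runs.of_small fun hs => ?_
  have hx := hs.le_of_reg hd.x
  have hrem := hs.le_of_reg hd.rem
  have hxY : d.x % I.Y ≤ H := (Nat.mod_le _ _).trans hx
  have hxY' : d.x / I.Y ≤ H := (Nat.div_le_self _ _).trans hx
  obtain ⟨hn, hk, hD, hY, -, -, hnb⟩ := hc
  obtain ⟨x, rem, L⟩ := d
  obtain ⟨hdx, hdr, hdL⟩ := hd
  simp only at *
  refine Runs.time_le (T := 1 + (1 + (1 + (1 + 1) + (1 + ((1 + (1 + 1) + (1 + 1)) + 1))))) ?_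
    (by norm_num)
  refine Runs.seq (Runs.assign_eq ((x % I.Y : ℕ) : ℤ) hH (by decide)
    (Expr.val_mod (by simpa [Expr.val] using hdx) (by simpa [Expr.val] using hY))
    (fun _ => abs_natCast_le hxY) ?_)
  refine Runs.seq (Runs.assign_eq ((x / I.Y : ℕ) : ℤ) hH (by decide)
    (by simp [Expr.val, BinOp.apply, hdx, hY]) (fun _ => abs_natCast_le hxY') ?_)
  refine Runs.ite hH (by decide) (fun h0 => ?_) (fun h0 => ?_)
  · have hr0 : rem ≠ 0 := by
      intro h
      simp [Expr.val, hdr, h] at h0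
    refine Runs.seq (Runs.store_eq (i : ℤ)
      (I.NB (L (x % I.Y / I.D) * I.n + x % I.Y % I.D) : ℤ) hH (by decide) (by decide)
      (by simp [Expr.val, hi]) ?_ (fun _ => abs_natCast_le (hNH _)) ?_)
    · rw [← hnb]
      simp only [Expr.val]
      rw [show BinOp.apply .add _ _ = ((L (x % I.Y / I.D) * I.n + x % I.Y % I.D : ℕ) : ℤ) from ?_]
      · simp
      · have h1 : (Expr.op BinOp.div (.reg 28) (.reg 3)).val
            ((s.setReg 28 ((x % I.Y : ℕ) : ℤ)).setReg 15 ((x / I.Y : ℕ) : ℤ)) =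
            ((x % I.Y / I.D : ℕ) : ℤ) := by simp [Expr.val, BinOp.apply, hD]
        simp only [Expr.val] at h1
        rw [Expr.val_mod (x := x % I.Y) (y := I.D) (by simp [Expr.val]) (by simp [Expr.val, hD]),
          h1]
        simp only [State.arr_setReg, hdL, BinOp.apply, State.reg_setReg, hn]
        simp
    · refine Runs.assign_eq ((rem - 1 : ℕ) : ℤ) hH (by decide) ?_
        (fun _ => abs_natCast_le (by omega)) ?_
      · simp [Expr.val, BinOp.apply, hdr]
        omega
      · refine ⟨?_, ?_, fun z => ?_⟩
        · simp [Dec.step, hr0]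
        · simp [Dec.step, hr0]
        · simp [Dec.step, hr0, Function.update_apply, hdL]
  · have hr0 : rem = 0 := by simpa [Expr.val, hdr] using h0
    refine Runs.seq (Runs.assign_eq ((x % I.Y : ℕ) : ℤ) hH (by decide)
      (by simp [Expr.val]) (fun _ => abs_natCast_le hxY) ?_)
    refine Runs.seq (Runs.mono (T := 1 + (1 + 1) + (1 + 1))
      (Q := fun s' => s'.reg 0 = I.n ∧ s'.reg 1 = I.k ∧ s'.reg 16 = (x % I.Y : ℕ) ∧
        s'.reg 17 = i ∧ (∀ z : ℕ, s'.arr 3 z = R z) ∧ (∀ z : ℕ, s'.arr 5 z = L z) ∧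
        s'.reg 29 = (x / I.Y % (if x % I.Y = 0 then I.Y else I.Y * I.Y) : ℕ) ∧
        s'.reg 15 = (x / I.Y / (if x % I.Y = 0 then I.Y else I.Y * I.Y) : ℕ)) ?_ le_rfl ?_)
    · refine Runs.ite hH (by decide) (fun h1 => ?_) (fun h1 => ?_)
      · have h1' : x % I.Y ≠ 0 := by
          intro h
          apply h1
          simp only [Expr.val, State.reg_setReg, if_pos, h]
          rfl
        refine Runs.seq (Runs.assign_eq ((x / I.Y % (I.Y * I.Y) : ℕ) : ℤ) hH (by decide)
          (Expr.val_mod (by simp [Expr.val]) (by simp [Expr.val, hY, BinOp.apply]))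
          (fun _ => abs_natCast_le ((Nat.mod_le _ _).trans hxY')) ?_)
        refine Runs.assign_eq ((x / I.Y / (I.Y * I.Y) : ℕ) : ℤ) hH (by decide)
          (by simp [Expr.val, hY, BinOp.apply])
          (fun _ => abs_natCast_le ((Nat.div_le_self _ _).trans hxY')) ?_
        rw [if_neg h1']
        simp [hn, hk, hi, hR, hdL]
      · have h1' : x % I.Y = 0 := by
          simp only [Expr.val, State.reg_setReg, if_pos] at h1
          exact_mod_cast h1
        refine Runs.seq (Runs.assign_eq ((x / I.Y % I.Y : ℕ) : ℤ) hH (by decide)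
          (Expr.val_mod (by simp [Expr.val]) (by simp [Expr.val, hY]))
          (fun _ => abs_natCast_le ((Nat.mod_le _ _).trans hxY')) ?_)
        refine Runs.assign_eq ((x / I.Y / I.Y : ℕ) : ℤ) hH (by decide)
          (by simp [Expr.val, hY, BinOp.apply])
          (fun _ => abs_natCast_le ((Nat.div_le_self _ _).trans hxY')) ?_
        rw [if_pos h1']
        simp [hn, hk, hi, hR, hdL]
    · rintro s' ⟨gn, gk, g16, g17, g3, g5, g29, g15⟩
      refine Runs.store_eq (i : ℤ) (R ((x % I.Y + 1) * (I.k * I.k) +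
        x / I.Y % (if x % I.Y = 0 then I.Y else I.Y * I.Y)) : ℤ) hH (by decide) (by decide)
        (by simp [Expr.val, g17]) ?_ (fun _ => abs_natCast_le (hRH _)) ?_
      · rw [← g3]
        simp only [Expr.val, BinOp.apply, g16, gk, g29]
        push_cast
        rfl
      · by_cases h1 : x % I.Y = 0
        · refine ⟨?_, ?_, fun z => ?_⟩
          · simp [Dec.step, hr0, g15, h1]
          · simp [Dec.step, hr0, g16, h1]
          · simp [Dec.step, hr0, Function.update_apply, g5, h1]
        · refine ⟨?_, ?_, fun z => ?_⟩
          · simp [Dec.step, hr0, g15, h1]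
          · simp [Dec.step, hr0, g16, h1]
          · simp [Dec.step, hr0, Function.update_apply, g5, h1]

/-- The decoder after writing the vertices `i, …, i + m - 1`. -/
def Dec.iter (I : Inst) (R : ℕ → ℕ) : ℕ → ℕ → Dec → Dec
  | _, 0, d => d
  | i, m + 1, d => Dec.iter I R (i + 1) m (d.step I R i)

/-- `Dec.iter` peels off the first step. This form peels off the last one, as the loop invariant
needs, and concatenates the codes of blocks. -/
theorem Dec.iter_add (I : Inst) (R : ℕ → ℕ) (l m : ℕ) : ∀ (i : ℕ) (d : Dec),
    Dec.iter I R i (l + m) d = Dec.iter I R (i + l) m (Dec.iter I R i l d) := by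
  induction l with
  | zero => intro i d; simp [Dec.iter]
  | succ l ih =>
    intro i d
    rw [Nat.add_right_comm]
    simp only [Dec.iter]
    rw [ih]
    congr 1
    omega

/-- The decoding loop. -/
def decodeProg : Prog := forLoop 17 8 decodeStep

theorem runs_decode {H : ℕ} (hH : 2 ≤ H) {I : Inst} {R : ℕ → ℕ} {d : Dec} {s : State}
    {i₀ m : ℕ} (hc : Ctx I s) (hR : ∀ z : ℕ, s.arr 3 z = R z) (hd : d.Rep s) (hi : s.reg 17 = i₀)
    (hm : s.reg 8 = m) (him : i₀ ≤ m) (hNH : ∀ z, I.NB z ≤ H) (hRH : ∀ z, R z ≤ H) :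
    Runs H decodeProg s (m * 16 + 1) (Dec.iter I R i₀ (m - i₀) d).Rep := by
  refine (Runs.forLoop (T := 14) hH (fun i => (Dec.iter I R i₀ (i - i₀) d).Rep) rfl rfl (by decide)
    hi hm him (by simpa [Dec.iter] using hd) ?_).mono le_rfl fun s' h => h.1
  intro i hi₀ him' s' hs' hF hrep
  refine (hrep.runs_step (i := i) hH (hc.frame hF) (fun z => ?_) hs' hNH hRH).mono le_rfl ?_
  · rw [hF.arr 3 rfl]
    exact hR z
  · intro s'' h
    rw [show i + 1 - i₀ = (i - i₀) + 1 by omega, Dec.iter_add,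
      show i₀ + (i - i₀) = i by omega]
    exact ⟨by simpa [Dec.iter] using h.x, by simpa [Dec.iter] using h.rem,
      by simpa [Dec.iter] using h.L⟩

open RAM

/-! ### Evaluating a list of vertices. -/

/-- The cost of a sequence of vertices. -/
def costSeq (I : Inst) (f : ℕ → ℕ) (m : ℕ) : ℤ :=
  ∑ i ∈ range m, (I.c (f i) - ∑ j ∈ range m, I.a (f i) (f j))

/-- The number of coincidences in a sequence, counting the occurrences of marked vertices. -/
def coincidences (MK f : ℕ → ℕ) (cur : ℤ) (m : ℕ) : ℤ :=
  ∑ i ∈ range m, ((if (MK (f i) : ℤ) = cur then 1 else 0) +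
    ∑ j ∈ range m, if f i = f j then 1 else 0)

/-- The vertices are distinct and unmarked. -/
def Valid (MK f : ℕ → ℕ) (cur : ℤ) (m : ℕ) : Prop :=
  (∀ i < m, ∀ j < m, f i = f j → i = j) ∧ ∀ i < m, (MK (f i) : ℤ) ≠ cur

/-- The diagonal pairs contribute exactly `m` and all other terms are nonnegative, so a single
comparison of the counter with `m` tests validity. -/
theorem coincidences_eq_iff {MK f : ℕ → ℕ} {cur : ℤ} {m : ℕ} :
    coincidences MK f cur m = m ↔ Valid MK f cur m := by
  have hsplit : ∀ i ∈ range m, (∑ j ∈ range m, if f i = f j then (1 : ℤ) else 0) =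
      1 + ∑ j ∈ (range m).erase i, if f i = f j then (1 : ℤ) else 0 := by
    intro i hi
    rw [← add_sum_erase _ _ hi]
    simp
  have hn1 : ∀ i, (0 : ℤ) ≤ if (MK (f i) : ℤ) = cur then 1 else 0 := fun i => by
    split_ifs <;> norm_num
  have hn2 : ∀ i j, (0 : ℤ) ≤ if f i = f j then 1 else 0 := fun i j => by
    split_ifs <;> norm_num
  have hn3 : ∀ i, (0 : ℤ) ≤ ∑ j ∈ (range m).erase i, if f i = f j then 1 else 0 := fun i =>
    sum_nonneg fun j _ => hn2 i j
  have hsum : coincidences MK f cur m = m + ∑ i ∈ range m,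
      ((if (MK (f i) : ℤ) = cur then 1 else 0) +
        ∑ j ∈ (range m).erase i, if f i = f j then (1 : ℤ) else 0) := by
    rw [coincidences, sum_congr rfl fun i hi => by rw [hsplit i hi]]
    simp only [sum_add_distrib]
    simp
    ring
  rw [hsum, add_eq_left, sum_eq_zero_iff_of_nonneg fun i _ => add_nonneg (hn1 i) (hn3 i)]
  constructor
  · intro h
    refine ⟨fun i hi j hj hij => ?_, fun i hi hmk => ?_⟩
    · have h1 := h i (mem_range.2 hi)
      have h2 : ∑ j ∈ (range m).erase i, (if f i = f j then (1 : ℤ) else 0) = 0 := by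
        linarith [hn1 i, hn3 i]
      rw [sum_eq_zero_iff_of_nonneg fun j _ => hn2 i j] at h2
      by_contra hne
      have := h2 j (mem_erase.2 ⟨Ne.symm hne, mem_range.2 hj⟩)
      simp [hij] at this
    · have h1 := h i (mem_range.2 hi)
      rw [if_pos hmk] at h1
      linarith [hn3 i]
  · rintro ⟨h1, h2⟩ i hi
    rw [if_neg (h2 i (mem_range.1 hi)), zero_add]
    refine sum_eq_zero fun j hj => if_neg fun hij => ?_
    rw [mem_erase, mem_range] at hj
    exact hj.1 (h1 i (mem_range.1 hi) j hj.2 hij).symm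

/-- Evaluate the listed vertices: cost in register `19`, coincidences in register `18`. -/
def evalProg : Prog :=
  .seq (.assign 18 (.const 0))
  (.seq (.assign 19 (.const 0))
  (.seq (.assign 20 (.const 0))
  (forLoop 20 8
    (.seq (.assign 19 (.op .add (.reg 19) (.get 1 (.get 5 (.reg 20)))))
    (.seq (.assign 18 (.op .add (.reg 18) (.op .eq (.get 4 (.get 5 (.reg 20))) (.reg 11))))
    (.seq (.assign 21 (.const 0))
    (forLoop 21 8
      (.seq (.assign 19 (.op .sub (.reg 19) (.get 0 (.op .add
          (.op .mul (.get 5 (.reg 20)) (.reg 0)) (.get 5 (.reg 21))))))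
        (.assign 18 (.op .add (.reg 18)
          (.op .eq (.get 5 (.reg 20)) (.get 5 (.reg 21)))))))))))))

/-- General bounds on the data. -/
structure Inst.Bounded (I : Inst) (H : ℕ) : Prop where
  two_le : 2 ≤ H
  sq_le : 4 * I.n * I.n + 4 * I.n + 4 ≤ H
  c_le : ∀ u, |I.c u| ≤ I.n
  a_nonneg : ∀ u v, 0 ≤ I.a u v
  a_le : ∀ u v, I.a u v ≤ 1

theorem runs_eval {H : ℕ} {I : Inst} (hB : I.Bounded H) {s : State} {MK f : ℕ → ℕ} {m : ℕ}
    {cur : ℤ} (hc : Ctx I s) (hMK : ∀ z : ℕ, s.arr 4 z = MK z) (hcur : s.reg 11 = cur)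
    (hm : s.reg 8 = m) (hmn : m ≤ I.n) (hf : ∀ i < m, s.arr 5 i = f i) (hfn : ∀ i < m, f i < I.n) :
    Runs H evalProg s (m * (m * 4 + 6) + 4)
      fun s' => s'.reg 18 = coincidences MK f cur m ∧ s'.reg 19 = costSeq I f m := by
  obtain ⟨hH, hsq, hcb, ha0, ha1⟩ := hB
  -- A completed row changes the running cost by at most `n` for the weight plus `m` for the matrix
  -- entries; `hbound'` is the analogue for the counter, with `1 + m` per row.
  have hbound : ∀ i < m, ∀ j ≤ m, i * (I.n + m) + I.n + j + 1 ≤ H := by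
    intro i hi j hj
    have h1 : (i + 1) * (I.n + m) ≤ I.n * (I.n + I.n) := Nat.mul_le_mul (by omega) (by omega)
    nlinarith
  have hbound' : ∀ i < m, ∀ j ≤ m, i * (1 + m) + 1 + j + 1 ≤ H := by
    intro i hi j hj
    have h1 : (i + 1) * (1 + m) ≤ I.n * (I.n + I.n) := Nat.mul_le_mul (by omega) (by omega)
    nlinarith
  set row : ℕ → ℤ := fun i => I.c (f i) - ∑ j ∈ range m, I.a (f i) (f j) with hrow
  set crow : ℕ → ℤ := fun i => (if (MK (f i) : ℤ) = cur then 1 else 0) +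
    ∑ j ∈ range m, (if f i = f j then 1 else 0) with hcrow
  refine Runs.time_le (T := 1 + (1 + (1 + (m * ((1 + (1 + (1 + (m * (1 + 1 + 2) + 1)))) + 2) + 1))))
    ?_ (by ring_nf; omega)
  refine Runs.seq (Runs.assign_eq 0 hH (by decide) rfl (by simp) ?_)
  refine Runs.seq (Runs.assign_eq 0 hH (by decide) rfl (by simp) ?_)
  refine Runs.seq (Runs.assign_eq 0 hH (by decide) rfl (by simp) ?_)
  refine Runs.mono (Runs.forLoop (a := 0) hH (fun i s' =>
    s'.reg 18 = ∑ i ∈ range i, crow i ∧ s'.reg 19 = ∑ i ∈ range i, row i ∧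
    |s'.reg 18| ≤ (i * (1 + m) : ℕ) ∧ |s'.reg 19| ≤ (i * (I.n + m) : ℕ))
    rfl rfl (by decide) (by simp) (by simp [hm]) (by omega) (by simp) ?_) le_rfl
    fun s' h => ⟨h.1.1, h.1.2.1⟩
  rintro i - him s₁ hi₁ hF ⟨h18, h19, hb18, hb19⟩
  have hc₁ : Ctx I s₁ := (hc.congr (by simp) (by simp)).frame hF
  have hMK₁ : ∀ z : ℕ, s₁.arr 4 z = MK z := fun z => by rw [hF.arr 4 rfl]; exact hMK z
  have hcur₁ : s₁.reg 11 = cur := (hF.reg 11 rfl).trans (by simpa using hcur)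
  have hm₁ : s₁.reg 8 = m := (hF.reg 8 rfl).trans (by simpa using hm)
  have hf₁ : ∀ i < m, s₁.arr 5 i = f i := fun i h => by rw [hF.arr 5 rfl]; exact hf i h
  have hci := abs_le.1 (hcb (f i))
  have hbi := hbound i him 0 (by omega)
  have hbi' := hbound' i him 0 (by omega)
  rw [abs_le] at hb18 hb19
  refine Runs.seq (Runs.assign_eq (s₁.reg 19 + I.c (f i)) hH (by decide)
    (by simp only [Expr.val, BinOp.apply, hi₁, hf₁ i him, hc₁.c _ (hfn i him)])
    (fun _ => abs_le.2 ⟨by omega, by omega⟩) ?_)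
  have hmk : (0 : ℤ) ≤ (if (MK (f i) : ℤ) = cur then 1 else 0) ∧
      (if (MK (f i) : ℤ) = cur then (1 : ℤ) else 0) ≤ 1 := by split_ifs <;> norm_num
  refine Runs.seq (Runs.assign_eq (s₁.reg 18 + if (MK (f i) : ℤ) = cur then 1 else 0) hH
    (by decide) (by simp [Expr.val, BinOp.apply, hi₁, hf₁ i him, hMK₁, hcur₁])
    (fun _ => abs_le.2 ⟨by omega, by omega⟩) ?_)
  refine Runs.seq (Runs.assign_eq 0 hH (by decide) rfl (by simp) ?_)
  refine Runs.mono (Runs.forLoop (a := 0) (b := m) hH (fun j s' =>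
    s'.reg 18 = s₁.reg 18 + ((if (MK (f i) : ℤ) = cur then 1 else 0) +
      ∑ j ∈ range j, if f i = f j then 1 else 0) ∧
    s'.reg 19 = s₁.reg 19 + (I.c (f i) - ∑ j ∈ range j, I.a (f i) (f j)) ∧
    |s'.reg 18| ≤ (i * (1 + m) + 1 + j : ℕ) ∧ |s'.reg 19| ≤ (i * (I.n + m) + I.n + j : ℕ))
    rfl rfl (by decide) (by simp) (by simp [hm₁]) (by omega) ?_ ?_) le_rfl ?_
  · refine ⟨by simp, by simp, ?_, ?_⟩
    · simp only [State.reg_setReg]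
      norm_num
      exact abs_le.2 ⟨by push_cast at *; omega, by push_cast at *; omega⟩
    · simp only [State.reg_setReg]
      norm_num
      exact abs_le.2 ⟨by push_cast at *; omega, by push_cast at *; omega⟩
  · rintro j - hjm s₂ hj₂ hF₂ ⟨g18, g19, gb18, gb19⟩
    have hc₂ : Ctx I s₂ := (hc₁.congr (by simp) (by simp)).frame hF₂
    have hf₂ : ∀ i < m, s₂.arr 5 i = f i := fun i h => by rw [hF₂.arr 5 rfl]; exact hf₁ i h
    have hi₂ : s₂.reg 20 = i := (hF₂.reg 20 rfl).trans (by simpa using hi₁)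
    have hbj := hbound i him j (by omega)
    have hbj' := hbound' i him j (by omega)
    have e0 := ha0 (f i) (f j)
    have e1 := ha1 (f i) (f j)
    rw [abs_le] at gb18 gb19
    refine Runs.seq (Runs.assign_eq (s₂.reg 19 - I.a (f i) (f j)) hH (by decide)
      (by simp only [Expr.val, BinOp.apply, hi₂, hj₂, hf₂ i him, hf₂ j hjm, hc₂.n,
        hc₂.a _ (hfn i him) _ (hfn j hjm)])
      (fun _ => abs_le.2 ⟨by omega, by omega⟩) ?_)
    have he : (0 : ℤ) ≤ (if f i = f j then 1 else 0) ∧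
      (if f i = f j then (1 : ℤ) else 0) ≤ 1 := by split_ifs <;> norm_num
    refine Runs.assign_eq (s₂.reg 18 + if f i = f j then 1 else 0) hH (by decide)
      (by simp [Expr.val, BinOp.apply, hi₂, hj₂, hf₂ i him, hf₂ j hjm])
      (fun _ => abs_le.2 ⟨by omega, by omega⟩) ?_
    refine ⟨?_, ?_, ?_, ?_⟩
    · rw [sum_range_succ]
      simp [g18]
      ring
    · simp [sum_range_succ, g19]
      ring
    · simp only [State.reg_setReg]
      norm_num
      exact abs_le.2 ⟨by push_cast at *; omega, by push_cast at *; omega⟩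
    · simp only [State.reg_setReg]
      norm_num
      exact abs_le.2 ⟨by push_cast at *; omega, by push_cast at *; omega⟩
  · rintro s₂ ⟨⟨g18, g19, gb18, gb19⟩, -⟩
    refine ⟨?_, ?_, ?_, ?_⟩
    · simp [sum_range_succ, g18, h18, hcrow]
    · rw [sum_range_succ]
      simp only [State.reg_setReg, g19, h19, hrow]
      simp
    · rw [show (i + 1) * (1 + m) = i * (1 + m) + 1 + m by ring]
      simpa using gb18
    · rw [show (i + 1) * (I.n + m) = i * (I.n + m) + I.n + m by ring]
      simpa using gb19

open RAM

/-! ### Searching all codes below a bound. -/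

/-- Save the current list of vertices and its cost as the best one. -/
def saveProg : Prog :=
  .seq (.assign 13 (.reg 19)) (.seq (.assign 22 (.const 0))
    (forLoop 22 8 (.store 6 (.reg 22) (.get 5 (.reg 22)))))

theorem runs_save {H : ℕ} (hH : 2 ≤ H) {s : State} {f : ℕ → ℕ} {m : ℕ} {z : ℤ}
    (hm : s.reg 8 = m) (hz : s.reg 19 = z) (hf : ∀ i < m, s.arr 5 i = f i) :
    Runs H saveProg s (m * 3 + 3) fun s' => s'.reg 13 = z ∧ ∀ i < m, s'.arr 6 i = f i := by
  refine Runs.time_le (T := 1 + (1 + (m * (1 + 2) + 1))) ?_ (by omega)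
  refine Runs.seq (Runs.assign hH (by decide) (fun hs => hs.1 19) ?_)
  refine Runs.seq (Runs.assign_eq 0 hH (by decide) rfl (by simp) ?_)
  refine (Runs.forLoop (a := 0) (b := m) hH (fun j s' => ∀ i < j, s'.arr 6 i = f i)
    rfl rfl (by decide) (by simp) (by simp [hm]) (by omega) (by simp) ?_).mono le_rfl ?_
  · rintro j - hj s₁ hj₁ hF hinv
    have hf₁ : s₁.arr 5 j = f j := by rw [hF.arr 5 rfl]; exact hf j hj
    refine Runs.store hH (by decide) (by decide) (fun hs => hs.2 5 _) ?_
    intro i hi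
    simp only [Expr.val, hj₁, hf₁, State.arr_setReg, State.arr_setArr, if_true]
    split_ifs with h
    · rw [Nat.cast_inj] at h
      rw [h]
    · exact hinv i (by
        rw [Nat.cast_inj] at h
        omega)
  · rintro s' ⟨h, -, hF⟩
    refine ⟨?_, h⟩
    rw [hF.reg 13 rfl]
    simp [Expr.val, hz]

/-- Try one code: decode, evaluate, and compare with the best list so far. -/
def tryProg : Prog :=
  .seq (.assign 15 (.reg 14)) (.seq (.assign 16 (.reg 10)) (.seq (.store 5 (.const 0) (.reg 12))
  (.seq (.assign 17 (.reg 9)) (.seq decodeProg (.seq evalProg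
  (.ite (.op .eq (.reg 18) (.reg 8)) (.ite (.op .le (.reg 13) (.reg 19)) .skip saveProg)
    .skip))))))

/-- Try all codes below the number in register `7`. -/
def searchProg : Prog := .seq (.assign 14 (.const 0)) (forLoop 14 7 tryProg)

/-- The code `x` yields the sequence `f`, independently of the previous contents of the list. -/
def Codes (I : Inst) (R : ℕ → ℕ) (v rem i₀ m x : ℕ) (f : ℕ → ℕ) : Prop :=
  ∀ L : ℕ → ℕ, ∀ i < m, (Dec.iter I R i₀ (m - i₀) ⟨x, rem, Function.update L 0 v⟩).L i = f i

/-- The best list is a valid sequence with the cost that is stored. -/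
def Saved (I : Inst) (MK : ℕ → ℕ) (cur : ℤ) (m : ℕ) (s : State) : Prop :=
  ∃ f : ℕ → ℕ, (∀ i < m, f i < I.n) ∧ Valid MK f cur m ∧ s.reg 13 = costSeq I f m ∧
    ∀ i < m, s.arr 6 i = f i

/-- Even a meaningless code decodes to vertices, so the evaluation stays inside the matrix. It is
applied with `N = max n 1`, because untouched cells hold `0` even when `n = 0`. -/
theorem Dec.iter_lt {I : Inst} {R : ℕ → ℕ} {N : ℕ} (hNB : ∀ z, I.NB z < N) (hR : ∀ z, R z < N)
    (m : ℕ) : ∀ (i : ℕ) (d : Dec), (∀ z, d.L z < N) → ∀ z, (Dec.iter I R i m d).L z < N := by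
  induction m with
  | zero => intro i d h; exact h
  | succ m ih =>
    intro i d h
    refine ih _ _ fun z => ?_
    simp only [Dec.step]
    split_ifs <;> simp only [Function.update_apply] <;> split_ifs <;>
      first | exact hNB _ | exact hR _ | exact h _

/-- The memory during a search. -/
structure SearchCtx (I : Inst) (R MK : ℕ → ℕ) (cur : ℤ) (v rem i₀ m M : ℕ) (s : State) :
    Prop where
  ctx : Ctx I s
  R : ∀ z : ℕ, s.arr 3 z = R z
  MK : ∀ z : ℕ, s.arr 4 z = MK z
  M : s.reg 7 = M
  m : s.reg 8 = m
  i₀ : s.reg 9 = i₀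
  rem : s.reg 10 = rem
  cur : s.reg 11 = cur
  v : s.reg 12 = v

theorem SearchCtx.frame {I : Inst} {R MK : ℕ → ℕ} {cur : ℤ} {v rem i₀ m M : ℕ} {s s' : State}
    {P : Prog} (h : SearchCtx I R MK cur v rem i₀ m M s) (hF : Frame P s s')
    (hr : ∀ r ∈ [0, 1, 3, 4, 7, 8, 9, 10, 11, 12], P.writesReg r = false := by decide)
    (ha : ∀ A ∈ [0, 1, 2, 3, 4], P.writesArr A = false := by decide) :
    SearchCtx I R MK cur v rem i₀ m M s' where
  ctx := h.ctx.frame hF (fun r h => hr r (by simp at h ⊢; omega))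
    (fun r h => ha r (by simp at h ⊢; omega))
  R z := by rw [hF.arr 3 (ha 3 (by simp))]; exact h.R z
  MK z := by rw [hF.arr 4 (ha 4 (by simp))]; exact h.MK z
  M := (hF.reg 7 (hr 7 (by simp))).trans h.M
  m := (hF.reg 8 (hr 8 (by simp))).trans h.m
  i₀ := (hF.reg 9 (hr 9 (by simp))).trans h.i₀
  rem := (hF.reg 10 (hr 10 (by simp))).trans h.rem
  cur := (hF.reg 11 (hr 11 (by simp))).trans h.cur
  v := (hF.reg 12 (hr 12 (by simp))).trans h.v

/-- Meaningless codes do no harm: a list is saved only after it has passed the validity test.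
Conversely, a code of a valid list `f` leaves a stored cost no larger than that of `f`. -/
theorem runs_try {H : ℕ} {I : Inst} (hB : I.Bounded H) {R MK : ℕ → ℕ} {cur : ℤ}
    {v rem i₀ m M x : ℕ} {s : State} (hc : SearchCtx I R MK cur v rem i₀ m M s)
    (hx : s.reg 14 = x) (him : i₀ ≤ m) (hmn : m ≤ I.n) (hNB : ∀ z, I.NB z < max I.n 1)
    (hR : ∀ z, R z < max I.n 1) (hv : v < max I.n 1) {L : ℕ → ℕ} (hL : ∀ z : ℕ, s.arr 5 z = L z)
    (hLn : ∀ z, L z < max I.n 1) :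
    Runs H tryProg s (m * (m * 4 + 30) + 20) fun s' =>
      (∃ L' : ℕ → ℕ, (∀ z : ℕ, s'.arr 5 z = L' z) ∧ ∀ z, L' z < max I.n 1) ∧
      s'.reg 13 ≤ s.reg 13 ∧
      ((s'.reg 13 = s.reg 13 ∧ s'.arr 6 = s.arr 6) ∨ Saved I MK cur m s') ∧
      ∀ f, Codes I R v rem i₀ m x f → Valid MK f cur m → s'.reg 13 ≤ costSeq I f m := by
  refine Runs.of_small fun hs => ?_
  have hH := hB.two_le
  have hnH : max I.n 1 ≤ H := by
    have := hB.sq_le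
    have : 0 ≤ 4 * I.n * I.n := Nat.zero_le _
    omega
  refine Runs.time_le (T := 1 + (1 + (1 + (1 + ((m * 16 + 1) + ((m * (m * 4 + 6) + 4) +
    (1 + (1 + 1 + (m * 3 + 3)) + 1))))))) ?_ (by ring_nf; omega)
  set d : Dec := ⟨x, rem, Function.update L 0 v⟩ with hd
  set f := (Dec.iter I R i₀ (m - i₀) d).L with hf
  have hdn : ∀ z, d.L z < max I.n 1 := fun z => by
    simp only [hd, Function.update_apply]
    split_ifs
    exacts [hv, hLn z]
  have hfn' : ∀ z, f z < max I.n 1 := Dec.iter_lt hNB hR _ _ _ hdn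
  have hfn : ∀ i < m, f i < I.n := fun i hi => by have := hfn' i; omega
  refine Runs.seq (Runs.assign_eq (x : ℤ) hH (by decide) hx
    (fun hs => abs_natCast_le (hs.le_of_reg hx)) ?_)
  refine Runs.seq (Runs.assign_eq (rem : ℤ) hH (by decide) (by simp [Expr.val, hc.rem])
    (fun _ => abs_natCast_le (hs.le_of_reg hc.rem)) ?_)
  refine Runs.seq (Runs.store_eq 0 (v : ℤ) hH (by decide) (by decide) rfl
    (by simp [Expr.val, hc.v]) (fun _ => abs_natCast_le (by omega)) ?_)
  refine Runs.seq (Runs.assign_eq (i₀ : ℤ) hH (by decide) (by simp [Expr.val, hc.i₀])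
    (fun _ => abs_natCast_le (hs.le_of_reg hc.i₀)) ?_)
  refine Runs.seq ((runs_decode (m := m) (i₀ := i₀) (d := d) hH
    (hc.ctx.congr (by simp) (by intro A hA; ext z; simp at hA ⊢; omega))
    (by simpa using hc.R) ⟨by simp [hd], by simp [hd], fun z => ?_⟩ (by simp)
    (by simp [hc.m]) him (fun z => by have := hNB z; omega)
    (fun z => by have := hR z; omega)).frame.mono le_rfl ?_)
  · simp [hd, Function.update_apply, hL]
  rintro s₁ ⟨hrep, hF₁⟩
  have hc₁ : SearchCtx I R MK cur v rem i₀ m M s₁ := by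
    -- A frame depends only on which registers and arrays are written, so a program with dummy
    -- expressions and the right targets serves.
    have hF : Frame (.seq (.seq (.assign 15 (.reg 0)) (.assign 16 (.reg 0)))
        (.seq (.store 5 (.reg 0) (.reg 0)) (.seq (.assign 17 (.reg 0)) decodeProg))) s s₁ := by
      refine ⟨fun r hr => ?_, fun A hA => ?_⟩
      · simp only [Prog.writesReg, Bool.or_eq_false_iff, beq_eq_false_iff_ne] at hr
        obtain ⟨⟨h15, h16⟩, -, h17, hr⟩ := hr
        rw [hF₁.reg r hr]
        simp [Ne.symm h15, Ne.symm h16, Ne.symm h17]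
      · simp only [Prog.writesArr, Bool.or_eq_false_iff, beq_eq_false_iff_ne] at hA
        obtain ⟨-, h5, -, hA⟩ := hA
        rw [hF₁.arr A hA]
        ext z
        simp [Ne.symm h5]
    exact hc.frame hF
  have h13 : s₁.reg 13 = s.reg 13 := by
    rw [hF₁.reg 13 rfl]
    simp
  have h6 : s₁.arr 6 = s.arr 6 := by
    rw [hF₁.arr 6 rfl]
    ext z
    simp
  refine Runs.seq ((runs_eval hB hc₁.ctx hc₁.MK hc₁.cur hc₁.m hmn (f := f)
    (fun i _ => hrep.L i) hfn).frame.mono le_rfl ?_)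
  rintro s₂ ⟨⟨h18, h19⟩, hF₂⟩
  have hc₂ := hc₁.frame hF₂
  have h13' : s₂.reg 13 = s.reg 13 := (hF₂.reg 13 rfl).trans h13
  have h6' : s₂.arr 6 = s.arr 6 := (hF₂.arr 6 rfl).trans h6
  have hL₂ : ∀ z : ℕ, s₂.arr 5 z = f z := fun z => by rw [hF₂.arr 5 rfl]; exact hrep.L z
  -- The list array is not cleared between codes; `Codes` covers all previous contents, in
  -- particular the actual one `L`.
  have hcodes : ∀ g, Codes I R v rem i₀ m x g → ∀ i < m, f i = g i := fun g hg i hi =>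
    hg L i hi
  have hcost : ∀ g, Codes I R v rem i₀ m x g → costSeq I f m = costSeq I g m := fun g hg => by
    refine sum_congr rfl fun i hi => ?_
    rw [hcodes g hg i (mem_range.1 hi)]
    congr 1
    exact sum_congr rfl fun j hj => by rw [hcodes g hg j (mem_range.1 hj)]
  have hvalid : ∀ g, Codes I R v rem i₀ m x g → Valid MK g cur m → Valid MK f cur m := by
    intro g hg hV
    refine ⟨fun i hi j hj h => hV.1 i hi j hj ?_, fun i hi => ?_⟩
    · rw [← hcodes g hg i hi, ← hcodes g hg j hj, h]
    · rw [hcodes g hg i hi]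
      exact hV.2 i hi
  refine Runs.ite hH (by decide) (fun ht => ?_) (fun ht => ?_)
  · have hV : Valid MK f cur m := by
      rw [← coincidences_eq_iff, ← h18]
      by_contra h
      simp [Expr.val, BinOp.apply, hc₂.m, h] at ht
    refine Runs.ite hH (by decide) (fun ht' => ?_) (fun ht' => ?_)
    · have hle : s₂.reg 13 ≤ s₂.reg 19 := by
        by_contra h
        simp [Expr.val, BinOp.apply, h] at ht'
      refine Runs.skip ⟨⟨f, hL₂, hfn'⟩, h13'.le, Or.inl ⟨h13', h6'⟩, fun g hg _ => ?_⟩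
      rw [← hcost g hg, ← h19]
      exact hle
    · have hlt : s₂.reg 19 < s₂.reg 13 := by
        by_contra h
        simp [Expr.val, BinOp.apply, not_lt.1 h] at ht'
      refine (runs_save hH hc₂.m h19 (fun i _ => hL₂ i)).frame.mono le_rfl ?_
      rintro s₃ ⟨⟨hz, hs₃⟩, hF₃⟩
      refine ⟨⟨f, fun z => ?_, hfn'⟩, ?_, Or.inr ⟨f, hfn, hV, hz, hs₃⟩, fun g hg _ => ?_⟩
      · rw [hF₃.arr 5 rfl]
        exact hL₂ z
      · rw [hz, ← h13', ← h19]
        exact hlt.le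
      · rw [hz, hcost g hg]
  · have hV : ¬ Valid MK f cur m := by
      rw [← coincidences_eq_iff, ← h18]
      intro h
      simp [Expr.val, BinOp.apply, hc₂.m, h] at ht
    exact Runs.skip ⟨⟨f, hL₂, hfn'⟩, h13'.le, Or.inl ⟨h13', h6'⟩,
      fun g hg hg' => absurd (hvalid g hg hg') hV⟩

theorem runs_search {H : ℕ} {I : Inst} (hB : I.Bounded H) {R MK : ℕ → ℕ} {cur : ℤ}
    {v rem i₀ m M : ℕ} {s : State} (hc : SearchCtx I R MK cur v rem i₀ m M s)
    (him : i₀ ≤ m) (hmn : m ≤ I.n) (hNB : ∀ z, I.NB z < max I.n 1)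
    (hR : ∀ z, R z < max I.n 1) (hv : v < max I.n 1)
    (hL : ∃ L : ℕ → ℕ, (∀ z : ℕ, s.arr 5 z = L z) ∧ ∀ z, L z < max I.n 1) :
    Runs H searchProg s (M * (m * (m * 4 + 30) + 22) + 2) fun s' =>
      (∃ L : ℕ → ℕ, (∀ z : ℕ, s'.arr 5 z = L z) ∧ ∀ z, L z < max I.n 1) ∧
      s'.reg 13 ≤ s.reg 13 ∧
      ((s'.reg 13 = s.reg 13 ∧ s'.arr 6 = s.arr 6) ∨ Saved I MK cur m s') ∧
      ∀ x < M, ∀ f, Codes I R v rem i₀ m x f → Valid MK f cur m →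
        s'.reg 13 ≤ costSeq I f m := by
  have hH := hB.two_le
  refine Runs.time_le (T := 1 + (M * (m * (m * 4 + 30) + 20 + 2) + 1)) ?_ (by ring_nf; omega)
  refine Runs.seq (Runs.assign_eq 0 hH (by decide) rfl (by simp) ?_)
  have hc' : SearchCtx I R MK cur v rem i₀ m M (s.setReg 14 0) :=
    hc.frame (P := .assign 14 (.reg 0)) ⟨fun r hr => by
      simp only [Prog.writesReg, beq_eq_false_iff_ne] at hr
      simp [Ne.symm hr], fun A _ => rfl⟩
  refine (Runs.forLoop (a := 0) (b := M) hH (fun y s' =>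
    (∃ L : ℕ → ℕ, (∀ z : ℕ, s'.arr 5 z = L z) ∧ ∀ z, L z < max I.n 1) ∧
      s'.reg 13 ≤ s.reg 13 ∧
      ((s'.reg 13 = s.reg 13 ∧ s'.arr 6 = s.arr 6) ∨ Saved I MK cur m s') ∧
      ∀ x < y, ∀ f, Codes I R v rem i₀ m x f → Valid MK f cur m → s'.reg 13 ≤ costSeq I f m)
    rfl rfl (by decide) (by simp) (by simp [hc.M]) (by omega)
    ⟨by simpa using hL, by simp, by simp, by simp⟩ ?_).mono le_rfl fun s' h => h.1
  rintro y - hy s₁ hy₁ hF ⟨⟨L, hL₁, hLn⟩, hle, hor, hcomp⟩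
  refine (runs_try hB (hc'.frame hF) hy₁ him hmn hNB hR hv hL₁ hLn).mono le_rfl ?_
  rintro s₂ ⟨hL₂, hle₂, hor₂, hcomp₂⟩
  refine ⟨by simpa using hL₂, by simpa using hle₂.trans hle, ?_, ?_⟩
  · rcases hor₂ with ⟨h1, h2⟩ | h
    · rcases hor with ⟨h3, h4⟩ | ⟨f, h3, h4, h5, h6⟩
      · exact Or.inl ⟨by simpa using h1.trans h3, by simpa using h2.trans h4⟩
      · exact Or.inr ⟨f, h3, h4, by simpa using h1.trans h5, by simpa [h2] using h6⟩
    · obtain ⟨f, h3, h4, h5, h6⟩ := h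
      exact Or.inr ⟨f, h3, h4, by simpa using h5, by simpa using h6⟩
  · intro x hx f hf hV
    simp only [State.reg_setReg]
    norm_num
    rcases Nat.lt_succ_iff_lt_or_eq.1 hx with h | rfl
    · exact hle₂.trans (hcomp x h f hf hV)
    · exact hcomp₂ f hf hV

open RAM

/-! ### Existence of codes and counting their digits. -/

/-- The neighbour lists are complete, and the parameters fit together. -/
structure Inst.Complete (I : Inst) : Prop where
  D_pos : 1 ≤ I.D
  Y_eq : I.Y = I.k * I.D
  nb : ∀ u < I.n, ∀ v < I.n, I.a u v ≠ 0 → ∃ t < I.D, I.NB (u * I.n + t) = v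

theorem add_mul_lt_of_lt {d Y x z : ℕ} (hd : d < Y) (hx : x < z) : d + Y * x < Y * z := by
  have : Y * (x + 1) ≤ Y * z := Nat.mul_le_mul_left _ hx
  rw [mul_add] at this
  omega

/-- The digit for a vertex is `q' * D + t`, where `q'` is the position of an earlier neighbour and
`t` an index in its neighbour list; it is below `k * D = Y`. Digits are put in front of `x'`, the
code of whatever follows, and `p` is where the current block starts. -/
theorem exists_code_growth {I : Inst} (hI : I.Complete) (R : ℕ → ℕ) (g : ℕ → ℕ) (p x' : ℕ)
    (m : ℕ) : ∀ i, i + m ≤ I.k → (∀ q, p ≤ q → q < i + m → g q < I.n) →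
    (∀ q, i ≤ q → q < i + m → ∃ q', p ≤ q' ∧ q' < q ∧ I.a (g q') (g q) ≠ 0) →
    p ≤ i →
    ∃ x < I.Y ^ m * (x' + 1), ∀ (L : ℕ → ℕ) (rem : ℕ), m ≤ rem →
      (∀ q, p ≤ q → q < i → L q = g q) →
      ∃ L', Dec.iter I R i m ⟨x, rem, L⟩ = ⟨x', rem - m, L'⟩ ∧
        (∀ q, p ≤ q → q < i + m → L' q = g q) ∧ ∀ q < i, L' q = L q := by
  induction m with
  | zero =>
    intro i _ _ _ _
    exact ⟨x', by simp, fun L rem _ hL => ⟨L, by simp [Dec.iter], by simpa using hL,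
      fun _ _ => rfl⟩⟩
  | succ m ih =>
    intro i hik hgn hgr hp
    obtain ⟨x₁, hx₁, hdec⟩ := ih (i + 1) (by omega) (fun q h h' => hgn q h (by omega))
      (fun q h h' => hgr q (by omega) (by omega)) (by omega)
    obtain ⟨q', hpq, hqi, ha⟩ := hgr i le_rfl (by omega)
    obtain ⟨t, ht, hnb⟩ := hI.nb _ (hgn q' hpq (by omega)) _ (hgn i hp (by omega)) ha
    have hd : q' * I.D + t < I.Y := by
      rw [hI.Y_eq]
      have : (q' + 1) * I.D ≤ I.k * I.D := Nat.mul_le_mul_right _ (by omega)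
      rw [add_mul] at this
      omega
    refine ⟨(q' * I.D + t) + I.Y * x₁, ?_, ?_⟩
    · rw [pow_succ', mul_assoc]
      exact add_mul_lt_of_lt hd hx₁
    · intro L rem hrem hL
      have hmod : ((q' * I.D + t) + I.Y * x₁) % I.Y = q' * I.D + t := by
        rw [Nat.add_mul_mod_self_left, Nat.mod_eq_of_lt hd]
      have hdiv : ((q' * I.D + t) + I.Y * x₁) / I.Y = x₁ := by
        rw [Nat.add_mul_div_left _ _ (by omega), Nat.div_eq_of_lt hd, zero_add]
      have hmod' : (q' * I.D + t) % I.D = t := by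
        rw [Nat.mul_add_mod_self_right, Nat.mod_eq_of_lt ht]
      have hdiv' : (q' * I.D + t) / I.D = q' := by
        rw [mul_comm, Nat.mul_add_div (by omega), Nat.div_eq_of_lt ht, add_zero]
      obtain ⟨L', hL', hag, hlow⟩ := hdec (Function.update L i (g i)) (rem - 1) (by omega) (by
        intro q h h'
        rw [Function.update_apply]
        split_ifs with hq
        · rw [hq]
        · exact hL q h (by omega))
      refine ⟨L', ?_, fun q h h' => hag q h (by omega), fun q hq => ?_⟩
      · rw [Dec.iter, Dec.step, if_pos (by simp; omega)]
        simp only [hmod, hdiv, hmod', hdiv', hL q' hpq hqi, hnb]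
        rw [hL']
        congr 1
        omega
      · rw [hlow q (by omega), Function.update_of_ne (by omega)]

/-- The first vertex is given separately and costs no digit. The counter starts at `s` while only `s
- 1` steps are made, so no block header is ever read. -/
theorem exists_codes_grown {I : Inst} (hI : I.Complete) (R : ℕ → ℕ) {f : ℕ → ℕ} {s : ℕ}
    (hs : 1 ≤ s) (hsk : s ≤ I.k) (hfn : ∀ i < s, f i < I.n) (hf : Grown I.a f s) :
    ∃ x < I.Y ^ I.k, Codes I R (f 0) s 1 s x f := by
  obtain ⟨x, hx, hdec⟩ := exists_code_growth hI R f 0 0 (s - 1) 1 (by omega)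
    (fun q _ h => hfn q (by omega)) (fun q h h' => by
      obtain ⟨j, hj, ha⟩ := hf.2 q (by omega) (by omega)
      exact ⟨j, by omega, hj, ha⟩) (by omega)
  have hY : 1 ≤ I.Y := by
    rw [hI.Y_eq]
    exact Nat.mul_pos (by omega) hI.D_pos
  refine ⟨x, (hx.trans_le ?_), fun L i hi => ?_⟩
  · rw [zero_add, mul_one]
    exact Nat.pow_le_pow_right hY (by omega)
  · obtain ⟨L', hL', hag, -⟩ := hdec (Function.update L 0 (f 0)) s (by omega) (fun q _ h => by
      have : q = 0 := by omega
      subst this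
      simp)
    rw [hL']
    exact hag i (by omega) (by omega)

/-- This count gives the exponent `2 * k`. For `s ≥ 2` there are one header digit, two digits for
the root index (`r < k * s ≤ Y * Y`) and `s - 1` growth digits, so `s + 2 ≤ 2 * s`. For `s = 1` that
would be one digit too many, but then `r < k ≤ Y` fits into one digit. -/
theorem exists_code_block {I : Inst} (hI : I.Complete) (R : ℕ → ℕ) (g : ℕ → ℕ) {i s r : ℕ}
    (x' : ℕ) (hs : 1 ≤ s) (his : i + s ≤ I.k) (hr : r < I.k * s)
    (hR : R (s * (I.k * I.k) + r) = g i) (hgn : ∀ q, i ≤ q → q < i + s → g q < I.n)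
    (hgr : ∀ q, i < q → q < i + s → ∃ q', i ≤ q' ∧ q' < q ∧ I.a (g q') (g q) ≠ 0) :
    ∃ x < I.Y ^ (2 * s) * (x' + 1), ∀ L : ℕ → ℕ, ∃ L',
      Dec.iter I R i s ⟨x, 0, L⟩ = ⟨x', 0, L'⟩ ∧
        (∀ q, i ≤ q → q < i + s → L' q = g q) ∧ ∀ q < i, L' q = L q := by
  have hkY : I.k ≤ I.Y := by
    rw [hI.Y_eq]
    exact Nat.le_mul_of_pos_right _ hI.D_pos
  have hY : 1 ≤ I.Y := by omega
  obtain ⟨m, rfl⟩ : ∃ m, s = m + 1 := ⟨s - 1, by omega⟩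
  have hmY : m < I.Y := by omega
  rcases Nat.eq_zero_or_pos m with rfl | hm
  · have hrY : r < I.Y := by omega
    refine ⟨0 + I.Y * (r + I.Y * x'), ?_, fun L => ⟨Function.update L i (g i), ?_, ?_, ?_⟩⟩
    · rw [show 2 * (0 + 1) = 1 + 1 by norm_num, pow_succ, pow_one, mul_assoc]
      exact add_mul_lt_of_lt (by omega) (add_mul_lt_of_lt hrY (by omega))
    · have h1 : (0 + I.Y * (r + I.Y * x')) % I.Y = 0 := by simp
      have h2 : (0 + I.Y * (r + I.Y * x')) / I.Y = r + I.Y * x' := by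
        rw [zero_add, Nat.mul_div_cancel_left _ (by omega)]
      have h3 : (r + I.Y * x') % I.Y = r := by
        rw [Nat.add_mul_mod_self_left, Nat.mod_eq_of_lt hrY]
      have h4 : (r + I.Y * x') / I.Y = x' := by
        rw [Nat.add_mul_div_left _ _ (by omega), Nat.div_eq_of_lt hrY, zero_add]
      rw [Dec.iter, Dec.iter, Dec.step, if_neg (by simp), if_neg (by rw [h1]; simp)]
      simp only [h1, h2, h3, h4, hR]
    · intro q h h'
      have : q = i := by omega
      subst this
      simp
    · intro q hq
      rw [Function.update_of_ne (by omega)]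
  · have hrY : r < I.Y * I.Y := hr.trans_le (Nat.mul_le_mul hkY (by omega))
    obtain ⟨x₁, hx₁, hdec⟩ := exists_code_growth hI R g i x' m (i + 1) (by omega)
      (fun q h h' => hgn q h (by omega)) (fun q h h' => hgr q (by omega) (by omega)) (by omega)
    refine ⟨m + I.Y * (r + I.Y * I.Y * x₁), ?_, fun L => ?_⟩
    · have h1 : m + I.Y * (r + I.Y * I.Y * x₁) <
          I.Y * (I.Y * I.Y * (I.Y ^ m * (x' + 1))) :=
        add_mul_lt_of_lt hmY (add_mul_lt_of_lt hrY hx₁)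
      refine h1.trans_le ?_
      rw [show I.Y * (I.Y * I.Y * (I.Y ^ m * (x' + 1))) = I.Y ^ (m + 3) * (x' + 1) by ring]
      exact Nat.mul_le_mul_right _ (Nat.pow_le_pow_right hY (by omega))
    · have h1 : (m + I.Y * (r + I.Y * I.Y * x₁)) % I.Y = m := by
        rw [Nat.add_mul_mod_self_left, Nat.mod_eq_of_lt hmY]
      have h2 : (m + I.Y * (r + I.Y * I.Y * x₁)) / I.Y = r + I.Y * I.Y * x₁ := by
        rw [Nat.add_mul_div_left _ _ (by omega), Nat.div_eq_of_lt hmY, zero_add]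
      have h3 : (r + I.Y * I.Y * x₁) % (I.Y * I.Y) = r := by
        rw [Nat.add_mul_mod_self_left, Nat.mod_eq_of_lt hrY]
      have h4 : (r + I.Y * I.Y * x₁) / (I.Y * I.Y) = x₁ := by
        rw [Nat.add_mul_div_left _ _ (by positivity), Nat.div_eq_of_lt hrY, zero_add]
      obtain ⟨L', hL', hag, hlow⟩ := hdec (Function.update L i (g i)) m le_rfl (fun q h h' => by
        have : q = i := by omega
        subst this
        simp)
      refine ⟨L', ?_, fun q h h' => hag q h (by omega), fun q hq => ?_⟩
      · rw [Dec.iter, Dec.step, if_neg (by simp), if_pos (by rw [h1]; omega)]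
        simp only [h1, h2, h3, h4, hR]
        rw [hL', Nat.sub_self]
      · rw [hlow q (by omega), Function.update_of_ne (by omega)]

/-- Every vertex of `W s` is listed in the row of the table `R` that belongs to `s`. -/
def Lists (k : ℕ) (R : ℕ → ℕ) (W : ℕ → Finset ℕ) : Prop :=
  ∀ s, 1 ≤ s → s ≤ k → ∀ w ∈ W s, ∃ r < k * s, R (s * (k * k) + r) = w

/-- Each member is grown from a vertex of its hitting set, which the table lists. The code of the
remaining members plays the role of `x'` in `exists_code_block`, so the digit counts add up. -/
theorem exists_code_family {I : Inst} (hI : I.Complete) {R : ℕ → ℕ} {W : ℕ → Finset ℕ}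
    (hW : Lists I.k R W) (F : List (Finset ℕ)) (hconn : ∀ C ∈ F, Conn I.a C)
    (hsub : ∀ C ∈ F, C ⊆ range I.n) (hhit : ∀ C ∈ F, ¬ Disjoint C (W C.card)) :
    ∀ i, i + (F.map Finset.card).sum ≤ I.k →
    ∃ (g : ℕ → ℕ) (x : ℕ), x < I.Y ^ (2 * (F.map Finset.card).sum) ∧
      (Ico i (i + (F.map Finset.card).sum)).image g = F.foldr (· ∪ ·) ∅ ∧
      ∀ L : ℕ → ℕ, ∃ L', Dec.iter I R i (F.map Finset.card).sum ⟨x, 0, L⟩ = ⟨0, 0, L'⟩ ∧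
        (∀ q, i ≤ q → q < i + (F.map Finset.card).sum → L' q = g q) ∧ ∀ q < i, L' q = L q := by
  induction F with
  | nil =>
    intro i _
    exact ⟨id, 0, by simp, by simp, fun L => ⟨L, by simp [Dec.iter], fun q h h' => by
      simp at h'; omega, fun _ _ => rfl⟩⟩
  | cons C F ih =>
    intro i hi
    rw [List.map_cons, List.sum_cons] at *
    have hC := hconn C (by simp)
    have hCn := hsub C (by simp)
    have hpos : 0 < C.card := card_pos.2 hC.1
    obtain ⟨g₂, x₂, hx₂, hg₂, hdec₂⟩ := ih (fun C h => hconn C (List.mem_cons_of_mem _ h))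
      (fun C h => hsub C (List.mem_cons_of_mem _ h))
      (fun C h => hhit C (List.mem_cons_of_mem _ h)) (i + C.card) (by omega)
    obtain ⟨w, hwC, hwW⟩ := not_disjoint_iff.1 (hhit C (by simp))
    obtain ⟨r, hr, hRw⟩ := hW C.card hpos (by omega) w hwW
    obtain ⟨f, hf0, hfC, hfg⟩ := hC.exists_grown hwC
    set s := C.card with hs
    obtain ⟨x, hx, hdec⟩ := exists_code_block (i := i) hI R (fun q => f (q - i)) x₂ hpos (by omega) hr
      (by simpa [hf0] using hRw)
      (fun q h h' => by
        have : f (q - i) ∈ C := by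
          rw [← hfC]
          exact mem_image_of_mem f (mem_range.2 (by omega))
        exact mem_range.1 (hCn this))
      (fun q h h' => by
        obtain ⟨j, hj, ha⟩ := hfg.2 (q - i) (by omega) (by omega)
        exact ⟨i + j, by omega, by omega, by simpa using ha⟩)
    set t := (F.map Finset.card).sum with ht
    refine ⟨fun q => if q < i + s then f (q - i) else g₂ q, x, ?_, ?_, fun L => ?_⟩
    · refine hx.trans_le ?_
      rw [Nat.mul_add 2, pow_add]
      exact Nat.mul_le_mul_left _ hx₂
    · rw [List.foldr_cons, ← hg₂, ← hfC]
      ext w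
      simp only [mem_image, mem_Ico, mem_union, mem_range]
      constructor
      · rintro ⟨q, hq, rfl⟩
        split_ifs with h
        · exact Or.inl ⟨q - i, by omega, rfl⟩
        · exact Or.inr ⟨q, by omega, rfl⟩
      · rintro (⟨q, hq, rfl⟩ | ⟨q, hq, rfl⟩)
        · exact ⟨i + q, by omega, by rw [if_pos (by omega)]; simp⟩
        · exact ⟨q, by omega, by rw [if_neg (by omega)]⟩
    · obtain ⟨L₁, hL₁, hag₁, hlow₁⟩ := hdec L
      obtain ⟨L₂, hL₂, hag₂, hlow₂⟩ := hdec₂ L₁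
      refine ⟨L₂, ?_, fun q h h' => ?_, fun q hq => ?_⟩
      · rw [Dec.iter_add, hL₁, hL₂]
      · dsimp only
        split_ifs with hq
        · rw [hlow₂ q hq, hag₁ q h hq]
        · exact hag₂ q (by omega) (by omega)
      · rw [hlow₂ q (by omega), hlow₁ q hq]

theorem costSeq_eq_cost {I : Inst} {f : ℕ → ℕ} {m : ℕ}
    (hf : ∀ i < m, ∀ j < m, f i = f j → i = j) :
    costSeq I f m = cost I.a I.c ((range m).image f) := by
  have hinj : Set.InjOn f (range m : Finset ℕ) := fun i hi j hj h =>
    hf i (by simpa using hi) j (by simpa using hj) h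
  rw [cost, sum_image hinj, costSeq, sum_sub_distrib]
  congr 1
  rw [sum_image hinj]
  exact sum_congr rfl fun i _ => (sum_image hinj).symm

theorem card_foldr_union {F : List (Finset ℕ)} (h : F.Pairwise Disjoint) :
    (F.foldr (· ∪ ·) ∅).card = (F.map Finset.card).sum := by
  induction F with
  | nil => simp
  | cons C F ih =>
    rw [List.pairwise_cons] at h
    rw [List.foldr_cons, card_union_of_disjoint, ih h.2, List.map_cons, List.sum_cons]
    clear ih
    induction F with
    | nil => simp
    | cons D F ih' =>
      rw [List.foldr_cons, disjoint_union_right]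
      exact ⟨h.1 D (by simp), ih' ⟨fun E hE => h.1 E (List.mem_cons_of_mem _ hE),
        (List.pairwise_cons.1 h.2).2⟩⟩

theorem cost_foldr_union_le {a : ℕ → ℕ → ℤ} {c : ℕ → ℤ} (ha : ∀ u v, 0 ≤ a u v)
    {F : List (Finset ℕ)} (h : F.Pairwise Disjoint) :
    cost a c (F.foldr (· ∪ ·) ∅) ≤ (F.map (cost a c)).sum := by
  induction F with
  | nil => simp [cost]
  | cons C F ih =>
    rw [List.pairwise_cons] at h
    rw [List.foldr_cons, List.map_cons, List.sum_cons]
    refine (cost_union_le ha ?_).trans (by linarith [ih h.2])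
    clear ih
    induction F with
    | nil => simp
    | cons D F ih' =>
      rw [List.foldr_cons, disjoint_union_right]
      exact ⟨h.1 D (by simp), ih' ⟨fun E hE => h.1 E (List.mem_cons_of_mem _ hE),
        (List.pairwise_cons.1 h.2).2⟩⟩

/-- Some code yields a vertex set that is at least as good as a given one. -/
theorem exists_codes_le {I : Inst} (hI : I.Complete) (ha : ∀ u v, 0 ≤ I.a u v)
    (hsymm : ∀ u v, I.a u v = I.a v u) {R : ℕ → ℕ} {W : ℕ → Finset ℕ} (hW : Lists I.k R W)
    (hH : ∀ s, 1 ≤ s → s ≤ I.k → Hitting I.a I.c (range I.n) I.k s (W s)) {S : Finset ℕ}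
    (hS : S ⊆ range I.n) (hcard : S.card = I.k) (v : ℕ) :
    ∃ x < I.Y ^ (2 * I.k), ∃ f : ℕ → ℕ, Codes I R v 0 0 I.k x f ∧
      (∀ i < I.k, ∀ j < I.k, f i = f j → i = j) ∧ costSeq I f I.k ≤ cost I.a I.c S := by
  obtain ⟨F₀, hF₀, -⟩ := exists_family hsymm I.c S
  have hF₁ : Family I.a I.c (range I.n) I.k (cost I.a I.c S) F₀ :=
    ⟨hF₀.conn, fun C hC => (hF₀.sub C hC).trans hS, hF₀.disj, by rw [hF₀.card, hcard],
      hF₀.cost_le⟩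
  obtain ⟨F, hF, hhit⟩ := hF₁.exists_hit hsymm hH
  obtain ⟨g, x, hx, hg, hdec⟩ := exists_code_family hI hW F hF.conn hF.sub hhit 0
    (by rw [hF.card]; omega)
  rw [hF.card, zero_add] at *
  rw [← range_eq_Ico] at hg
  have hinj : ∀ i < I.k, ∀ j < I.k, g i = g j → i = j := by
    -- The image is a disjoint union of total size `k`, so `g` cannot repeat a vertex.
    have : Set.InjOn g (range I.k : Finset ℕ) := by
      rw [← card_image_iff, hg, card_foldr_union hF.disj, hF.card, card_range]
    intro i hi j hj h
    exact this (by simpa using hi) (by simpa using hj) h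
  refine ⟨x, hx, g, fun L i hi => ?_, hinj, ?_⟩
  · obtain ⟨L', hL', hag, -⟩ := hdec (Function.update L 0 v)
    rw [Nat.sub_zero, hL']
    exact hag i (by omega) hi
  · rw [costSeq_eq_cost hinj, hg]
    exact (cost_foldr_union_le ha hF.disj).trans hF.cost_le

open RAM

/-! ### Filling the table of hitting sets. -/

theorem SearchCtx.update {I : Inst} {R MK R' MK' : ℕ → ℕ} {cur : ℤ} {v v' rem i₀ m M : ℕ}
    {s s' : State} {P : Prog} (h : SearchCtx I R MK cur v rem i₀ m M s) (hF : Frame P s s')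
    (hR : ∀ z : ℕ, s'.arr 3 z = R' z) (hMK : ∀ z : ℕ, s'.arr 4 z = MK' z)
    (hv : s'.reg 12 = v')
    (hr : ∀ r ∈ [0, 1, 3, 4, 7, 8, 9, 10, 11], P.writesReg r = false := by decide)
    (ha : ∀ A ∈ [0, 1, 2], P.writesArr A = false := by decide) :
    SearchCtx I R' MK' cur v' rem i₀ m M s' where
  ctx := h.ctx.frame hF (fun r h => hr r (by simp at h ⊢; omega))
    (fun r h => ha r (by simp at h ⊢; omega))
  R := hR
  MK := hMK
  M := (hF.reg 7 (hr 7 (by simp))).trans h.M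
  m := (hF.reg 8 (hr 8 (by simp))).trans h.m
  i₀ := (hF.reg 9 (hr 9 (by simp))).trans h.i₀
  rem := (hF.reg 10 (hr 10 (by simp))).trans h.rem
  cur := (hF.reg 11 (hr 11 (by simp))).trans h.cur
  v := hv

/-- Enter the best list into the table and mark its vertices. -/
def storeProg : Prog :=
  .seq (.assign 22 (.const 0)) (forLoop 22 8
    (.seq (.store 3 (.op .add (.op .mul (.reg 23) (.op .mul (.reg 1) (.reg 1)))
        (.op .add (.op .mul (.reg 24) (.reg 23)) (.reg 22))) (.get 6 (.reg 22)))
      (.store 4 (.get 6 (.reg 22)) (.reg 23))))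

/-- Row `s` starts at `s * (k * k)`, and round `j` fills its cells from `j * s` on. With `k` rounds
and `s ≤ k` the row does not run into the next one. -/
theorem runs_store {H : ℕ} (hH : 2 ≤ H) {st : State} {R MK f : ℕ → ℕ} {k s j : ℕ}
    (hk : st.reg 1 = k) (hm : st.reg 8 = s) (hs : st.reg 23 = s) (hj : st.reg 24 = j)
    (hR : ∀ z : ℕ, st.arr 3 z = R z) (hMK : ∀ z : ℕ, st.arr 4 z = MK z)
    (hf : ∀ i < s, st.arr 6 i = f i) :
    Runs H storeProg st (s * 4 + 2) fun st' => ∃ R' : ℕ → ℕ,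
      (∀ z : ℕ, st'.arr 3 z = R' z) ∧
      (∀ z : ℕ, st'.arr 4 z = ((if z ∈ (range s).image f then s else MK z : ℕ) : ℤ)) ∧
      (∀ z < s * (k * k) + j * s, R' z = R z) ∧ (∀ i < s, R' (s * (k * k) + (j * s + i)) = f i) ∧
      ∀ z, (∃ i < s, R' z = f i) ∨ R' z = R z := by
  refine Runs.time_le (T := 1 + (s * (1 + 1 + 2) + 1)) ?_ (by omega)
  refine Runs.seq (Runs.assign_eq 0 hH (by decide) rfl (by simp) ?_)
  refine (Runs.forLoop (a := 0) (b := s) hH (fun i st' => ∃ R' : ℕ → ℕ,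
      (∀ z : ℕ, st'.arr 3 z = R' z) ∧
      (∀ z : ℕ, st'.arr 4 z = ((if z ∈ (range i).image f then s else MK z : ℕ) : ℤ)) ∧
      (∀ z < s * (k * k) + j * s, R' z = R z) ∧ (∀ i' < i, R' (s * (k * k) + (j * s + i')) = f i') ∧
      ∀ z, (∃ i < s, R' z = f i) ∨ R' z = R z)
    rfl rfl (by decide) (by simp) (by simp [hm]) (by omega) ?_ ?_).mono le_rfl fun s' h => h.1
  · exact ⟨R, by simpa using hR, by simpa using hMK, fun _ _ => rfl, by simp, fun _ => Or.inr rfl⟩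
  rintro i - his s₁ hi₁ hF ⟨R₁, hR₁, hMK₁, hlow, hag, hval⟩
  have hk₁ : s₁.reg 1 = k := (hF.reg 1 rfl).trans (by simpa using hk)
  have hs₁ : s₁.reg 23 = s := (hF.reg 23 rfl).trans (by simpa using hs)
  have hj₁ : s₁.reg 24 = j := (hF.reg 24 rfl).trans (by simpa using hj)
  have hf₁ : s₁.arr 6 i = f i := by rw [hF.arr 6 rfl]; exact hf i his
  refine Runs.seq (Runs.store_eq ((s * (k * k) + (j * s + i) : ℕ) : ℤ) (f i : ℤ) hH (by decide)
    (by decide) (by simp [Expr.val, BinOp.apply, hk₁, hs₁, hj₁, hi₁])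
    (by simp [Expr.val, hi₁, hf₁]) (fun h => hf₁ ▸ h.2 6 i) ?_)
  refine Runs.store_eq (f i : ℤ) (s : ℤ) hH (by decide) (by decide)
    (by simp [Expr.val, hi₁, hf₁]) (by simp [Expr.val, hs₁]) (fun h => by
      have := h.1 23
      simpa [hs₁] using this) ?_
  refine ⟨Function.update R₁ (s * (k * k) + (j * s + i)) (f i), fun z => ?_, fun z => ?_,
    fun z hz => ?_, fun i' hi' => ?_, fun z => ?_⟩
  · simp only [State.arr_setReg, State.arr_setArr, Function.update_apply, hR₁, Nat.cast_inj]
    norm_num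
  · simp only [State.arr_setReg, State.arr_setArr, Nat.cast_inj, hMK₁, range_add_one, image_insert,
      mem_insert]
    norm_num
    by_cases h : z = f i <;> simp [h]
  · rw [Function.update_of_ne (by omega)]
    exact hlow z hz
  · rw [Function.update_apply]
    split_ifs with h
    · rw [show i' = i by omega]
    · exact hag i' (by
        rcases Nat.lt_succ_iff_lt_or_eq.1 hi' with h' | rfl
        · exact h'
        · exact absurd rfl h)
  · rw [Function.update_apply]
    split_ifs with h
    · exact Or.inl ⟨i, his, rfl⟩
    · exact hval z

/-- Find a cheapest list of unmarked vertices that some code yields, and store it. -/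
def bestProg : Prog :=
  .seq (.assign 13 (.op .add (.op .mul (.reg 0) (.reg 0)) (.const 1)))
  (.seq (.assign 12 (.const 0)) (.seq (forLoop 12 0 searchProg)
  (.ite (.op .le (.reg 13) (.op .mul (.reg 0) (.reg 0))) storeProg .skip)))

/-- A bound for the time of a search. -/
def searchTime (n M : ℕ) : ℕ := M * (n * (n * 4 + 30) + 22) + 2

theorem searchTime_mono {m n M : ℕ} (h : m ≤ n) :
    M * (m * (m * 4 + 30) + 22) + 2 ≤ searchTime n M := by
  unfold searchTime
  gcongr

/-- The list array holds vertices. -/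
def ListOk (I : Inst) (s : State) : Prop :=
  ∃ L : ℕ → ℕ, (∀ z : ℕ, s.arr 5 z = L z) ∧ ∀ z, L z < max I.n 1

theorem ListOk.frame {I : Inst} {s s' : State} {P : Prog} (h : ListOk I s) (hF : Frame P s s')
    (hP : P.writesArr 5 = false := by rfl) : ListOk I s' := by
  obtain ⟨L, hL, hLn⟩ := h
  exact ⟨L, fun z => by rw [hF.arr 5 hP]; exact hL z, hLn⟩

theorem cost_le_sq {I : Inst} {H : ℕ} (hB : I.Bounded H) {C : Finset ℕ} (hC : C ⊆ range I.n) :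
    cost I.a I.c C ≤ I.n * I.n := by
  have h1 : 0 ≤ ∑ u ∈ C, ∑ v ∈ C, I.a u v :=
    sum_nonneg fun u _ => sum_nonneg fun v _ => hB.a_nonneg u v
  have h2 : ∑ u ∈ C, I.c u ≤ C.card • (I.n : ℤ) :=
    sum_le_card_nsmul _ _ _ fun u _ => (abs_le.1 (hB.c_le u)).2
  have h3 : C.card ≤ I.n := by simpa using card_le_card hC
  rw [nsmul_eq_mul] at h2
  have h4 : (C.card : ℤ) * I.n ≤ I.n * I.n := by exact_mod_cast Nat.mul_le_mul_right _ h3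
  rw [cost]
  linarith

/-- Every connected set of unmarked vertices is reached by some code, with any of its vertices as
root. The list found need not be connected, since a digit can point outside the true neighbours;
`Hitting` asks only for size, disjointness and cost. -/
theorem runs_best {H : ℕ} {I : Inst} (hB : I.Bounded H) (hI : I.Complete) {R MK : ℕ → ℕ}
    {v s j M : ℕ} {st : State} (hc : SearchCtx I R MK s v s 1 s M st) (hM : M = I.Y ^ I.k)
    (hs : st.reg 23 = s) (hj : st.reg 24 = j) (h1s : 1 ≤ s) (hsk : s ≤ I.k) (hkn : I.k ≤ I.n)
    (hNB : ∀ z, I.NB z < max I.n 1) (hR : ∀ z, R z < max I.n 1) (hL : ListOk I st) :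
    Runs H bestProg st (I.n * (searchTime I.n M + 2) + I.n * 4 + 7) fun st' =>
      st'.reg 12 = I.n ∧ ListOk I st' ∧ ∃ R' MK' : ℕ → ℕ, (∀ z : ℕ, st'.arr 3 z = R' z) ∧
      (∀ z : ℕ, st'.arr 4 z = MK' z) ∧ (∀ z, R' z < max I.n 1) ∧
      (∀ z < s * (I.k * I.k) + j * s, R' z = R z) ∧
      ((MK' = MK ∧ ∀ C ⊆ range I.n, Conn I.a C → C.card = s → ∃ w ∈ C, MK w = s) ∨
        ∃ f : ℕ → ℕ, (∀ i < s, f i < I.n) ∧ Valid MK f s s ∧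
          (∀ C ⊆ range I.n, Conn I.a C → C.card = s → (∀ w ∈ C, MK w ≠ s) →
            costSeq I f s ≤ cost I.a I.c C) ∧
          (∀ w, MK' w = if w ∈ (range s).image f then s else MK w) ∧
          ∀ i < s, R' (s * (I.k * I.k) + (j * s + i)) = f i) := by
  have hH := hB.two_le
  have hsq := hB.sq_le
  have hsn : s ≤ I.n := hsk.trans hkn
  refine Runs.time_le (T := 1 + (1 + ((I.n * (searchTime I.n M + 2) + 1) +
    (1 + (s * 4 + 2) + 1)))) ?_ (by omega)
  -- A sentinel above the cost of every vertex set (`cost_le_sq`): a final value of at most `n * n`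
  -- means that a list was saved.
  refine Runs.seq (Runs.assign_eq ((I.n * I.n + 1 : ℕ) : ℤ) hH (by decide)
    (by simp [Expr.val, BinOp.apply, hc.ctx.n]) (fun _ => abs_natCast_le (by nlinarith)) ?_)
  refine Runs.seq (Runs.assign_eq 0 hH (by decide) rfl (by simp) ?_)
  have hF0 : Frame (.seq (.assign 13 (.reg 0)) (.assign 12 (.reg 0))) st
      ((st.setReg 13 ((I.n * I.n + 1 : ℕ) : ℤ)).setReg 12 0) := by
    refine ⟨fun r hr => ?_, fun A _ => rfl⟩
    simp only [Prog.writesReg, Bool.or_eq_false_iff, beq_eq_false_iff_ne] at hr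
    simp [Ne.symm hr.1, Ne.symm hr.2]
  have hc0 := hc.update (R' := R) (MK' := MK) (v' := 0) hF0 hc.R hc.MK (by simp)
  refine Runs.seq ((Runs.forLoop (a := 0) (b := I.n) hH (fun v s' =>
    ListOk I s' ∧ (s'.reg 13 = (I.n * I.n + 1 : ℕ) ∨ Saved I MK s s s') ∧
    ∀ v' < v, ∀ x < M, ∀ f, Codes I R v' s 1 s x f → Valid MK f s s →
      s'.reg 13 ≤ costSeq I f s)
    rfl rfl (by decide) (by simp) (by simp [hc.ctx.n]) (by omega)
    ⟨hL.frame hF0, Or.inl (by simp), by simp⟩ ?_).mono le_rfl ?_)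
  · rintro v - hv s₁ hv₁ hF ⟨hL₁, hor, hcomp⟩
    have hc₁ := hc0.update (R' := R) (MK' := MK) (v' := v) hF
      (fun z => by rw [hF.arr 3 rfl]; exact hc0.R z)
      (fun z => by rw [hF.arr 4 rfl]; exact hc0.MK z) hv₁
    refine (runs_search hB hc₁ h1s hsn hNB hR (by omega) hL₁).mono (searchTime_mono hsn) ?_
    rintro s₂ ⟨hL₂, hle, hor₂, hcomp₂⟩
    refine ⟨by simpa [ListOk] using hL₂, ?_, ?_⟩
    · rcases hor₂ with ⟨h1, h2⟩ | ⟨f, h3, h4, h5, h6⟩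
      · rcases hor with h | ⟨f, h3, h4, h5, h6⟩
        · exact Or.inl (by simpa using h1.trans h)
        · exact Or.inr ⟨f, h3, h4, by simpa using h1.trans h5, by simpa [h2] using h6⟩
      · exact Or.inr ⟨f, h3, h4, by simpa using h5, by simpa using h6⟩
    · intro v' hv' x hx f hf hV
      simp only [State.reg_setReg]
      norm_num
      rcases Nat.lt_succ_iff_lt_or_eq.1 hv' with h | rfl
      · exact hle.trans (hcomp v' h x hx f hf hV)
      · exact hcomp₂ x hx f hf hV
  rintro s₁ ⟨⟨hL₁, hor, hcomp⟩, hv₁, hF⟩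
  have hc₁ := hc0.update (R' := R) (MK' := MK) (v' := I.n) hF
    (fun z => by rw [hF.arr 3 rfl]; exact hc0.R z)
    (fun z => by rw [hF.arr 4 rfl]; exact hc0.MK z) hv₁
  have hbest : ∀ C ⊆ range I.n, Conn I.a C → C.card = s → (∀ w ∈ C, MK w ≠ s) →
      s₁.reg 13 ≤ cost I.a I.c C := by
    intro C hC hconn hCs hmk
    obtain ⟨r, hr⟩ := hconn.1
    obtain ⟨f, rfl, hfC, hfg⟩ := hconn.exists_grown hr
    rw [hCs] at hfC hfg
    have hfmem : ∀ i < s, f i ∈ C := fun i hi => by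
      rw [← hfC]
      exact mem_image_of_mem f (mem_range.2 hi)
    have hfn : ∀ i < s, f i < I.n := fun i hi => mem_range.1 (hC (hfmem i hi))
    obtain ⟨x, hx, hcodes⟩ := exists_codes_grown hI R h1s hsk hfn hfg
    rw [← hfC, ← costSeq_eq_cost hfg.1]
    exact hcomp (f 0) (hfn 0 (by omega)) x (hM ▸ hx) f hcodes
      ⟨hfg.1, fun i hi h => hmk _ (hfmem i hi) (by exact_mod_cast h)⟩
  refine Runs.ite hH (by decide) (fun ht => ?_) (fun ht => ?_)
  · have hle : s₁.reg 13 ≤ I.n * I.n := by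
      by_contra h
      simp [Expr.val, BinOp.apply, hc₁.ctx.n, h] at ht
    obtain ⟨f, hfn, hV, hcost, hBL⟩ : Saved I MK s s s₁ := by
      refine hor.resolve_left fun h => ?_
      rw [h] at hle
      push_cast at hle
      omega
    refine (runs_store hH hc₁.ctx.k hc₁.m
      ((hF.reg 23 rfl).trans (by simpa using hs)) ((hF.reg 24 rfl).trans (by simpa using hj))
      hc₁.R hc₁.MK hBL).frame.mono le_rfl ?_
    rintro s₂ ⟨⟨R', hR', hMK', hlow, hag, hval⟩, hF₂⟩
    refine ⟨(hF₂.reg 12 rfl).trans hv₁, hL₁.frame hF₂, R', _, hR', hMK', fun z => ?_, hlow, Or.inr ⟨f, hfn, hV, ?_,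
      fun w => rfl, hag⟩⟩
    · rcases hval z with ⟨i, hi, h⟩ | h
      · rw [h]
        have := hfn i hi
        omega
      · rw [h]
        exact hR z
    · intro C h1 h2 h3 h4
      rw [← hcost]
      exact hbest C h1 h2 h3 h4
  · have hlt : (I.n : ℤ) * I.n < s₁.reg 13 := by
      by_contra h
      simp [Expr.val, BinOp.apply, hc₁.ctx.n, not_lt.1 h] at ht
    refine (Runs.skip (Q := fun s' => s' = s₁) rfl).mono (by omega) ?_
    rintro _ rfl
    refine ⟨hv₁, hL₁, R, MK, hc₁.R, hc₁.MK, hR, fun _ _ => rfl, Or.inl ⟨rfl, fun C h1 h2 h3 => ?_⟩⟩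
    -- An unmarked connected set would have been found, at cost at most `n * n`.
    by_contra! h
    have := hbest C h1 h2 h3 h
    have := cost_le_sq hB h1
    omega

/-- Fill the row of the table that belongs to the size in register `23`. -/
def rowProg : Prog :=
  .seq (.assign 8 (.reg 23)) (.seq (.assign 10 (.reg 23)) (.seq (.assign 11 (.reg 23))
    (.seq (.assign 12 (.const 0)) (.seq (.assign 24 (.const 0)) (forLoop 24 1 bestProg)))))

/-- A bound for the time of filling a row. -/
def rowTime (n M : ℕ) : ℕ := n * (n * (searchTime n M + 2) + n * 4 + 9) + 6

/-- The memory between the rows of the table. -/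
structure TableCtx (I : Inst) (R MK : ℕ → ℕ) (M : ℕ) (s : State) : Prop where
  R_lt : ∀ z, R z < max I.n 1
  ctx : Ctx I s
  R : ∀ z : ℕ, s.arr 3 z = R z
  MK : ∀ z : ℕ, s.arr 4 z = MK z
  M : s.reg 7 = M
  i₀ : s.reg 9 = 1
  list : ListOk I s

/-- The mark of row `s` is `s` itself. Rows are filled in increasing order, so no vertex carries
this mark at first and the marks need no clearing. The hitting set consists of the vertices marked
`s`, and each round adds one set to it. -/
theorem runs_row {H : ℕ} {I : Inst} (hB : I.Bounded H) (hI : I.Complete) {R MK : ℕ → ℕ}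
    {s M : ℕ} {st : State} (hc : TableCtx I R MK M st) (hM : M = I.Y ^ I.k)
    (hs : st.reg 23 = s) (h1s : 1 ≤ s) (hsk : s ≤ I.k) (hkn : I.k ≤ I.n)
    (hNB : ∀ z, I.NB z < max I.n 1) (hMK : ∀ w, MK w < s) :
    Runs H rowProg st (rowTime I.n M) fun st' => ∃ R' MK' : ℕ → ℕ, ∃ W : Finset ℕ,
      TableCtx I R' MK' M st' ∧ (∀ w, MK' w ≤ s) ∧ (∀ z < s * (I.k * I.k), R' z = R z) ∧
      Hitting I.a I.c (range I.n) I.k s W ∧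
      ∀ w ∈ W, ∃ r < I.k * s, R' (s * (I.k * I.k) + r) = w := by
  have hH := hB.two_le
  have hsH : |(s : ℤ)| ≤ H := abs_natCast_le (by
    have := hB.sq_le
    have : 0 ≤ 4 * I.n * I.n := Nat.zero_le _
    omega)
  refine Runs.time_le (T := 1 + (1 + (1 + (1 + (1 +
    (I.k * (I.n * (searchTime I.n M + 2) + I.n * 4 + 7 + 2) + 1)))))) ?_ (by
      have : I.k * (I.n * (searchTime I.n M + 2) + I.n * 4 + 7 + 2) ≤
        I.n * (I.n * (searchTime I.n M + 2) + I.n * 4 + 9) := Nat.mul_le_mul_right _ hkn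
      unfold rowTime
      omega)
  refine Runs.seq (Runs.assign_eq s hH (by decide) hs (fun _ => hsH) ?_)
  refine Runs.seq (Runs.assign_eq s hH (by decide) (by simp [Expr.val, hs]) (fun _ => hsH) ?_)
  refine Runs.seq (Runs.assign_eq s hH (by decide) (by simp [Expr.val, hs]) (fun _ => hsH) ?_)
  refine Runs.seq (Runs.assign_eq 0 hH (by decide) rfl (by simp) ?_)
  refine Runs.seq (Runs.assign_eq 0 hH (by decide) rfl (by simp) ?_)
  set s₀ := ((((st.setReg 8 s).setReg 10 s).setReg 11 s).setReg 12 0).setReg 24 0 with hs₀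
  have hc₀ : SearchCtx I R MK s 0 s 1 s M s₀ :=
    ⟨hc.ctx.congr (by simp [hs₀]) (by simp [hs₀]), hc.R, hc.MK, by simp [hs₀, hc.M],
      by simp [hs₀], by simp [hs₀, hc.i₀], by simp [hs₀], by simp [hs₀], by simp [hs₀]⟩
  have hs23 : s₀.reg 23 = s := by simp [hs₀, hs]
  refine (Runs.forLoop (a := 0) (b := I.k) hH (fun j st' => ∃ R' MK' : ℕ → ℕ, ∃ v : ℕ,
      SearchCtx I R' MK' s v s 1 s M st' ∧ ListOk I st' ∧ (∀ z, R' z < max I.n 1) ∧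
      (∀ w, MK' w ≤ s) ∧ (∀ z < s * (I.k * I.k), R' z = R z) ∧
      Hitting I.a I.c (range I.n) j s {w ∈ range I.n | MK' w = s} ∧
      ∀ w, MK' w = s → ∃ r < j * s, R' (s * (I.k * I.k) + r) = w)
    rfl rfl (by decide) (by simp [hs₀]) (by simp [hs₀, hc.ctx.k]) (by omega)
    ⟨R, MK, 0, hc₀, hc.list, hc.R_lt, fun w => (hMK w).le, fun _ _ => rfl,
      fun C _ _ _ _ => ⟨fun _ => ∅, by simp, by simp⟩, fun w hw => absurd hw (hMK w).ne⟩
    ?_).mono le_rfl ?_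
  · rintro j - hj s₁ hj₁ hF ⟨R₁, MK₁, v, hc₁, hL₁, hR₁, hMK₁, hlow, hhit, hlist⟩
    refine (runs_best hB hI hc₁ hM ((hF.reg 23 rfl).trans hs23) hj₁ h1s hsk hkn hNB hR₁
      hL₁).frame.mono le_rfl ?_
    rintro s₂ ⟨⟨hv₂, hL₂, R₂, MK₂, hR₂, hMK₂, hR₂lt, hlow₂, hor⟩, hF₂⟩
    have hF₂' : Frame (.seq bestProg (.assign 24 (.reg 0))) s₁
        (s₂.setReg 24 ((j + 1 : ℕ) : ℤ)) := by
      refine ⟨fun r hr => ?_, fun A hA => ?_⟩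
      · simp only [Prog.writesReg, Bool.or_eq_false_iff, beq_eq_false_iff_ne] at hr
        rw [State.reg_setReg, if_neg (Ne.symm hr.2)]
        exact hF₂.reg r hr.1
      · simp only [Prog.writesArr, Bool.or_false] at hA
        exact hF₂.arr A hA
    refine ⟨R₂, MK₂, I.n, hc₁.update hF₂' hR₂ hMK₂ (by simpa using hv₂), by simpa [ListOk] using hL₂,
      hR₂lt, ?_, fun z hz => (hlow₂ z (by omega)).trans (hlow z hz), ?_, ?_⟩
    · intro w
      rcases hor with ⟨rfl, -⟩ | ⟨f, -, -, -, h, -⟩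
      · exact hMK₁ w
      · rw [h]
        split_ifs
        exacts [le_rfl, hMK₁ w]
    · intro C hC hconn hCs hdisj
      rcases hor with ⟨rfl, hno⟩ | ⟨f, hfn, hV, hbest, hmk, -⟩
      -- Nothing was found, so every connected set of size `s` already meets the marked vertices and
      -- the requirement is vacuous.
      · obtain ⟨w, hw, hws⟩ := hno C hC hconn hCs
        exact absurd (mem_filter.2 ⟨hC hw, hws⟩) (disjoint_left.1 hdisj hw)
      · have hunm : ∀ w ∈ C, MK₁ w ≠ s := by
          intro w hw h
          refine disjoint_left.1 hdisj hw (mem_filter.2 ⟨hC hw, ?_⟩)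
          rw [hmk]
          split_ifs
          exacts [rfl, h]
        -- A set avoiding the enlarged marked set also avoids the earlier one. The earlier rounds
        -- thus supply `j` sets, and the new list is disjoint from them because it was unmarked.
        obtain ⟨B, hB, hBd⟩ := hhit C hC hconn hCs (disjoint_left.2 fun w hw hw' =>
          hunm w hw (mem_filter.1 hw').2)
        have hdj : ∀ i < j, Disjoint (B i) ((range s).image f) := by
          intro i hi
          refine disjoint_left.2 fun w hw hw' => ?_
          obtain ⟨q, hq, rfl⟩ := mem_image.1 hw'
          refine hV.2 q (mem_range.1 hq) ?_
          exact_mod_cast (mem_filter.1 ((hB i hi).1 hw)).2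
        refine ⟨Function.update B j ((range s).image f), fun i hi => ?_, fun i hi i' hi' hne => ?_⟩
        · rcases Nat.lt_succ_iff_lt_or_eq.1 hi with h | rfl
          · rw [Function.update_of_ne h.ne]
            refine ⟨fun w hw => ?_, (hB i h).2⟩
            have := mem_filter.1 ((hB i h).1 hw)
            refine mem_filter.2 ⟨this.1, ?_⟩
            rw [hmk]
            split_ifs
            exacts [rfl, this.2]
          · rw [Function.update_self]
            refine ⟨fun w hw => ?_, fun w hw => ?_, ?_, ?_⟩
            · obtain ⟨q, hq, rfl⟩ := mem_image.1 hw
              exact mem_filter.2 ⟨mem_range.2 (hfn q (mem_range.1 hq)), by rw [hmk, if_pos hw]⟩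
            · obtain ⟨q, hq, rfl⟩ := mem_image.1 hw
              exact mem_range.2 (hfn q (mem_range.1 hq))
            · rw [card_image_of_injOn, card_range]
              intro q hq q' hq' h
              exact hV.1 q (by simpa using hq) q' (by simpa using hq') h
            · rw [← costSeq_eq_cost hV.1]
              exact hbest C hC hconn hCs hunm
        · rcases Nat.lt_succ_iff_lt_or_eq.1 hi with h | rfl
          · rcases Nat.lt_succ_iff_lt_or_eq.1 hi' with h' | rfl
            · rw [Function.update_of_ne h.ne, Function.update_of_ne h'.ne]
              exact hBd i h i' h' hne
            · rw [Function.update_of_ne h.ne, Function.update_self]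
              exact hdj i h
          · rcases Nat.lt_succ_iff_lt_or_eq.1 hi' with h' | rfl
            · rw [Function.update_of_ne h'.ne, Function.update_self]
              exact (hdj i' h').symm
            · exact absurd rfl hne
    · intro w hw
      have hold : MK₁ w = s → ∃ r < (j + 1) * s, R₂ (s * (I.k * I.k) + r) = w := by
        intro h
        obtain ⟨r, hr, hRr⟩ := hlist w h
        exact ⟨r, by rw [add_mul]; omega, by rw [hlow₂ _ (by omega), hRr]⟩
      rcases hor with ⟨rfl, -⟩ | ⟨f, -, -, -, hmk, hRf⟩
      · exact hold hw
      · rw [hmk] at hw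
        split_ifs at hw with hwf
        · obtain ⟨q, hq, rfl⟩ := mem_image.1 hwf
          have := mem_range.1 hq
          exact ⟨j * s + q, by rw [add_mul]; omega, hRf q this⟩
        · exact hold hw
  · rintro s₁ ⟨⟨R₁, MK₁, v, hc₁, hL₁, hR₁, hMK₁, hlow, hhit, hlist⟩, -, -⟩
    exact ⟨R₁, MK₁, _, ⟨hR₁, hc₁.ctx, hc₁.R, hc₁.MK, hc₁.M, hc₁.i₀, hL₁⟩, hMK₁, hlow, hhit,
      fun w hw => hlist w (mem_filter.1 hw).2⟩

/-- Fill the table. -/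
def tableProg : Prog :=
  .seq (.assign 25 (.op .add (.reg 1) (.const 1))) (.seq (.assign 9 (.const 1))
    (.seq (.assign 7 (.reg 5)) (.seq (.assign 23 (.const 1)) (forLoop 23 25 rowProg))))

theorem runs_table {H : ℕ} {I : Inst} (hB : I.Bounded H) (hI : I.Complete) {st : State}
    (hc : Ctx I st) (hM : st.reg 5 = (I.Y ^ I.k : ℕ)) (hR : ∀ z : ℕ, st.arr 3 z = 0)
    (hMK : ∀ z : ℕ, st.arr 4 z = 0) (hL : ∀ z : ℕ, st.arr 5 z = 0) (hkn : I.k ≤ I.n)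
    (hNB : ∀ z, I.NB z < max I.n 1) :
    Runs H tableProg st ((I.n + 1) * (rowTime I.n (I.Y ^ I.k) + 2) + 5) fun st' =>
      ∃ R MK : ℕ → ℕ, ∃ W : ℕ → Finset ℕ, TableCtx I R MK (I.Y ^ I.k) st' ∧ Lists I.k R W ∧
        ∀ s, 1 ≤ s → s ≤ I.k → Hitting I.a I.c (range I.n) I.k s (W s) := by
  have hH := hB.two_le
  have hnH : I.n + 1 ≤ H := by
    have := hB.sq_le
    have : 0 ≤ 4 * I.n * I.n := Nat.zero_le _
    omega
  refine Runs.time_le (T := 1 + (1 + (1 + (1 +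
    ((I.k + 1) * (rowTime I.n (I.Y ^ I.k) + 2) + 1))))) ?_ (by
      have : (I.k + 1) * (rowTime I.n (I.Y ^ I.k) + 2) ≤
        (I.n + 1) * (rowTime I.n (I.Y ^ I.k) + 2) := Nat.mul_le_mul_right _ (by omega)
      omega)
  refine Runs.seq (Runs.assign_eq ((I.k + 1 : ℕ) : ℤ) hH (by decide)
    (by simp [Expr.val, BinOp.apply, hc.k]) (fun _ => abs_natCast_le (by omega)) ?_)
  refine Runs.seq (Runs.assign_eq 1 hH (by decide) rfl (by simp; omega) ?_)
  refine Runs.seq (Runs.assign_eq ((I.Y ^ I.k : ℕ) : ℤ) hH (by decide) (by simp [Expr.val, hM])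
    (fun hs => by simpa [hM] using hs.1 5) ?_)
  refine Runs.seq (Runs.assign_eq 1 hH (by decide) rfl (by simp; omega) ?_)
  set s₀ := (((st.setReg 25 ((I.k + 1 : ℕ) : ℤ)).setReg 9 1).setReg 7
    ((I.Y ^ I.k : ℕ) : ℤ)).setReg 23 1 with hs₀
  refine (Runs.forLoop (a := 1) (b := I.k + 1) hH (fun s st' => ∃ R MK : ℕ → ℕ,
      ∃ W : ℕ → Finset ℕ, TableCtx I R MK (I.Y ^ I.k) st' ∧ (∀ w, MK w < s) ∧
      ∀ s', 1 ≤ s' → s' < s → Hitting I.a I.c (range I.n) I.k s' (W s') ∧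
        ∀ w ∈ W s', ∃ r < I.k * s', R (s' * (I.k * I.k) + r) = w)
    rfl rfl (by decide) (by simp [hs₀]) (by simp [hs₀]) (by omega)
    ⟨fun _ => 0, fun _ => 0, fun _ => ∅, ⟨by simp, hc.congr (by simp [hs₀]) (by simp [hs₀]),
      by simpa [hs₀] using hR, by simpa [hs₀] using hMK, by simp [hs₀], by simp [hs₀],
      ⟨fun _ => 0, by simpa [hs₀] using hL, by simp⟩⟩, by simp, by omega⟩ ?_).mono le_rfl ?_
  · rintro s h1s hs s₁ hs₁ hF ⟨R₁, MK₁, W, hc₁, hMK₁, hW⟩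
    refine (runs_row hB hI hc₁ rfl hs₁ h1s (by omega) hkn hNB hMK₁).mono le_rfl ?_
    rintro s₂ ⟨R₂, MK₂, W', hc₂, hMK₂, hlow, hhit, hlist⟩
    refine ⟨R₂, MK₂, Function.update W s W', ⟨hc₂.R_lt, hc₂.ctx.congr (by simp) (by simp), hc₂.R,
      hc₂.MK, by simpa using hc₂.M, by simpa using hc₂.i₀, hc₂.list⟩,
      fun w => Nat.lt_succ_of_le (hMK₂ w), fun s' h1s' hs' => ?_⟩
    rcases Nat.lt_succ_iff_lt_or_eq.1 hs' with h | rfl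
    · rw [Function.update_of_ne h.ne]
      refine ⟨(hW s' h1s' h).1, fun w hw => ?_⟩
      obtain ⟨r, hr, hRr⟩ := (hW s' h1s' h).2 w hw
      refine ⟨r, hr, ?_⟩
      rw [hlow, hRr]
      -- The entries of an earlier row end before row `s` begins, where the memory was left
      -- unchanged.
      have h1 : I.k * s' ≤ I.k * I.k := Nat.mul_le_mul_left _ (by omega)
      have h2 : (s' + 1) * (I.k * I.k) ≤ s * (I.k * I.k) := Nat.mul_le_mul_right _ h
      rw [add_mul] at h2
      omega
    · rw [Function.update_self]
      exact ⟨hhit, hlist⟩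
  · rintro s₁ ⟨⟨R, MK, W, hc₁, -, hW⟩, -, -⟩
    exact ⟨R, MK, W, hc₁, fun s h h' => (hW s h (by omega)).2,
      fun s h h' => (hW s h (by omega)).1⟩

open RAM

/-! ### Neighbour lists, vertex weights, maximum degree and powers. -/

/-- The number of neighbours of `v` below `u`. -/
def degBelow (a : ℕ → ℕ → ℤ) (v u : ℕ) : ℕ := #{w ∈ range u | a v w ≠ 0}

theorem degBelow_succ (a : ℕ → ℕ → ℤ) (v u : ℕ) :
    degBelow a v (u + 1) = degBelow a v u + if a v u ≠ 0 then 1 else 0 := by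
  rw [degBelow, degBelow, range_add_one, filter_insert]
  split_ifs with h
  · rw [card_insert_of_notMem (by simp)]
  · rfl

theorem degBelow_le (a : ℕ → ℕ → ℤ) (v u : ℕ) : degBelow a v u ≤ u :=
  (card_filter_le _ _).trans_eq (card_range u)

/-- Inspect a possible neighbour. -/
def scanProg : Prog :=
  .ite (.get 0 (.op .add (.op .mul (.reg 12) (.reg 0)) (.reg 26)))
    (.seq (.store 2 (.op .add (.op .mul (.reg 12) (.reg 0)) (.reg 27)) (.reg 26))
      (.assign 27 (.op .add (.reg 27) (.const 1)))) .skip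

/-- The weight of a vertex whose degree is in register `27`. -/
def weightExpr (cut : Bool) : Expr := if cut then .reg 27 else .const 0

/-- Compute the neighbour lists, the vertex weights, and the maximum degree. -/
def initProg (cut : Bool) : Prog :=
  .seq (.assign 3 (.const 1)) (.seq (.assign 12 (.const 0)) (forLoop 12 0
    (.seq (.assign 27 (.const 0)) (.seq (.assign 26 (.const 0)) (.seq (forLoop 26 0 scanProg)
    (.seq (.store 1 (.reg 12) (weightExpr cut))
      (.ite (.op .le (.reg 27) (.reg 3)) .skip (.assign 3 (.reg 27)))))))))

theorem runs_scan {H : ℕ} (hH : 2 ≤ H) {a : ℕ → ℕ → ℤ} {n v : ℕ} (hn : n + 1 ≤ H) (hv : v < n)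
    {s : State} {NB : ℕ → ℕ} (h0 : s.reg 0 = n) (h12 : s.reg 12 = v) (h26 : s.reg 26 = 0)
    (h27 : s.reg 27 = 0)
    (ha : ∀ u < n, ∀ v < n, s.arr 0 ((u : ℤ) * n + v) = a u v)
    (hNB : ∀ z : ℕ, s.arr 2 z = NB z) (hNBn : ∀ z, NB z < max n 1) :
    Runs H (forLoop 26 0 scanProg) s (n * 6 + 1) fun s' => s'.reg 27 = degBelow a v n ∧
      ∃ NB' : ℕ → ℕ, (∀ z : ℕ, s'.arr 2 z = NB' z) ∧ (∀ z, NB' z < max n 1) ∧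
      (∀ z < v * n, NB' z = NB z) ∧
      ∀ u < n, a v u ≠ 0 → ∃ t < degBelow a v n, NB' (v * n + t) = u := by
  refine (Runs.forLoop (T := 1 + (1 + 1) + 1) (a := 0) (b := n) hH (fun u s' =>
      s'.reg 27 = degBelow a v u ∧
      ∃ NB' : ℕ → ℕ, (∀ z : ℕ, s'.arr 2 z = NB' z) ∧ (∀ z, NB' z < max n 1) ∧
      (∀ z < v * n, NB' z = NB z) ∧
      ∀ w < u, a v w ≠ 0 → ∃ t < degBelow a v u, NB' (v * n + t) = w)
    rfl rfl (by decide) (by simp [h26]) h0 (by omega)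
    ⟨by simp [h27, degBelow], NB, hNB, hNBn, fun _ _ => rfl, by omega⟩ ?_).mono (by omega)
    fun s' h => h.1
  rintro u - hu s₁ hu₁ hF ⟨hd, NB₁, hNB₁, hNBn₁, hlow, hlist⟩
  have h0₁ : s₁.reg 0 = n := (hF.reg 0 rfl).trans h0
  have h12₁ : s₁.reg 12 = v := (hF.reg 12 rfl).trans h12
  have hcell : s₁.arr 0 ((v : ℤ) * n + u) = a v u := by rw [hF.arr 0 rfl]; exact ha v hv u hu
  have hdu := degBelow_le a v u
  refine Runs.ite hH (by decide) (fun ht => ?_) (fun ht => ?_)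
  · have hne : a v u ≠ 0 := by
      simpa only [Expr.val, BinOp.apply, h12₁, h0₁, hu₁, hcell] using ht
    refine Runs.seq (Runs.store_eq ((v * n + degBelow a v u : ℕ) : ℤ) (u : ℤ) hH (by decide)
      (by decide) (by simp [Expr.val, BinOp.apply, h12₁, h0₁, hd]) hu₁
      (fun _ => abs_natCast_le (by omega)) ?_)
    refine Runs.assign_eq ((degBelow a v u + 1 : ℕ) : ℤ) hH (by decide)
      (by simp [Expr.val, BinOp.apply, hd]) (fun _ => abs_natCast_le (by omega)) ?_
    refine ⟨by simp [degBelow_succ, hne], Function.update NB₁ (v * n + degBelow a v u) u,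
      fun z => ?_, fun z => ?_, fun z hz => ?_, fun w hw haw => ?_⟩
    · simp only [State.arr_setReg, State.arr_setArr, Function.update_apply, hNB₁, Nat.cast_inj]
      split_ifs <;> simp_all
    · rw [Function.update_apply]
      split_ifs
      · omega
      · exact hNBn₁ z
    · rw [Function.update_of_ne (by omega)]
      exact hlow z hz
    · rw [degBelow_succ, if_pos hne]
      rcases Nat.lt_succ_iff_lt_or_eq.1 hw with h | rfl
      · obtain ⟨t, ht, htw⟩ := hlist w h haw
        exact ⟨t, by omega, by rw [Function.update_of_ne (by omega), htw]⟩
      · exact ⟨degBelow a v w, by omega, by simp⟩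
  · have he : a v u = 0 := by
      simpa only [Expr.val, BinOp.apply, h12₁, h0₁, hu₁, hcell] using ht
    refine (Runs.skip (Q := fun s' => s' = s₁) rfl).mono le_rfl ?_
    rintro _ rfl
    refine ⟨by simp [degBelow_succ, he, hd], NB₁, by simpa using hNB₁, hNBn₁, hlow,
      fun w hw haw => ?_⟩
    rcases Nat.lt_succ_iff_lt_or_eq.1 hw with h | rfl
    · obtain ⟨t, ht, htw⟩ := hlist w h haw
      exact ⟨t, by rw [degBelow_succ]; omega, htw⟩
    · exact absurd he haw

/-- The weight of a vertex of degree `d`. -/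
def weight (cut : Bool) (d : ℕ) : ℤ := if cut then d else 0

theorem runs_init {H : ℕ} (hH : 2 ≤ H) (cut : Bool) {a : ℕ → ℕ → ℤ} {n : ℕ} (hn : n + 1 ≤ H)
    {s : State} (h0 : s.reg 0 = n)
    (ha : ∀ u < n, ∀ v < n, s.arr 0 ((u : ℤ) * n + v) = a u v)
    (hNB : ∀ z : ℕ, s.arr 2 z = 0) :
    Runs H (initProg cut) s (n * (n * 6 + 9) + 3) fun s' => ∃ D : ℕ, ∃ NB : ℕ → ℕ,
      s'.reg 3 = D ∧ 1 ≤ D ∧ (∀ u < n, degBelow a u n ≤ D) ∧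
      (D = 1 ∨ ∃ u < n, degBelow a u n = D) ∧
      (∀ u < n, s'.arr 1 u = weight cut (degBelow a u n)) ∧ (∀ z : ℕ, s'.arr 2 z = NB z) ∧
      (∀ z, NB z < max n 1) ∧
      ∀ u < n, ∀ v < n, a u v ≠ 0 → ∃ t < degBelow a u n, NB (u * n + t) = v := by
  have hw : (weightExpr cut).Light := by cases cut <;> decide
  refine Runs.time_le (T := 1 + (1 + (n * ((1 + (1 + (n * 6 + 1 + (1 + (1 + 1 + 1))))) + 2) + 1)))
    ?_ (by ring_nf; omega)
  -- Starting the maximum at `1` produces `max Δ 1`, which keeps `D` positive for edgeless graphs.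
  refine Runs.seq (Runs.assign_eq 1 hH (by decide) rfl (by simp; omega) ?_)
  refine Runs.seq (Runs.assign_eq 0 hH (by decide) rfl (by simp) ?_)
  refine (Runs.forLoop (a := 0) (b := n) hH (fun v s' => ∃ D : ℕ, ∃ NB : ℕ → ℕ,
      s'.reg 3 = D ∧ 1 ≤ D ∧ (∀ u < v, degBelow a u n ≤ D) ∧
      (D = 1 ∨ ∃ u < v, degBelow a u n = D) ∧
      (∀ u < v, s'.arr 1 u = weight cut (degBelow a u n)) ∧ (∀ z : ℕ, s'.arr 2 z = NB z) ∧
      (∀ z, NB z < max n 1) ∧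
      ∀ u < v, ∀ v < n, a u v ≠ 0 → ∃ t < degBelow a u n, NB (u * n + t) = v)
    rfl rfl (by decide) (by simp) (by simp [h0]) (by omega)
    ⟨1, fun _ => 0, by simp, le_rfl, by omega, Or.inl rfl, by omega, by simpa using hNB, by simp,
      by omega⟩ ?_).mono le_rfl fun s' h => h.1
  rintro v - hv s₁ hv₁ hF ⟨D, NB, hD, hD1, hDge, hDex, hc, hNB₁, hNBn, hlist⟩
  have h0₁ : s₁.reg 0 = n := (hF.reg 0 rfl).trans (by simpa using h0)
  have ha₁ : ∀ u < n, ∀ v < n, s₁.arr 0 ((u : ℤ) * n + v) = a u v := fun u hu v hv => by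
    rw [hF.arr 0 rfl]
    exact ha u hu v hv
  refine Runs.seq (Runs.assign_eq 0 hH (by decide) rfl (by simp) ?_)
  refine Runs.seq (Runs.assign_eq 0 hH (by decide) rfl (by simp) ?_)
  refine Runs.seq ((runs_scan hH hn hv (a := a) (NB := NB) (by simp [h0₁]) (by simp [hv₁])
    (by simp) (by simp) (by simpa using ha₁) (by simpa using hNB₁) hNBn).frame.mono le_rfl ?_)
  rintro s₂ ⟨⟨h27, NB', hNB₂, hNBn₂, hlow, hlist₂⟩, hF₂⟩
  have hdn := degBelow_le a v n
  have hv₂ : s₂.reg 12 = v := (hF₂.reg 12 rfl).trans (by simpa using hv₁)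
  have hD₂ : s₂.reg 3 = D := (hF₂.reg 3 rfl).trans (by simpa using hD)
  have hc₂ : ∀ u < v, s₂.arr 1 u = weight cut (degBelow a u n) := fun u hu => by
    rw [hF₂.arr 1 rfl]
    simpa using hc u hu
  have hwb : |weight cut (degBelow a v n)| ≤ H := by
    cases cut
    · simp [weight]
    · exact abs_natCast_le (by omega)
  have hlist' : ∀ u < v + 1, ∀ w < n, a u w ≠ 0 →
      ∃ t < degBelow a u n, NB' (u * n + t) = w := by
    intro u hu w hw haw
    rcases Nat.lt_succ_iff_lt_or_eq.1 hu with h | rfl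
    · obtain ⟨t, ht, htw⟩ := hlist u h w hw haw
      refine ⟨t, ht, ?_⟩
      rw [hlow, htw]
      have h1 := degBelow_le a u n
      have h2 : (u + 1) * n ≤ v * n := Nat.mul_le_mul_right _ h
      rw [add_mul] at h2
      omega
    · exact hlist₂ w hw haw
  refine Runs.seq (Runs.store_eq (v : ℤ) (weight cut (degBelow a v n)) hH (by decide) hw hv₂
    (by cases cut <;> simp [weightExpr, weight, Expr.val, h27]) (fun _ => hwb) ?_)
  have hc' : ∀ u < v + 1, (if (u : ℤ) = v then weight cut (degBelow a v n) else s₂.arr 1 u) =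
      weight cut (degBelow a u n) := by
    intro u hu
    split_ifs with h
    · rw [Nat.cast_inj] at h
      rw [h]
    · rw [Nat.cast_inj] at h
      exact hc₂ u (by omega)
  refine Runs.ite hH (by decide) (fun ht => ?_) (fun ht => ?_)
  · have hle : degBelow a v n ≤ D := by
      by_contra h
      simp [Expr.val, BinOp.apply, h27, hD₂, h] at ht
    refine Runs.skip ⟨D, NB', by simpa using hD₂, hD1, fun u hu => ?_, ?_, by simpa using hc',
      by simpa using hNB₂, hNBn₂, hlist'⟩
    · rcases Nat.lt_succ_iff_lt_or_eq.1 hu with h | rfl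
      exacts [hDge u h, hle]
    · exact hDex.imp id fun ⟨u, hu, h⟩ => ⟨u, by omega, h⟩
  · have hlt : D < degBelow a v n := by
      by_contra h
      simp [Expr.val, BinOp.apply, h27, hD₂, not_lt.1 h] at ht
    refine Runs.assign_eq ((degBelow a v n : ℕ) : ℤ) hH (by decide) (by simp [Expr.val, h27])
      (fun _ => abs_natCast_le (by omega)) ?_
    refine ⟨degBelow a v n, NB', by simp, by omega, fun u hu => ?_, Or.inr ⟨v, by omega, rfl⟩,
      by simpa using hc', by simpa using hNB₂, hNBn₂, hlist'⟩
    rcases Nat.lt_succ_iff_lt_or_eq.1 hu with h | rfl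
    exacts [(hDge u h).trans hlt.le, le_rfl]

/-- Compute the base of the codes and its `k`-th power. -/
def powProg : Prog :=
  .seq (.assign 4 (.op .mul (.reg 1) (.reg 3))) (.seq (.assign 5 (.const 1))
    (.seq (.assign 22 (.const 0)) (forLoop 22 1 (.assign 5 (.op .mul (.reg 5) (.reg 4))))))

theorem runs_pow {H : ℕ} (hH : 2 ≤ H) {s : State} {k D : ℕ} (hk : s.reg 1 = k) (hD : s.reg 3 = D)
    (hD1 : 1 ≤ D) (hkD : (k * D) ^ k ≤ H) :
    Runs H powProg s (k * 3 + 4) fun s' => s'.reg 4 = (k * D : ℕ) ∧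
      s'.reg 5 = ((k * D) ^ k : ℕ) := by
  -- Smaller powers are bounded by the last one only if the base is positive. For `k = 0` the base
  -- vanishes, but only the exponent `0` occurs.
  have hpow : ∀ i ≤ k, (k * D) ^ i ≤ H := by
    intro i hi
    rcases Nat.eq_zero_or_pos k with rfl | hk
    · rw [Nat.le_zero.1 hi]
      simpa using hkD
    · exact (Nat.pow_le_pow_right (Nat.mul_pos hk hD1) hi).trans hkD
  have hY : k * D ≤ H := by
    rcases Nat.eq_zero_or_pos k with rfl | hk
    · simp
    · simpa using hpow 1 hk
  refine Runs.time_le (T := 1 + (1 + (1 + (k * (1 + 2) + 1)))) ?_ (by omega)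
  refine Runs.seq (Runs.assign_eq ((k * D : ℕ) : ℤ) hH (by decide)
    (by simp [Expr.val, BinOp.apply, hk, hD]) (fun _ => abs_natCast_le hY) ?_)
  refine Runs.seq (Runs.assign_eq 1 hH (by decide) rfl (by simp; omega) ?_)
  refine Runs.seq (Runs.assign_eq 0 hH (by decide) rfl (by simp) ?_)
  refine (Runs.forLoop (a := 0) (b := k) hH (fun i s' => s'.reg 5 = ((k * D) ^ i : ℕ))
    rfl rfl (by decide) (by simp) (by simp [hk]) (by omega) (by simp) ?_).mono le_rfl ?_
  · rintro i - hi s₁ - hF h5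
    have h4 : s₁.reg 4 = (k * D : ℕ) := (hF.reg 4 rfl).trans (by simp)
    refine Runs.assign_eq (((k * D) ^ (i + 1) : ℕ) : ℤ) hH (by decide)
      (by simp [Expr.val, BinOp.apply, h5, h4, pow_succ])
      (fun _ => abs_natCast_le (hpow _ hi)) (by simp)
  · rintro s₁ ⟨h5, -, hF⟩
    exact ⟨(hF.reg 4 rfl).trans (by simp), h5⟩

/-! ### The final search over whole solutions. -/

/-- The threshold for the cost. -/
def thresholdExpr (cut : Bool) : Expr := if cut then .reg 2 else .op .mul (.const (-2)) (.reg 2)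

/-- The threshold for the cost. -/
def threshold (cut : Bool) (p : ℤ) : ℤ := if cut then p else -2 * p

/-- The last phase: try all codes for the whole vertex set. -/
def finalProg (cut : Bool) : Prog :=
  .seq (.assign 7 (.op .mul (.reg 5) (.reg 5))) (.seq (.assign 8 (.reg 1))
  (.seq (.assign 9 (.const 0)) (.seq (.assign 10 (.const 0)) (.seq (.assign 11 (.const (-1)))
  (.seq (.assign 12 (.const 0)) (.seq (.assign 13 (.op .add (.op .mul (.reg 0) (.reg 0)) (.const 1)))
  (.seq searchProg (.assign 0 (.op .le (.reg 13) (thresholdExpr cut))))))))))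

theorem runs_final {H : ℕ} {I : Inst} (hB : I.Bounded H) (hI : I.Complete)
    (hsymm : ∀ u v, I.a u v = I.a v u) {cut : Bool} {p : ℤ} {st : State} {R MK : ℕ → ℕ}
    {W : ℕ → Finset ℕ} (hc : TableCtx I R MK (I.Y ^ I.k) st) (hW : Lists I.k R W)
    (hhit : ∀ s, 1 ≤ s → s ≤ I.k → Hitting I.a I.c (range I.n) I.k s (W s))
    (h5 : st.reg 5 = (I.Y ^ I.k : ℕ)) (h2 : st.reg 2 = p) (hkn : I.k ≤ I.n)
    (hYH : I.Y ^ (2 * I.k) ≤ H) (hNB : ∀ z, I.NB z < max I.n 1) :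
    Runs H (finalProg cut) st (searchTime I.n (I.Y ^ (2 * I.k)) + 8) fun s' =>
      ((∃ S ⊆ range I.n, S.card = I.k ∧ cost I.a I.c S ≤ threshold cut p) → s'.reg 0 = 1) ∧
      ((¬ ∃ S ⊆ range I.n, S.card = I.k ∧ cost I.a I.c S ≤ threshold cut p) → s'.reg 0 = 0) := by
  have hH := hB.two_le
  have hsq := hB.sq_le
  have hq : (Expr.op .le (.reg 13) (thresholdExpr cut)).Light := by cases cut <;> decide
  have hn2 : I.n * I.n + 1 ≤ H := by nlinarith
  have hnH : I.n ≤ H := by nlinarith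
  refine Runs.time_le (T := 1 + (1 + (1 + (1 + (1 + (1 + (1 +
    (searchTime I.n (I.Y ^ (2 * I.k)) + 1)))))))) ?_ (by omega)
  refine Runs.seq (Runs.assign_eq ((I.Y ^ (2 * I.k) : ℕ) : ℤ) hH (by decide)
    (by simp [Expr.val, BinOp.apply, h5, two_mul, pow_add]) (fun _ => abs_natCast_le hYH) ?_)
  refine Runs.seq (Runs.assign_eq (I.k : ℤ) hH (by decide) (by simp [Expr.val, hc.ctx.k])
    (fun _ => abs_natCast_le (by omega)) ?_)
  refine Runs.seq (Runs.assign_eq 0 hH (by decide) rfl (by simp) ?_)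
  refine Runs.seq (Runs.assign_eq 0 hH (by decide) rfl (by simp) ?_)
  -- Marks are natural numbers, so with `-1` as the current mark every vertex counts as unmarked.
  refine Runs.seq (Runs.assign_eq (-1) hH (by decide) rfl (by simp; omega) ?_)
  refine Runs.seq (Runs.assign_eq 0 hH (by decide) rfl (by simp) ?_)
  refine Runs.seq (Runs.assign_eq ((I.n * I.n + 1 : ℕ) : ℤ) hH (by decide)
    (by simp [Expr.val, BinOp.apply, hc.ctx.n]) (fun _ => abs_natCast_le hn2) ?_)
  set s₀ := ((((((st.setReg 7 ((I.Y ^ (2 * I.k) : ℕ) : ℤ)).setReg 8 I.k).setReg 9 0).setReg 10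
    0).setReg 11 (-1)).setReg 12 0).setReg 13 ((I.n * I.n + 1 : ℕ) : ℤ) with hs₀
  have hc₀ : SearchCtx I R MK (-1) 0 0 0 I.k (I.Y ^ (2 * I.k)) s₀ :=
    ⟨hc.ctx.congr (by simp [hs₀]) (by simp [hs₀]), hc.R, hc.MK, by simp [hs₀], by simp [hs₀],
      by simp [hs₀], by simp [hs₀], by simp [hs₀], by simp [hs₀]⟩
  refine Runs.seq ((runs_search hB hc₀ (by omega) hkn hNB hc.R_lt (by omega)
    hc.list).frame.mono (searchTime_mono hkn) ?_)
  rintro s₁ ⟨⟨-, -, hor, hcomp⟩, hF⟩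
  have h2₁ : s₁.reg 2 = p := (hF.reg 2 rfl).trans (by simp [hs₀, h2])
  have hopt : ∀ S ⊆ range I.n, S.card = I.k → s₁.reg 13 ≤ cost I.a I.c S := by
    intro S hS hcard
    obtain ⟨x, hx, f, hcodes, hinj, hle⟩ :=
      exists_codes_le hI hB.a_nonneg hsymm hW hhit hS hcard 0
    exact (hcomp x hx f hcodes ⟨hinj, fun i _ => by omega⟩).trans hle
  obtain ⟨f, hfn, hV, hcost, -⟩ : Saved I MK (-1) I.k s₁ := by
    -- Since `k ≤ n`, the set `range k` is a candidate of cost at most `n * n`, so the sentinel has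
    -- been replaced.
    refine hor.resolve_left fun h => ?_
    have h1 := hopt (range I.k) (range_subset_range.2 hkn) (by simp)
    have h2 := cost_le_sq hB (range_subset_range.2 hkn)
    have h3 := h.1
    simp only [hs₀, State.reg_setReg] at h3
    norm_num at h3
    omega
  have hf : ∃ S ⊆ range I.n, S.card = I.k ∧ cost I.a I.c S = s₁.reg 13 := by
    refine ⟨(range I.k).image f, fun w hw => ?_, ?_, ?_⟩
    · obtain ⟨q, hq, rfl⟩ := mem_image.1 hw
      exact mem_range.2 (hfn q (mem_range.1 hq))
    · rw [card_image_of_injOn, card_range]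
      intro q hq q' hq' h
      exact hV.1 q (by simpa using hq) q' (by simpa using hq') h
    · rw [hcost, costSeq_eq_cost hV.1]
  have hval : (Expr.op .le (.reg 13) (thresholdExpr cut)).val s₁ =
      if s₁.reg 13 ≤ threshold cut p then 1 else 0 := by
    cases cut <;> simp [thresholdExpr, threshold, Expr.val, BinOp.apply, h2₁]
  refine Runs.assign_eq _ hH hq hval (fun _ => ?_) ⟨?_, ?_⟩
  · split_ifs <;> simp
    omega
  · rintro ⟨S, hS, hcard, hle⟩
    simp [(hopt S hS hcard).trans hle]
  · intro hno
    obtain ⟨S, hS, hcard, heq⟩ := hf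
    have : ¬ s₁.reg 13 ≤ threshold cut p := fun h => hno ⟨S, hS, hcard, heq ▸ h⟩
    simp [this]

open RAM

/-! ### From graphs and edge counts to matrices and costs. -/

open Classical in
/-- The adjacency matrix, with natural numbers as vertices. -/
noncomputable def adjMat {n : ℕ} (G : SimpleGraph (Fin n)) (u v : ℕ) : ℤ :=
  if ∃ (hu : u < n) (hv : v < n), G.Adj ⟨u, hu⟩ ⟨v, hv⟩ then 1 else 0

theorem adjMat_symm {n : ℕ} (G : SimpleGraph (Fin n)) (u v : ℕ) :
    adjMat G u v = adjMat G v u := by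
  unfold adjMat
  congr 1
  exact propext ⟨fun ⟨a, b, h⟩ => ⟨b, a, h.symm⟩, fun ⟨a, b, h⟩ => ⟨b, a, h.symm⟩⟩

theorem adjMat_val {n : ℕ} (G : SimpleGraph (Fin n)) [DecidableRel G.Adj] (i j : Fin n) :
    adjMat G i j = if G.Adj i j then 1 else 0 := by
  simp [adjMat]

theorem input_arr {n : ℕ} (G : SimpleGraph (Fin n)) (k : ℕ) (p : ℤ) {u v : ℕ} (hu : u < n)
    (hv : v < n) : (input G k p).arr 0 ((u : ℤ) * n + v) = adjMat G u v := by
  simp only [input, adjMat]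
  congr 1
  refine propext ⟨?_, ?_⟩
  · rintro ⟨-, i, j, h, heq⟩
    have heq' : u * n + v = (i : ℕ) * n + j := by exact_mod_cast heq
    have hn : 0 < n := by omega
    have h1 : u = i := by
      have := congrArg (· / n) heq'
      simpa [mul_comm _ n, Nat.mul_add_div hn, Nat.div_eq_of_lt hv,
        Nat.div_eq_of_lt j.isLt] using this
    subst h1
    have h2 : v = j := by omega
    subst h2
    exact ⟨i.isLt, j.isLt, h⟩
  · rintro ⟨hu, hv, h⟩
    exact ⟨rfl, _, _, h, rfl⟩

theorem degBelow_adjMat {n : ℕ} (G : SimpleGraph (Fin n)) [DecidableRel G.Adj] (i : Fin n) :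
    degBelow (adjMat G) i n = G.degree i := by
  rw [degBelow, ← SimpleGraph.card_neighborFinset_eq_degree, ← card_map Fin.valEmbedding]
  congr 1
  ext w
  simp only [mem_filter, mem_range, mem_map, SimpleGraph.mem_neighborFinset]
  constructor
  · rintro ⟨hw, h⟩
    unfold adjMat at h
    split_ifs at h with h'
    · obtain ⟨_, _, h'⟩ := h'
      exact ⟨⟨w, hw⟩, h', rfl⟩
    · exact absurd rfl h
  · rintro ⟨j, h, rfl⟩
    exact ⟨j.isLt, by simp [adjMat_val, h]⟩

theorem eq_max_maxDeg {n : ℕ} (G : SimpleGraph (Fin n)) {D : ℕ} (h1 : 1 ≤ D)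
    (hge : ∀ u < n, degBelow (adjMat G) u n ≤ D)
    (hex : D = 1 ∨ ∃ u < n, degBelow (adjMat G) u n = D) : D = max (maxDeg G) 1 := by
  classical
  have hmax : maxDeg G = G.maxDegree := by
    unfold maxDeg
    congr
  rw [hmax]
  apply le_antisymm
  · rcases hex with rfl | ⟨u, hu, rfl⟩
    · exact le_max_right _ _
    · have := degBelow_adjMat G ⟨u, hu⟩
      simp only at this
      rw [this]
      refine le_max_of_le_left ?_
      convert G.degree_le_maxDegree ⟨u, hu⟩
  · refine max_le (G.maxDegree_le_of_forall_degree_le D fun i => ?_) h1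
    have := hge i i.isLt
    rw [degBelow_adjMat] at this
    convert this

theorem sum_adj_eq {V : Type*} [Fintype V] (G : SimpleGraph V) [DecidableRel G.Adj] :
    ∑ i, ∑ j, (if G.Adj i j then (1 : ℤ) else 0) = 2 * G.edgeSet.ncard := by
  classical
  have h := G.sum_degrees_eq_twice_card_edges
  rw [← SimpleGraph.coe_edgeFinset, Set.ncard_coe_finset]
  rw [← Nat.cast_two, ← Nat.cast_mul, ← h, Nat.cast_sum]
  refine sum_congr rfl fun i _ => ?_
  rw [← SimpleGraph.card_neighborFinset_eq_degree, sum_boole]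
  congr 2
  ext j
  simp

/-- This is the handshake formula for the graph `K` of edges inside `S`. -/
theorem sum_inner {V : Type*} [Fintype V] [DecidableEq V] (G : SimpleGraph V)
    [DecidableRel G.Adj] (S : Finset V) :
    ∑ i ∈ S, ∑ j ∈ S, (if G.Adj i j then (1 : ℤ) else 0) = 2 * innerEdges G S := by
  classical
  obtain ⟨K, hKA⟩ : ∃ K : SimpleGraph V, ∀ i j, K.Adj i j ↔ G.Adj i j ∧ i ∈ S ∧ j ∈ S :=
    ⟨{ Adj := fun i j => G.Adj i j ∧ i ∈ S ∧ j ∈ S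
       symm := ⟨fun i j h => ⟨h.1.symm, h.2.2, h.2.1⟩⟩
       loopless := ⟨fun i h => G.loopless.irrefl i h.1⟩ }, fun _ _ => Iff.rfl⟩
  have hK : K.edgeSet = {e ∈ G.edgeSet | ∀ v ∈ e, v ∈ S} := by
    ext e
    induction e with
    | _ x y => simp [hKA]
  rw [innerEdges, ← hK, ← sum_adj_eq K]
  rw [← sum_filter_add_sum_filter_not univ (fun i => i ∈ S), filter_mem_eq_inter, univ_inter,
    sum_eq_zero (s := univ.filter _), add_zero]
  · refine sum_congr rfl fun i hi => ?_
    rw [← sum_filter_add_sum_filter_not univ (fun i => i ∈ S), filter_mem_eq_inter, univ_inter,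
      sum_eq_zero (s := univ.filter _), add_zero]
    · refine sum_congr rfl fun j hj => ?_
      simp [hKA, hi, hj]
    · intro j hj
      simp [hKA, (mem_filter.1 hj).2]
  · intro i hi
    simp [hKA, (mem_filter.1 hi).2]

/-- The handshake formula for the bipartite graph `K` of crossing edges counts every crossing edge
once from each side; by symmetry the two halves agree. -/
theorem sum_cut {V : Type*} [Fintype V] [DecidableEq V] (G : SimpleGraph V)
    [DecidableRel G.Adj] (S : Finset V) :
    ∑ i ∈ S, ∑ j ∈ Sᶜ, (if G.Adj i j then (1 : ℤ) else 0) = cutEdges G S := by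
  classical
  obtain ⟨K, hKA⟩ : ∃ K : SimpleGraph V, ∀ i j, K.Adj i j ↔ G.Adj i j ∧ (i ∈ S ↔ j ∉ S) :=
    ⟨{ Adj := fun i j => G.Adj i j ∧ (i ∈ S ↔ j ∉ S)
       symm := ⟨fun i j h => ⟨h.1.symm, by tauto⟩⟩
       loopless := ⟨fun i h => G.loopless.irrefl i h.1⟩ }, fun _ _ => Iff.rfl⟩
  have hK : K.edgeSet = {e ∈ G.edgeSet | (∃ v ∈ e, v ∈ S) ∧ ∃ v ∈ e, v ∉ S} := by
    ext e
    induction e with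
    | _ x y =>
      simp [hKA]
      tauto
  have h := sum_adj_eq K
  rw [hK] at h
  have h1 : ∑ i, ∑ j, (if K.Adj i j then (1 : ℤ) else 0) =
      ∑ i ∈ S, ∑ j ∈ Sᶜ, (if G.Adj i j then (1 : ℤ) else 0) +
      ∑ i ∈ Sᶜ, ∑ j ∈ S, (if G.Adj i j then (1 : ℤ) else 0) := by
    rw [← sum_add_sum_compl S]
    congr 1
    · refine sum_congr rfl fun i hi => ?_
      rw [← sum_add_sum_compl S, sum_eq_zero, zero_add]
      · refine sum_congr rfl fun j hj => ?_
        rw [mem_compl] at hj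
        simp [hKA, hi, hj]
      · intro j hj
        simp [hKA, hi, hj]
    · refine sum_congr rfl fun i hi => ?_
      rw [mem_compl] at hi
      rw [← sum_add_sum_compl S, sum_eq_zero (s := Sᶜ), add_zero]
      · refine sum_congr rfl fun j hj => ?_
        simp [hKA, hi, hj]
      · intro j hj
        rw [mem_compl] at hj
        simp [hKA, hi, hj]
  have h2 : ∑ i ∈ Sᶜ, ∑ j ∈ S, (if G.Adj i j then (1 : ℤ) else 0) =
      ∑ i ∈ S, ∑ j ∈ Sᶜ, (if G.Adj i j then (1 : ℤ) else 0) := by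
    rw [sum_comm]
    simp only [G.adj_comm]
  rw [h1, h2] at h
  have h3 : (2 : ℤ) * (∑ i ∈ S, ∑ j ∈ Sᶜ, (if G.Adj i j then (1 : ℤ) else 0)) =
      2 * (cutEdges G S : ℤ) := by
    rw [two_mul]
    exact h
  linarith

/-- The vertex weights for the two problems. -/
noncomputable def vertexWeight (cut : Bool) {n : ℕ} (G : SimpleGraph (Fin n)) (u : ℕ) : ℤ :=
  weight cut (degBelow (adjMat G) u n)

/-- With degrees as weights, the double sum removes from each degree the neighbours inside `S` and
leaves those outside. -/
theorem cost_map (cut : Bool) {n : ℕ} (G : SimpleGraph (Fin n)) (S : Finset (Fin n)) :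
    cost (adjMat G) (vertexWeight cut G) (S.map Fin.valEmbedding) =
      if cut then (cutEdges G S : ℤ) else -2 * innerEdges G S := by
  classical
  simp only [cost, sum_map, Fin.valEmbedding_apply, adjMat_val, vertexWeight, degBelow_adjMat]
  cases cut
  · rw [sum_inner]
    simp [weight]
  · rw [← sum_sub_distrib, if_pos rfl, ← sum_cut]
    refine sum_congr rfl fun i _ => ?_
    rw [sub_eq_iff_eq_add, add_comm, sum_add_sum_compl, sum_boole, weight, if_pos rfl,
      ← SimpleGraph.card_neighborFinset_eq_degree]
    congr 2
    ext j
    simp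

/-- The problem that is solved. -/
def problem (cut : Bool) : Problem := if cut then minCut else kDensestSubgraph

theorem problem_iff (cut : Bool) {n : ℕ} (G : SimpleGraph (Fin n)) (k : ℕ) (p : ℤ) :
    problem cut n G k p ↔ ∃ S ⊆ range n, S.card = k ∧
      cost (adjMat G) (vertexWeight cut G) S ≤ threshold cut p := by
  have h1 : problem cut n G k p ↔ ∃ S : Finset (Fin n), S.card = k ∧
      cost (adjMat G) (vertexWeight cut G) (S.map Fin.valEmbedding) ≤ threshold cut p := by
    simp only [cost_map]
    cases cut
    · refine exists_congr fun S => and_congr_right fun _ => ?_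
      simp only [Goal.Meets, value, one_mul, zero_mul, add_zero, threshold, Bool.false_eq_true,
        if_false]
      have : (p : ℝ) ≤ (innerEdges G S : ℕ) ↔ p ≤ innerEdges G S := by exact_mod_cast Iff.rfl
      rw [this]
      omega
    · refine exists_congr fun S => and_congr_right fun _ => ?_
      simp only [Goal.Meets, value, one_mul, zero_mul, zero_add, threshold, if_true]
      exact_mod_cast Iff.rfl
  rw [h1]
  constructor
  · rintro ⟨S, hS, h⟩
    refine ⟨S.map Fin.valEmbedding, fun w hw => ?_, by rw [card_map, hS], h⟩
    obtain ⟨i, -, rfl⟩ := mem_map.1 hw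
    exact mem_range.2 i.isLt
  · rintro ⟨S, hS, hcard, h⟩
    have hmap : (S.attachFin fun w hw => mem_range.1 (hS hw)).map Fin.valEmbedding = S :=
      map_valEmbedding_attachFin _
    refine ⟨S.attachFin fun w hw => mem_range.1 (hS hw), ?_, ?_⟩
    · rw [card_attachFin, hcard]
    · rw [hmap]
      exact h

/-! ### The whole program. -/

/-- The program for the two problems. -/
def mainProg (cut : Bool) : Prog :=
  .ite (.op .le (.reg 1) (.reg 0))
    (.seq (initProg cut) (.seq powProg (.seq tableProg (finalProg cut)))) (.assign 0 (.const 0))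

/-- A bound for the time when `k ≤ n`, where `Y` is the base of the codes. -/
def mainTime (n k Y : ℕ) : ℕ :=
  n * (n * 6 + 9) + 3 + (k * 3 + 4 + ((n + 1) * (rowTime n (Y ^ k) + 2) + 5 +
    (searchTime n (Y ^ (2 * k)) + 8))) + 2

theorem runs_main (cut : Bool) {n : ℕ} (G : SimpleGraph (Fin n)) {k : ℕ} (p : ℤ) {H : ℕ}
    (hsq : 4 * n * n + 4 * n + 4 ≤ H) (hkn : k ≤ n)
    (hYH : (k * max (maxDeg G) 1) ^ (2 * k) ≤ H) :
    Runs H (mainProg cut) (input G k p) (mainTime n k (k * max (maxDeg G) 1)) fun s' =>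
      (problem cut n G k p → s'.reg 0 = 1) ∧ (¬ problem cut n G k p → s'.reg 0 = 0) := by
  have hH : 2 ≤ H := by
    have := Nat.zero_le (4 * n * n)
    omega
  have hn1 : n + 1 ≤ H := by nlinarith
  have hr0 : (input G k p).reg 0 = n := rfl
  have hr1 : (input G k p).reg 1 = k := rfl
  have hr2 : (input G k p).reg 2 = p := rfl
  have harr : ∀ A, A ≠ 0 → ∀ z, (input G k p).arr A z = 0 := fun A hA z => by simp [input, hA]
  rw [problem_iff]
  set Y := k * max (maxDeg G) 1 with hY
  refine Runs.time_le (T := 1 + (n * (n * 6 + 9) + 3 + (k * 3 + 4 +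
    ((n + 1) * (rowTime n (Y ^ k) + 2) + 5 + (searchTime n (Y ^ (2 * k)) + 8)))) + 1) ?_
    (by unfold mainTime; omega)
  refine Runs.ite hH (by decide) (fun _ => ?_) (fun ht => ?_)
  swap
  · simp [Expr.val, BinOp.apply, hr0, hr1, hkn] at ht
  refine Runs.seq ((runs_init hH cut hn1 hr0 (fun u hu v hv => input_arr G k p hu hv)
    (fun z => harr 2 (by norm_num) z)).frame.mono le_rfl ?_)
  rintro s₁ ⟨⟨D, NB, hD, hD1, hDge, hDex, hc, hNB, hNBn, hlist⟩, hF₁⟩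
  have hDeq := eq_max_maxDeg G hD1 hDge hDex
  rw [← hDeq] at hY
  have hpk : Y ^ k ≤ Y ^ (2 * k) := by
    rcases Nat.eq_zero_or_pos k with rfl | hk
    · simp
    · exact Nat.pow_le_pow_right (hY ▸ Nat.mul_pos hk hD1) (by omega)
  refine Runs.seq ((runs_pow (k := k) hH ((hF₁.reg 1 rfl).trans hr1) hD hD1
    (by rw [← hY]; omega)).frame.mono le_rfl ?_)
  rintro s₂ ⟨⟨h4, h5⟩, hF₂⟩
  rw [← hY] at h4 h5
  let I : Inst := ⟨n, k, D, Y, adjMat G, vertexWeight cut G, NB⟩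
  have hB : I.Bounded H := by
    refine ⟨hH, hsq, fun u => ?_, fun u v => ?_, fun u v => ?_⟩
    · have := degBelow_le (adjMat G) u n
      cases cut
      · simp [I, vertexWeight, weight]
      · simpa [I, vertexWeight, weight] using this
    · simp only [I, adjMat]
      split_ifs <;> norm_num
    · simp only [I, adjMat]
      split_ifs <;> norm_num
  have hI : I.Complete := ⟨hD1, hY, fun u hu v hv h => by
    obtain ⟨t, ht, htv⟩ := hlist u hu v hv h
    exact ⟨t, ht.trans_le (hDge u hu), htv⟩⟩
  have harr₂ : ∀ A, (initProg cut).writesArr A = false → powProg.writesArr A = false →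
      s₂.arr A = (input G k p).arr A := fun A h h' => (hF₂.arr A h').trans (hF₁.arr A h)
  have hctx : Ctx I s₂ := by
    refine ⟨?_, ?_, ?_, h4, fun u hu v hv => ?_, fun u hu => ?_, fun z => ?_⟩
    · exact (hF₂.reg 0 rfl).trans ((hF₁.reg 0 rfl).trans hr0)
    · exact (hF₂.reg 1 rfl).trans ((hF₁.reg 1 rfl).trans hr1)
    · exact (hF₂.reg 3 rfl).trans hD
    · rw [harr₂ 0 rfl rfl]
      exact input_arr G k p hu hv
    · rw [hF₂.arr 1 rfl]
      exact hc u hu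
    · rw [hF₂.arr 2 rfl]
      exact hNB z
  refine Runs.seq ((runs_table hB hI hctx h5 (fun z => by
    rw [harr₂ 3 rfl rfl]; exact harr 3 (by norm_num) z) (fun z => by
    rw [harr₂ 4 rfl rfl]; exact harr 4 (by norm_num) z) (fun z => by
    rw [harr₂ 5 rfl rfl]; exact harr 5 (by norm_num) z) hkn hNBn).frame.mono le_rfl ?_)
  rintro s₃ ⟨⟨R, MK, W, hT, hW, hhit⟩, hF₃⟩
  exact runs_final hB hI (adjMat_symm G) hT hW hhit ((hF₃.reg 5 rfl).trans h5)
    ((hF₃.reg 2 rfl).trans ((hF₂.reg 2 rfl).trans ((hF₁.reg 2 rfl).trans hr2))) hkn hYH hNBn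

open RAM

/-! ### Estimating the running time. -/

theorem searchTime_le {n N M M' : ℕ} (hn : n + 1 ≤ N) (hM : M' ≤ M) (hM1 : 1 ≤ M) :
    searchTime n M' ≤ 58 * (M * N ^ 2) := by
  have hN : 1 ≤ N ^ 2 := Nat.one_le_pow _ _ (by omega)
  have h1 : n * (n * 4 + 30) + 22 ≤ 56 * N ^ 2 := by nlinarith
  have h2 : 1 ≤ M * N ^ 2 := Nat.mul_pos hM1 hN
  calc searchTime n M' ≤ M * (56 * N ^ 2) + 2 := by
        unfold searchTime
        gcongr
    _ ≤ 58 * (M * N ^ 2) := by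
        rw [Nat.mul_left_comm]
        omega

theorem rowTime_le {n N M M' : ℕ} (hn : n + 1 ≤ N) (hM : M' ≤ M) (hM1 : 1 ≤ M) :
    rowTime n M' ≤ 79 * (M * N ^ 4) := by
  have hN : 1 ≤ N := by omega
  have h1 := searchTime_le hn hM hM1
  have hpow : ∀ i, i ≤ 4 → N ^ i ≤ M * N ^ 4 := fun i hi =>
    (Nat.pow_le_pow_right hN hi).trans (Nat.le_mul_of_pos_left _ hM1)
  have e0 := hpow 0 (by omega)
  have e1 := hpow 1 (by omega)
  have e2 := hpow 2 (by omega)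
  rw [pow_zero] at e0
  rw [pow_one] at e1
  calc rowTime n M' ≤ N * (N * (58 * (M * N ^ 2) + 2) + N * 4 + 9) + 6 := by
        unfold rowTime
        gcongr <;> omega
    _ = 58 * (M * N ^ 4) + 6 * N ^ 2 + 9 * N + 6 := by ring
    _ ≤ 79 * (M * N ^ 4) := by omega

/-- Every monomial is raised to the top one, so `179` is the sum of the coefficients; `58` and `79`
in the two preceding bounds arise in the same way. -/
theorem mainTime_le {n k N Y : ℕ} (hn : n + 1 ≤ N) (hk : k ≤ n) (hY : 1 ≤ Y ^ (2 * k))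
    (hkY : Y ^ k ≤ Y ^ (2 * k)) : mainTime n k Y ≤ 179 * (Y ^ (2 * k) * N ^ 5) := by
  have hN : 1 ≤ N := by omega
  have h1 := searchTime_le hn (le_refl (Y ^ (2 * k))) hY
  have h2 := rowTime_le hn hkY hY
  set M := Y ^ (2 * k)
  have hpow : ∀ i, i ≤ 5 → N ^ i ≤ M * N ^ 5 := fun i hi =>
    (Nat.pow_le_pow_right hN hi).trans (Nat.le_mul_of_pos_left _ hY)
  have e0 := hpow 0 (by omega)
  have e1 := hpow 1 (by omega)
  have e2 := hpow 2 (by omega)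
  have e3 : M * N ^ 2 ≤ M * N ^ 5 := Nat.mul_le_mul_left _ (Nat.pow_le_pow_right hN (by omega))
  rw [pow_zero] at e0
  rw [pow_one] at e1
  calc mainTime n k Y ≤ N * (N * 6 + 9) + 3 + (N * 3 + 4 + (N * (79 * (M * N ^ 4) + 2) + 5 +
        (58 * (M * N ^ 2) + 8))) + 2 := by
        unfold mainTime
        gcongr <;> omega
    _ = 6 * N ^ 2 + 14 * N + 79 * (M * N ^ 5) + 58 * (M * N ^ 2) + 22 := by ring
    _ ≤ 179 * (M * N ^ 5) := by omega

theorem small_input {n : ℕ} (G : SimpleGraph (Fin n)) {k : ℕ} {p : ℤ} {H : ℕ} (hn : n ≤ H)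
    (hk : k ≤ H) (hp : p.natAbs ≤ H) (h1 : 1 ≤ H) : Small H (input G k p) := by
  refine ⟨fun r => ?_, fun A z => ?_⟩
  · simp only [input]
    split_ifs
    · exact abs_natCast_le hn
    · exact abs_natCast_le hk
    · rw [Int.abs_eq_natAbs]
      exact_mod_cast hp
    · simp
  · simp only [input]
    split_ifs
    · simpa using h1
    · simp

theorem maxDeg_le {n : ℕ} (G : SimpleGraph (Fin n)) : maxDeg G ≤ n := by
  classical
  unfold maxDeg
  refine SimpleGraph.maxDegree_le_of_forall_degree_le _ _ fun i => ?_
  exact (G.degree_lt_card_verts i).le.trans_eq (Fintype.card_fin n)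

/-- A bound for the length of the numbers in memory. -/
theorem bitLen_bound {n k N Y q : ℕ} (hn : n + 1 ≤ N) (hk : k ≤ n) (hN : 2 ≤ N)
    (hY : Y ≤ N * N) (hq : q ≤ 2 ^ N) :
    bitLen ((4 * n * n + 4 * n + 4 + Y ^ (2 * k) + q : ℕ) : ℤ) ≤ 6 * N ^ 2 := by
  -- Since `N ≤ X`, each summand is at most `X ^ (4 * N)`, whose length is of order `N ^ 2`.
  set X := 2 ^ N with hX
  have hNX : N ≤ X := Nat.lt_two_pow_self.le
  have hX4 : 4 ≤ X := by
    have : 2 ^ 2 ≤ 2 ^ N := Nat.pow_le_pow_right (by omega) hN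
    omega
  have hX1 : 1 ≤ X := by omega
  have h1 : 4 * n * n + 4 * n + 4 ≤ X ^ (4 * N) := by
    have h3 : X ^ 3 ≤ X ^ (4 * N) := Nat.pow_le_pow_right hX1 (by omega)
    have h4 : (n + 1) * (n + 1) ≤ X * X := Nat.mul_le_mul (by omega) (by omega)
    have h5 : 4 * (X * X) ≤ X * (X * X) := Nat.mul_le_mul_right _ hX4
    have h6 : X ^ 3 = X * (X * X) := by ring
    nlinarith
  have h2 : Y ^ (2 * k) ≤ X ^ (4 * N) := by
    calc Y ^ (2 * k) ≤ (X ^ 2) ^ (2 * k) :=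
          Nat.pow_le_pow_left (hY.trans (by rw [pow_two]; exact Nat.mul_le_mul hNX hNX)) _
      _ = X ^ (4 * k) := by rw [← pow_mul]; congr 1; ring
      _ ≤ X ^ (4 * N) := Nat.pow_le_pow_right hX1 (by omega)
  have h3 : q ≤ X ^ (4 * N) := hq.trans (by
    simpa using Nat.pow_le_pow_right hX1 (show 1 ≤ 4 * N by omega))
  have h4 : 0 < X ^ (4 * N) := by positivity
  have h5 : 4 * n * n + 4 * n + 4 + Y ^ (2 * k) + q < 2 ^ (N * (4 * N + 1)) := by
    rw [pow_mul 2 N, ← hX, pow_succ X (4 * N)]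
    have := Nat.mul_le_mul_left (X ^ (4 * N)) hX4
    omega
  refine (bitLen_le (by rw [Int.natAbs_natCast]; exact h5)).trans ?_
  nlinarith

theorem solvable (cut : Bool) :
    SolvableInOStar (problem cut) (fun Δ k => (max Δ 1 * k) ^ (2 * k)) := by
  refine ⟨mainProg cut, 179 * 1200, 7, fun n G k p => ?_⟩
  set N := inputSize n k p with hN
  have hbk := one_le_bitLen k
  have hbp := one_le_bitLen p
  have hnN : n + 2 ≤ N := by rw [hN, inputSize]; omega
  have hp : p.natAbs ≤ 2 ^ N := by
    have h1 := natAbs_lt_two_pow_bitLen p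
    have h2 : 2 ^ bitLen p ≤ 2 ^ N := Nat.pow_le_pow_right (by omega) (by
      rw [hN, inputSize]; omega)
    omega
  have hfY : (max (maxDeg G) 1 * k) ^ (2 * k) = (k * max (maxDeg G) 1) ^ (2 * k) := by
    rw [mul_comm]
  beta_reduce
  rw [hfY]
  set Y := k * max (maxDeg G) 1 with hY
  -- For `k = 0` the base is `0`, and the convention `0 ^ 0 = 1` keeps the time bound positive.
  have hYpos : ∀ i, i = 0 ∨ 0 < k → 1 ≤ Y ^ i := by
    rintro i (rfl | hk)
    · simp
    · exact Nat.one_le_pow _ _ (Nat.mul_pos hk (by omega))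
  have hM1 : 1 ≤ Y ^ (2 * k) := hYpos _ (by omega)
  have hfinish : ∀ {H T : ℕ}, Small H (input G k p) → bitLen H ≤ 6 * N ^ 2 →
      T ≤ 179 * (Y ^ (2 * k) * N ^ 5) →
      Runs H (mainProg cut) (input G k p) T (fun s' =>
        (problem cut n G k p → s'.reg 0 = 1) ∧ (¬ problem cut n G k p → s'.reg 0 = 0)) →
      ∃ (s : State) (t : ℕ), Exec (mainProg cut) (input G k p) s t ∧
        (problem cut n G k p → s.reg 0 = 1) ∧ (¬ problem cut n G k p → s.reg 0 = 0) ∧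
        t ≤ 179 * 1200 * Y ^ (2 * k) * N ^ 7 := by
    intro H T hsm hb hT hrun
    obtain ⟨s, t, hex, ht, -, hyes, hno⟩ := hrun hsm
    refine ⟨s, t, hex, hyes, hno, ht.trans ?_⟩
    calc T * (200 * bitLen H) ≤ 179 * (Y ^ (2 * k) * N ^ 5) * (200 * (6 * N ^ 2)) := by gcongr
      _ = 179 * 1200 * Y ^ (2 * k) * N ^ 7 := by ring
  rcases le_or_gt k n with hkn | hkn
  · have hkY : Y ^ k ≤ Y ^ (2 * k) := by
      rw [two_mul, pow_add]
      exact Nat.le_mul_of_pos_left _ (hYpos _ (by omega))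
    have hYN : Y ≤ N * N := by
      have := maxDeg_le G
      exact Nat.mul_le_mul (by omega) (by omega)
    have h0 := Nat.zero_le (4 * n * n)
    exact hfinish (small_input G (by omega) (by omega) (by omega) (by omega))
      (bitLen_bound (by omega) hkn (by omega) hYN hp)
      (mainTime_le (by omega) hkn hM1 hkY) (runs_main cut G p (by omega) hkn (by rw [← hY]; omega))
  · have hno : ¬ problem cut n G k p := by
      rw [problem_iff]
      rintro ⟨S, hS, hcard, -⟩
      have := card_le_card hS
      rw [card_range] at this
      omega
    have hX : N ≤ 2 ^ N := Nat.lt_two_pow_self.le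
    have hk : k ≤ 2 ^ N := by
      have h1 := natAbs_lt_two_pow_bitLen k
      have h2 : 2 ^ bitLen k ≤ 2 ^ N := Nat.pow_le_pow_right (by omega) (by
        rw [hN, inputSize]; omega)
      rw [Int.natAbs_natCast] at h1
      omega
    -- For `k > n` the number `k` may be exponential in `N`, so `H` must not contain `Y ^ (2 * k)`.
    -- The program only compares `k` with `n` and rejects.
    refine hfinish (H := n + k + p.natAbs + 2) (T := 2)
      (small_input G (by omega) (by omega) (by omega) (by omega)) ?_ ?_ ?_
    · refine (bitLen_le (m := N + 3) ?_).trans (by nlinarith)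
      rw [Int.natAbs_natCast, pow_add]
      omega
    · have : 1 ≤ Y ^ (2 * k) * N ^ 5 := Nat.mul_pos hM1 (Nat.one_le_pow _ _ (by omega))
      omega
    · refine Runs.ite (T := 0) (T' := 1) (by omega) (by decide) (fun ht => ?_) (fun _ => ?_)
      · exfalso
        simp [Expr.val, BinOp.apply, input, not_le.2 hkn] at ht
      · exact Runs.assign_eq 0 (by omega) (by decide) rfl (fun _ => by rw [abs_zero]; positivity)
          ⟨fun h => absurd h hno, fun _ => by simp⟩

end LocalPartition

theorem mainTheorem10 :
    LocalPartition.SolvableInOStar LocalPartition.kDensestSubgraph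
        (fun Δ k => (max Δ 1 * k) ^ (2 * k)) ∧
      LocalPartition.SolvableInOStar LocalPartition.minCut
        (fun Δ k => (max Δ 1 * k) ^ (2 * k)) :=
  ⟨LocalPartition.solvable false, LocalPartition.solvable true⟩
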